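/- For $\tau=\tau_1+i\tau_2$ in the upper half-plane put $q=e^{2\pi i\tau}$, $u=e^{2\pi i\xi}$, let $\theta(\xi,\tau)=\sum_{\nu\in\mathbb Z+1/2}(-1)^{\nu-1/2}q^{\nu^2/2}u^{\nu}$, let $\eta$ be the Dedekind eta function and $$G(\xi,\tau)=-\frac14\log\left|\frac{\theta(\xi,\tau)}{\eta(\tau)}\right|^2+\frac{\pi(\operatorname{Im}\xi)^2}{2\tau_2}.$$ With $\mathcal E_\tau=\mathbb C/(\tau\mathbb Z+\mathbb Z)$, for integers $l_1,l_2,l_3\ge 0$ let $$D_{l_1,l_2,l_3}(\tau)=\int_{\mathcal E_\tau^2}G(\xi,\tau)^{l_1}G(\nu,\tau)^{l_2}G(\xi-\nu,\tau)^{l_3}\,\frac{d\xi\,d\nu}{\tau_2^2}.$$ Let $\mathcal B$ be the $\mathbb Q$-algebra spanned over $\mathbb Q$ by the convergent sums $$\zeta(A)=\sum_{x_1,\dots,x_n\ge 1}\ \prod_{i=1}^r\frac1{a_{i1}x_1+\dots+a_{in}x_n},$$ where $A=(a_{ij})$ is an $r\times n$ matrix with entries in $\{0,1\}$ and no zero row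 (the empty matrix gives $\zeta(A)=1$). **(a)** For all $l_1,l_2,l_3$ there is exactly one Laurent polynomial $d_{l_1,l_2,l_3}(y)$ with real coefficients such that, as $\tau_2\to\infty$, $$D_{l_1,l_2,l_3}(\tau)=4^{-(l_1+l_2+l_3)}\,d_{l_1,l_2,l_3}(\pi\tau_2)+O(e^{-\pi\tau_2})\quad\text{uniformly in }\tau_1,$$ and $\int_0^1D_{l_1,l_2,l_3}(\tau_1+i\tau_2)\,d\tau_1=4^{-(l_1+l_2+l_3)}\,d_{l_1,l_2,l_3}(\pi\tau_2)+O(e^{-\pi\tau_2})$ (the zero mode; the integrand is integrable for all large $\tau_2$). All coefficients of $d_{l_1,l_2,l_3}$ belong to $\mathcal B$. **(b)** For integers $m_1,m_2,m_3\ge1$ and $\alpha,\beta\ge0$ let $$R(m_1,m_2,m_3;\alpha,\beta)=\sum_{k,h,t}\frac{1}{\prod_i|k_i|\,\prod_i|h_i|\,\prod_i|t_i|\,(\|k\|+\|h\|)^{\alpha}(\|k\|+\|t\|)^{\beta}},$$ the sum being over vectors $k,h,t$ of $m_1,m_2,m_3$ non-zero integers with $\sum_i k_i+\sum_i h_i=0=\sum_i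 k_i+\sum_i t_i$, and $\|k\|=\sum_i|k_i|$. This series converges absolutely, its sum belongs to $\mathcal B$, and $$R(m_1,m_2,m_3;\alpha,\beta)=\frac{m_1!\,m_2!\,m_3!}{2^{\alpha+\beta+m_1+m_2+m_3-6}}\sum_{l_1,l_2,l_3\ge1}\frac{K_{m_1}(l_1)K_{m_2}(l_2)K_{m_3}(l_3)}{(l_1+l_2)^{\alpha}(l_1+l_3)^{\beta}\,l_1^2l_2^2l_3^2}$$ $$\qquad+\,2\,\frac{m_1!\,m_2!\,m_3!}{2^{\alpha+\beta}}\sum_{a\ge1}\ \sum_{l_1,l_2,l_3\ge0}\frac{c_{m_1}(l_1,a)\,c_{m_2}(l_2,a)\,c_{m_3}(l_3,a)}{(l_1+l_2+a)^{\alpha}(l_1+l_3+a)^{\beta}},$$ both series being absolutely convergent. Here $$K_m(l)=\sum\frac{4^N}{n_1^{\gamma_1}\cdots n_N^{\gamma_N}}$$ over all $N\ge0$, $l>n_1>\dots>n_N>0$ and $\gamma_1,\dots,\gamma_N\in\{1,2\}$ with $\gamma_1+\dots+\gamma_N=m-2$ (so $K_1=0$); with $H_N(L)=\sum_{L>n_1>\dots>n_N>0}\frac1{n_1\cdots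 n_N}$ one puts $$c_m(0,a)=\frac{H_{m-1}(a)}{a},\qquad c_m(l,a)=\sum_{\substack{N,D\ge0\\N+D=m-2}}\frac{H_N(l+a)\,H_D(l)}{(l+a)\,l}\quad(l\ge1).$$ -/

import Mathlib

namespace ThreePoint

/-! ### Conical sums of (0,1)-matrices -/

/-- The linear form attached to the `i`-th row of `A`, evaluated at a vector of positive
integers. -/
def rowForm {r n : ℕ} (A : Matrix (Fin r) (Fin n) ℕ) (x : Fin n → ℕ+) (i : Fin r) : ℝ :=
  ∑ j, (A i j : ℝ) * ((x j : ℕ) : ℝ)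

/-- `z` is the conical sum `ζ(A) = ∑_{x₁,…,xₙ ≥ 1} 1 / (l₁(x) ⋯ l_r(x))` of a matrix `A` all of
whose entries are `0` or `1`; no row vanishes (so that every form is positive), and the series
converges. The empty matrix (`n = r = 0`) gives `z = 1`. -/
def IsConicalSum01 (z : ℝ) : Prop :=
  ∃ (r n : ℕ) (A : Matrix (Fin r) (Fin n) ℕ),
    (∀ i j, A i j = 0 ∨ A i j = 1) ∧ (∀ i, ∃ j, A i j = 1) ∧
      HasSum (fun x : Fin n → ℕ+ => ∏ i, (rowForm A x i)⁻¹) z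

theorem isConicalSum01_one : IsConicalSum01 1 := by
  refine ⟨0, 0, fun i => i.elim0, fun i => i.elim0, fun i => i.elim0, ?_⟩
  simp

theorem rowForm_nonneg {r n : ℕ} (A : Matrix (Fin r) (Fin n) ℕ) (x : Fin n → ℕ+) (i : Fin r) :
    0 ≤ rowForm A x i :=
  Finset.sum_nonneg fun _ _ => by positivity

theorem IsConicalSum01.mul {z w : ℝ} (hz : IsConicalSum01 z) (hw : IsConicalSum01 w) :
    IsConicalSum01 (z * w) := by
  obtain ⟨r, n, A, hA, hA', hAs⟩ := hz
  obtain ⟨s, m, B, hB, hB', hBs⟩ := hw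
  refine ⟨r + s, n + m,
    fun i j => Fin.addCases (fun i' => Fin.addCases (fun j' => A i' j') (fun _ => 0) j)
      (fun i' => Fin.addCases (fun _ => 0) (fun j' => B i' j') j) i, ?_, ?_, ?_⟩
  · intro i j
    refine Fin.addCases (fun i' => ?_) (fun i' => ?_) i <;>
      refine Fin.addCases (fun j' => ?_) (fun j' => ?_) j <;> simp [hA, hB]
  · intro i
    refine Fin.addCases (fun i' => ?_) (fun i' => ?_) i
    · obtain ⟨j, hj⟩ := hA' i'
      exact ⟨Fin.castAdd m j, by simp [hj]⟩
    · obtain ⟨j, hj⟩ := hB' i'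
      exact ⟨Fin.natAdd n j, by simp [hj]⟩
  · have hs : Summable fun p : (Fin n → ℕ+) × (Fin m → ℕ+) =>
        (∏ i, (rowForm A p.1 i)⁻¹) * ∏ i, (rowForm B p.2 i)⁻¹ :=
      Summable.mul_of_nonneg (f := fun x : Fin n → ℕ+ => ∏ i, (rowForm A x i)⁻¹)
        (g := fun x : Fin m → ℕ+ => ∏ i, (rowForm B x i)⁻¹) hAs.summable hBs.summable
        (fun x => Finset.prod_nonneg fun i _ => inv_nonneg.2 (rowForm_nonneg A x i))
        (fun x => Finset.prod_nonneg fun i _ => inv_nonneg.2 (rowForm_nonneg B x i))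
    rw [← (Fin.appendEquiv n m).hasSum_iff]
    have key := hAs.mul hBs hs
    refine (Eq.mpr (congrArg (fun f => HasSum f (z * w)) (funext fun p => ?_)) key)
    simp [Fin.prod_univ_add, rowForm, Fin.sum_univ_add, Fin.appendEquiv]
    exact mul_comm _ _

/-- The `ℚ`-algebra `ℬ`: its underlying vector space is the `ℚ`-span of the conical sums of
(0,1)-matrices. -/
noncomputable def conicalAlgebra01 : Subalgebra ℚ ℝ :=
  (Submodule.span ℚ {z : ℝ | IsConicalSum01 z}).toSubalgebra
    (Submodule.subset_span isConicalSum01_one) fun x y hx hy => by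
      have h := Submodule.mul_mem_mul hx hy
      rw [Submodule.span_mul_span] at h
      refine Submodule.span_mono ?_ h
      rintro _ ⟨a, ha, b, hb, rfl⟩
      exact IsConicalSum01.mul ha hb

/-! ### The three-vertex modular graph function -/

/-- The odd Jacobi theta function `∑_{ν ∈ ℤ + 1/2} (-1)^{ν - 1/2} q^{ν²/2} u^ν`, where
`q = exp(2πiτ)` and `u = exp(2πiξ)`. -/
noncomputable def theta (ξ τ : ℂ) : ℂ :=
  ∑' n : ℤ, (-1 : ℂ) ^ n *
    Complex.exp (2 * Real.pi * Complex.I *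
      (((n : ℂ) + 1 / 2) ^ 2 / 2 * τ + ((n : ℂ) + 1 / 2) * ξ))

/-- The genus one propagator (Green function of the torus `ℂ / (ℤτ + ℤ)`). -/
noncomputable def propagator (ξ τ : ℂ) : ℝ :=
  -(1 / 4) * Real.log (‖theta ξ τ / ModularForm.eta τ‖ ^ 2) + Real.pi * ξ.im ^ 2 / (2 * τ.im)

/-- The point `rτ + s` with real coordinates `p = (r, s)`. In these coordinates the torus
`ℂ / (ℤτ + ℤ)` is `(ℝ/ℤ)²` and its normalized area `dξ / τ₂` is `dr ds`. -/
noncomputable def torusPoint (τ : ℂ) (p : ℝ × ℝ) : ℂ := (p.1 : ℂ) * τ + (p.2 : ℂ)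

/-- `D_{l₁,l₂,l₃}(τ) = ∫ G(ξ)^{l₁} G(ν)^{l₂} G(ξ-ν)^{l₃} dξ dν / τ₂²`, over two copies of the
torus; the domain of integration is the unit cube of the coordinates of `ξ` and `ν`. -/
noncomputable def modularGraphFunction (l₁ l₂ l₃ : ℕ) (τ : ℂ) : ℝ :=
  ∫ p in Set.Icc (0 : (ℝ × ℝ) × (ℝ × ℝ)) 1,
    propagator (torusPoint τ p.1) τ ^ l₁ * propagator (torusPoint τ p.2) τ ^ l₂ *
      propagator (torusPoint τ p.1 - torusPoint τ p.2) τ ^ l₃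

/-- The value at `y` of a Laurent polynomial with real coefficients. -/
noncomputable def laurentEval (d : LaurentPolynomial ℝ) (y : ℝ) : ℝ :=
  d.coeff.sum fun n a => a * y ^ n

/-- `d` is the Laurent polynomial `d_{l₁,l₂,l₃}`: with `y = πτ₂`, the Laurent polynomial
`4^{-(l₁+l₂+l₃)} d(y)` is the part of `D_{l₁,l₂,l₃}(τ)` that is not exponentially small as
`τ₂ → ∞` (uniformly in `τ₁`), and the zero mode `∫₀¹ D_{l₁,l₂,l₃}(τ₁ + iτ₂) dτ₁` equals it up to
`O(exp(-πτ₂))`. -/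
structure IsLaurentPart (l₁ l₂ l₃ : ℕ) (d : LaurentPolynomial ℝ) : Prop where
  asymptotics :
    (fun τ : ℂ => modularGraphFunction l₁ l₂ l₃ τ -
        laurentEval d (Real.pi * τ.im) / 4 ^ (l₁ + l₂ + l₃))
      =O[Filter.comap Complex.im Filter.atTop] fun τ : ℂ => Real.exp (-(Real.pi * τ.im))
  integrable : ∀ᶠ τ₂ : ℝ in Filter.atTop, IntervalIntegrable
    (fun τ₁ : ℝ => modularGraphFunction l₁ l₂ l₃ (τ₁ + τ₂ * Complex.I))
    MeasureTheory.volume 0 1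
  zeroMode :
    (fun τ₂ : ℝ => (∫ τ₁ in (0 : ℝ)..1, modularGraphFunction l₁ l₂ l₃ (τ₁ + τ₂ * Complex.I)) -
        laurentEval d (Real.pi * τ₂) / 4 ^ (l₁ + l₂ + l₃))
      =O[Filter.atTop] fun τ₂ : ℝ => Real.exp (-(Real.pi * τ₂))

/-! ### The sums `R(m₁,m₂,m₃;α,β)` -/

/-- `|k| = |k₁| ⋯ |k_m|`. -/
noncomputable def prodAbs {m : ℕ} (k : Fin m → {z : ℤ // z ≠ 0}) : ℝ :=
  ∏ i, |((k i : ℤ) : ℝ)|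

/-- `‖k‖ = |k₁| + ⋯ + |k_m|`. -/
noncomputable def sumAbs {m : ℕ} (k : Fin m → {z : ℤ // z ≠ 0}) : ℝ :=
  ∑ i, |((k i : ℤ) : ℝ)|

/-- The sum `k₁ + ⋯ + k_m`. -/
def total {m : ℕ} (k : Fin m → {z : ℤ // z ≠ 0}) : ℤ := ∑ i, (k i : ℤ)

/-- The general term of the series `R(m₁,m₂,m₃;α,β)`. -/
noncomputable def termR (m₁ m₂ m₃ α β : ℕ)
    (p : (Fin m₁ → {z : ℤ // z ≠ 0}) × (Fin m₂ → {z : ℤ // z ≠ 0}) ×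
      (Fin m₃ → {z : ℤ // z ≠ 0})) : ℝ :=
  if total p.1 + total p.2.1 = 0 ∧ total p.1 + total p.2.2 = 0 then
    1 / (prodAbs p.1 * prodAbs p.2.1 * prodAbs p.2.2 *
      (sumAbs p.1 + sumAbs p.2.1) ^ α * (sumAbs p.1 + sumAbs p.2.2) ^ β)
  else 0

/-- `∑ 4^N / (n₁^{γ₁} ⋯ n_N^{γ_N})` over all `N ≥ 0`, all `l > n₁ > ⋯ > n_N > 0` and all
`γ₁,…,γ_N ∈ {1,2}` with `γ₁ + ⋯ + γ_N = m - 2`; it is `0` if `m < 2`. Here `s` is the set of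
the `nᵢ`. -/
noncomputable def chainSum12 (m l : ℕ) : ℝ :=
  ∑ s ∈ (Finset.Ioo 0 l).powerset,
    ∑ γ ∈ (s.pi fun _ => ({1, 2} : Finset ℕ)) with (∑ n ∈ s.attach, γ n.1 n.2) + 2 = m,
      4 ^ s.card / ∏ n ∈ s.attach, (n.1 : ℝ) ^ γ n.1 n.2

/-- `∑ 1 / (n₁ ⋯ n_N)` over `L > n₁ > ⋯ > n_N > 0`. -/
noncomputable def chainSum (N L : ℕ) : ℝ :=
  ∑ s ∈ Finset.powersetCard N (Finset.Ioo 0 L), ∏ n ∈ s, ((n : ℝ))⁻¹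

/-- For `l = 0`: `∑ 1 / (a n₁ ⋯ n_{m-1})` over `a > n₁ > ⋯ > n_{m-1} > 0`. For `l ≥ 1`: the sum,
over `N, D ≥ 0` with `N + D = m - 2`, of `∑ 1 / ((l+a) l n₁ ⋯ n_N d₁ ⋯ d_D)` over
`l + a > n₁ > ⋯ > n_N > 0` and `l > d₁ > ⋯ > d_D > 0`; it is `0` if `m = 1`. -/
noncomputable def blockSum (m l a : ℕ) : ℝ :=
  if l = 0 then chainSum (m - 1) a / a
  else ∑ p ∈ Finset.range m ×ˢ Finset.range m with p.1 + p.2 + 2 = m,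
    chainSum p.1 (l + a) * chainSum p.2 l / (((l : ℝ) + a) * l)

/-- The term at `(l₁,l₂,l₃)` of the series for the part of `R` with vanishing total sums. -/
noncomputable def termZero (m₁ m₂ m₃ α β : ℕ) (l : ℕ+ × ℕ+ × ℕ+) : ℝ :=
  chainSum12 m₁ l.1 * chainSum12 m₂ l.2.1 * chainSum12 m₃ l.2.2 /
    (((l.1 : ℝ) + (l.2.1 : ℝ)) ^ α * ((l.1 : ℝ) + (l.2.2 : ℝ)) ^ β *
      (l.1 : ℝ) ^ 2 * (l.2.1 : ℝ) ^ 2 * (l.2.2 : ℝ) ^ 2)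

/-- The term at `(a,l₁,l₂,l₃)`, with `a ≥ 1` and `lᵢ ≥ 0`, of the series for the part of `R` with
non-zero total sums. Splitting the summation according to which `lᵢ` vanish gives eight nested
sums. -/
noncomputable def termPos (m₁ m₂ m₃ α β : ℕ) (x : ℕ+ × ℕ × ℕ × ℕ) : ℝ :=
  blockSum m₁ x.2.1 x.1 * blockSum m₂ x.2.2.1 x.1 * blockSum m₃ x.2.2.2 x.1 /
    (((x.2.1 : ℝ) + (x.2.2.1 : ℝ) + (x.1 : ℝ)) ^ α *
      ((x.2.1 : ℝ) + (x.2.2.2 : ℝ) + (x.1 : ℝ)) ^ β)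

end ThreePoint

/-!
Part (b) is elementary and serves as the source of the algebra `ℬ` in part (a).

*The sums `R`.* A vector of non-zero integers is sorted by the sum `p` of its positive entries and
the sum `-n` of its negative ones. The total weight `1 / |k₁ ⋯ k_m|` of the vectors with given
`p, n` is the coefficient of `x^p y^n` in `(-log (1 - x) - log (1 - y))^m`, hence a finite sum of
products of nested harmonic sums (`signedWeight`, `tsum_prodAbs_inv`). The two conditions on the
totals leave a sum over four natural numbers (`tsum_termR`). Its terms with `a = 0` and `a ≥ 1` are
the two series of the explicit formula (`explicit_formula`); the function `K_m` appears because
`1 + 4x/n + 4x²/n² = (1 + 2x/n)²` (`chainSum12_eq`). Nested harmonic sums grow more slowly than any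
power, which gives convergence. For the membership in `ℬ`, the points of the nested harmonic sums
are inserted one at a time into the intervals cut out by the summation variables; each insertion
splits a variable into a sum of two, and in the end only products of reciprocals of `0/1`-forms
remain (`inB_tsum_conicTerm`). All these sums have non-negative terms and are handled in `ℝ≥0∞`.

*The Fourier expansion.* Write `ξ = rτ + s` with `0 < r < 1`. By the Jacobi triple product
(`tendsto_triple_product`), `4G = 2πτ₂ B₂(r) + fluct`, where `fluct` is the absolutely convergent
sum over an integer `n` and a non-zero integer `m` of waves of size `|m|⁻¹ exp(-2πτ₂ |m| |n + r|)`
(`hasSum_waveTerm`). Its singularities are logarithmic, so all powers are integrable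
(`allLp_fluctProd`). Hence products of such functions may be integrated termwise, first over
`s₁, s₂`, which keeps the waves with balanced frequencies (`hasSum_integral_fluctProd`), and then
over `0 < r₂ < r₁ < 1` (`hasSum_sectorIntegral`); the part `r₁ < r₂` is equivalent to this one as
`G` is even (`modularGraphFunction_eq`).

*The asymptotics.* The exponent of a wave with winding numbers `n` is at least a convex combination
of three natural numbers, one for each vertex of the simplex `0 < r₂ < r₁ < 1`
(`one_le_energy`). So it is at least `1` on the whole simplex, and the wave contributes to the
error, unless `n` is one of three vectors, for which the exponent vanishes at a vertex
(`exists_abs_sectorIntegral_sub_le`). In coordinates `u, v` at that vertex the exponent is linear,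
and the integral is a Laplace integral of a polynomial over `u, v > 0`, `u + v < 1`; it is
`∑ q y^{-α-β} A^{-α} B^{-β}` with rational `q`, up to an exponentially small error that is uniform
in the rates `A = ‖k‖ + ‖h‖` and `B = ‖k‖ + ‖t‖` (`hasExpansion_simplexLaplace`). The sum over the
frequencies turns each monomial into a value of `R`, which lies in `ℬ`
(`hasLaurentPart_cornerSum`). The error `exp(-3πτ₂/2)` leaves room for the powers of `τ₂` coming
from the polynomial part of `G`.

A Laurent polynomial that decays exponentially is zero, whence uniqueness, and the uniform
asymptotics can be integrated over `τ₁` (`isLaurentPart_of_asymptotics`).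
-/

namespace ThreePoint

section Conical

open scoped ENNReal

/-! ### Conical sums with nested harmonic sums -/

/-- An extended non-negative real that, if it is finite, belongs to the algebra `ℬ`. -/
def InB (z : ℝ≥0∞) : Prop := z ≠ ∞ → z.toReal ∈ conicalAlgebra01

theorem InB.zero : InB 0 := fun _ => by simp

theorem InB.add {z w : ℝ≥0∞} (hz : InB z) (hw : InB w) : InB (z + w) := by
  intro h
  have h1 : z ≠ ∞ := fun h' => h (by simp [h'])
  have h2 : w ≠ ∞ := fun h' => h (by simp [h'])
  rw [ENNReal.toReal_add h1 h2]
  exact add_mem (hz h1) (hw h2)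

theorem InB.sum {ι : Type*} (s : Finset ι) {f : ι → ℝ≥0∞} (hf : ∀ i ∈ s, InB (f i)) :
    InB (∑ i ∈ s, f i) := by
  classical
  induction s using Finset.induction_on with
  | empty => simpa using InB.zero
  | insert i s hi ih =>
    rw [Finset.sum_insert hi]
    exact (hf i (by simp)).add (ih fun j hj => hf j (by simp [hj]))

theorem InB.rat_mul {c z : ℝ≥0∞} (q : ℚ) (hc : c.toReal = q) (hz : InB z) : InB (c * z) := by
  intro h
  rw [ENNReal.toReal_mul, hc]
  by_cases hq : (q : ℝ) = 0
  · simp [hq]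
  have hz' : z ≠ ∞ := by
    rintro rfl
    apply h
    rw [ENNReal.mul_top]
    rintro rfl
    exact hq (by simpa using hc.symm)
  rw [← Rat.smul_def]
  exact Subalgebra.smul_mem _ (hz hz') q

/-- The nested harmonic sum `∑ 1 / (n₁ ⋯ n_N)` over `L > n₁ > ⋯ > n_N > 0`. -/
noncomputable def nestedSum : ℕ → ℕ → ℝ≥0∞
  | 0, _ => 1
  | N + 1, L => ∑ n ∈ Finset.Ioo 0 L, (n : ℝ≥0∞)⁻¹ * nestedSum N n

/-- The value of the linear form `∑_{v ∈ S} x_v`. -/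
def form {V : Type} (x : V → ℕ+) (S : Finset V) : ℕ := ∑ v ∈ S, (x v : ℕ)

/-- A product of reciprocals of linear forms with coefficients `0` and `1`, and of nested harmonic
sums with such a form as upper bound. -/
noncomputable def conicTerm {V : Type} (R : List (Finset V)) (T : List (Finset V × ℕ))
    (x : V → ℕ+) : ℝ≥0∞ :=
  (R.map fun S => (form x S : ℝ≥0∞)⁻¹).prod * (T.map fun t => nestedSum t.2 (form x t.1)).prod

theorem form_pos {V : Type} (x : V → ℕ+) {S : Finset V} (hS : S.Nonempty) : 0 < form x S :=
  Finset.sum_pos (fun v _ => (x v).pos) hS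

/-- The variable `v` is replaced by the sum of two variables, the second of which is `none`. -/
def splitVar {V : Type} [DecidableEq V] (v : V) (x : Option V → ℕ+) : V → ℕ+ :=
  fun w => if w = v then x (some w) + x none else x (some w)

/-- The linear form that becomes `S` under `splitVar v`. -/
def liftForm {V : Type} [DecidableEq V] (v : V) (S : Finset V) : Finset (Option V) :=
  if v ∈ S then Finset.insertNone S else S.map Function.Embedding.some

theorem form_liftForm {V : Type} [DecidableEq V] (v : V) (S : Finset V) (x : Option V → ℕ+) :
    form x (liftForm v S) = form (splitVar v x) S := by
  unfold form liftForm splitVar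
  split_ifs with h
  · rw [Finset.sum_insertNone, ← Finset.add_sum_erase S _ h, ← Finset.add_sum_erase S _ h]
    have : ∀ w ∈ S.erase v, ((if w = v then x (some w) + x none else x (some w) : ℕ+) : ℕ)
        = x (some w) := fun w hw => by rw [if_neg (Finset.ne_of_mem_erase hw)]
    rw [Finset.sum_congr rfl this]
    simp
    ring
  · rw [Finset.sum_map]
    refine Finset.sum_congr rfl fun w hw => ?_
    have : w ≠ v := by
      rintro rfl
      exact h hw
    simp [this]

theorem liftForm_nonempty {V : Type} [DecidableEq V] (v : V) {S : Finset V} (hS : S.Nonempty) :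
    (liftForm v S).Nonempty := by
  unfold liftForm
  split_ifs
  · exact ⟨none, by simp⟩
  · simpa using hS

theorem conicTerm_splitVar {V : Type} [DecidableEq V] (v : V) (R : List (Finset V))
    (T : List (Finset V × ℕ)) (x : Option V → ℕ+) :
    conicTerm R T (splitVar v x) =
      conicTerm (R.map (liftForm v)) (T.map fun t => (liftForm v t.1, t.2)) x := by
  simp [conicTerm, Function.comp_def, form_liftForm]

/-- A summation variable below `x v` is the new variable of `splitVar`: `n` and `x v - n` are two
independent positive integers. -/
theorem tsum_sum_Ioo_eq_tsum_splitVar {V : Type} [DecidableEq V] (v : V)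
    (h : (V → ℕ+) → ℕ → ℝ≥0∞) :
    ∑' x : V → ℕ+, ∑ n ∈ Finset.Ioo 0 (x v : ℕ), h x n =
      ∑' x : Option V → ℕ+, h (splitVar v x) (x none) := by
  let e : (Option V → ℕ+) → (V → ℕ+) × ℕ+ := fun x => (splitVar v x, x none)
  let H : (V → ℕ+) × ℕ+ → ℝ≥0∞ := fun p => if (p.2 : ℕ) < p.1 v then h p.1 p.2 else 0
  have he : Function.Injective e := by
    intro x y hxy
    have h2 : x none = y none := congrArg Prod.snd hxy
    have h1 := congrArg Prod.fst hxy
    funext w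
    cases w with
    | none => exact h2
    | some w =>
      have := congrFun h1 w
      simp only [e, splitVar] at this
      split_ifs at this
      · rw [h2] at this
        exact add_right_cancel this
      · exact this
  have hsupp : Function.support H ⊆ Set.range e := by
    intro p hp
    have hlt : (p.2 : ℕ) < p.1 v := by
      by_contra hcon
      exact hp (if_neg hcon)
    refine ⟨fun w => w.elim p.2 (fun w => if w = v then p.1 w - p.2 else p.1 w), ?_⟩
    refine Prod.ext (funext fun w => ?_) rfl
    simp only [e, splitVar, Option.elim]
    split_ifs with hw
    · subst hw
      rw [add_comm]
      exact PNat.add_sub_of_lt hlt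
    · rfl
  have h1 : ∀ x : V → ℕ+, ∑ n ∈ Finset.Ioo 0 (x v : ℕ), h x n = ∑' n : ℕ+, H (x, n) := by
    intro x
    have : ∑ n ∈ Finset.Ioo 0 (x v : ℕ), h x n =
        ∑' n : ℕ, if n ∈ Finset.Ioo 0 (x v : ℕ) then h x n else 0 := by
      rw [tsum_eq_sum (s := Finset.Ioo 0 (x v : ℕ)) (by intro b hb; simp only [if_neg hb])]
      exact Finset.sum_congr rfl fun n hn => by rw [if_pos hn]
    rw [this, ← Function.Injective.tsum_eq PNat.coe_injective]
    · refine tsum_congr fun n => ?_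
      simp [H, n.pos]
    · intro n hn
      have : n ∈ Finset.Ioo 0 (x v : ℕ) := by
        by_contra hcon
        exact hn (by simp only [if_neg hcon])
      exact ⟨⟨n, (Finset.mem_Ioo.1 this).1⟩, rfl⟩
  simp_rw [h1]
  rw [← ENNReal.tsum_prod, ← he.tsum_eq hsupp]
  refine tsum_congr fun x => ?_
  have : ((x none : ℕ+) : ℕ) < (splitVar v x v : ℕ+) := by simp [splitVar]
  simp only [H, e]
  rw [if_pos this]

/-- The sum over all values of the variables of a product of reciprocal forms is the conical sum of
the matrix whose rows are the indicator functions of the forms. -/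
theorem isConicalSum01_of_rows {V : Type} [Fintype V] [DecidableEq V] (R : List (Finset V))
    (hR : ∀ S ∈ R, S.Nonempty) (hfin : ∑' x : V → ℕ+, conicTerm R [] x ≠ ∞) :
    IsConicalSum01 (∑' x : V → ℕ+, conicTerm R [] x).toReal := by
  let e := Fintype.equivFin V
  refine ⟨R.length, Fintype.card V, fun i j => if e.symm j ∈ R.get i then 1 else 0, ?_, ?_, ?_⟩
  · intro i j
    by_cases h : e.symm j ∈ R.get i
    · exact Or.inr (if_pos h)
    · exact Or.inl (if_neg h)
  · intro i
    obtain ⟨v, hv⟩ := hR (R.get i) (List.get_mem _ _)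
    exact ⟨e v, if_pos (by simpa using hv)⟩
  · have hs := (ENNReal.summable_toReal hfin).hasSum
    rw [← ENNReal.tsum_toReal_eq (fun x => ENNReal.ne_top_of_tsum_ne_top hfin x)] at hs
    rw [← (e.arrowCongr (Equiv.refl ℕ+)).hasSum_iff]
    refine Eq.mpr (congrArg (fun f => HasSum f _) (funext fun x => ?_)) hs
    have hrow : ∀ i, rowForm (fun i j => if e.symm j ∈ R.get i then 1 else 0)
        (fun j => x (e.symm j)) i = form x (R.get i) := by
      intro i
      unfold rowForm
      rw [← e.sum_comp]
      simp [form]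
    have : (e.arrowCongr (Equiv.refl ℕ+)) x = fun j => x (e.symm j) := rfl
    simp only [Function.comp_apply, this, hrow]
    simp only [conicTerm, List.map_nil, List.prod_nil, mul_one]
    rw [← Fin.prod_univ_fun_getElem, ENNReal.toReal_prod]
    simp

/-- Inserting the points of a nested sum one at a time into the intervals cut out by the
variables turns the sum into a sum of conical sums. -/
theorem inB_tsum_conicTerm (M : ℕ) : ∀ {V : Type} [Fintype V] [DecidableEq V]
    (R : List (Finset V)) (T : List (Finset V × ℕ)), (∀ S ∈ R, S.Nonempty) →
    (T.map fun t => t.2 + 1).sum ≤ M → InB (∑' x : V → ℕ+, conicTerm R T x) := by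
  induction M with
  | zero =>
    intro V _ _ R T hR hT
    have : T = [] := by
      cases T with
      | nil => rfl
      | cons t T => simp at hT
    subst this
    exact fun h => Submodule.subset_span (isConicalSum01_of_rows R hR h)
  | succ M ih =>
    intro V _ _ R T hR hT
    match T, hT with
    | [], hT => exact ih R [] hR (by simp)
    | (S, 0) :: T, hT =>
      have : ∀ x : V → ℕ+, conicTerm R ((S, 0) :: T) x = conicTerm R T x := fun x => by
        simp [conicTerm, nestedSum]
      simp_rw [this]
      exact ih R T hR (by simp only [List.map_cons, List.sum_cons] at hT; omega)
    | (S, N + 1) :: T, hT =>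
      simp only [List.map_cons, List.sum_cons] at hT
      -- The largest summation variable of a nested sum with upper bound `x_v + ⋯` lies in one of
      -- the intervals cut out by the partial sums of this bound, or at an endpoint. `U` is the set
      -- of the variables that are already passed: `form x U` is the left endpoint.
      have key : ∀ (S U : Finset V), Disjoint S U →
          InB (∑' x : V → ℕ+, conicTerm R T x * ∑ n ∈ Finset.Ioo 0 (form x S),
            ((form x U + n : ℕ) : ℝ≥0∞)⁻¹ * nestedSum N (form x U + n)) := by
        intro S
        induction S using Finset.induction_on with
        | empty => intro U _; simpa [form] using InB.zero
        | insert v S hv ihS =>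
          intro U hU
          have hvU : v ∉ U := fun h => (Finset.disjoint_left.1 hU) (by simp) h
          have hSU : Disjoint S (insert v U) := by
            rw [Finset.disjoint_insert_right]
            exact ⟨hv, hU.mono_left (Finset.subset_insert _ _)⟩
          have hform : ∀ x : V → ℕ+, form x (insert v U) = form x U + x v := fun x => by
            simp [form, Finset.sum_insert hvU, add_comm]
          -- The interior of the interval of length `x v`: the variable `v` is split.
          have h1 : InB (∑' x : V → ℕ+, conicTerm R T x * ∑ n ∈ Finset.Ioo 0 (x v : ℕ),
              ((form x U + n : ℕ) : ℝ≥0∞)⁻¹ * nestedSum N (form x U + n)) := by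
            simp_rw [Finset.mul_sum]
            rw [tsum_sum_Ioo_eq_tsum_splitVar v (fun x n => conicTerm R T x *
              (((form x U + n : ℕ) : ℝ≥0∞)⁻¹ * nestedSum N (form x U + n)))]
            have : ∀ x : Option V → ℕ+, conicTerm R T (splitVar v x) *
                (((form (splitVar v x) U + x none : ℕ) : ℝ≥0∞)⁻¹ *
                  nestedSum N (form (splitVar v x) U + x none)) =
                conicTerm (Finset.insertNone U :: R.map (liftForm v))
                  ((Finset.insertNone U, N) :: T.map fun t => (liftForm v t.1, t.2)) x := by
              intro x
              have hf : form x (Finset.insertNone U) = form (splitVar v x) U + x none := by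
                rw [← form_liftForm, liftForm, if_neg hvU]
                simp [form, Finset.sum_insertNone, add_comm]
              rw [conicTerm_splitVar]
              simp only [conicTerm, List.map_cons, List.prod_cons, hf]
              ring
            simp_rw [this]
            refine ih _ _ ?_ ?_
            · intro S' hS'
              rcases List.mem_cons.1 hS' with rfl | hS'
              · exact ⟨none, by simp⟩
              · obtain ⟨S'', hS'', rfl⟩ := List.mem_map.1 hS'
                exact liftForm_nonempty v (hR _ hS'')
            · simp only [List.map_cons, List.sum_cons, List.map_map, Function.comp_def]
              omega
          rcases S.eq_empty_or_nonempty with rfl | hSne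
          · simpa [form] using h1
          -- The right endpoint of this interval.
          have h2 : InB (∑' x : V → ℕ+, conicTerm R T x *
              (((form x U + x v : ℕ) : ℝ≥0∞)⁻¹ * nestedSum N (form x U + x v))) := by
            have : ∀ x : V → ℕ+, conicTerm R T x *
                (((form x U + x v : ℕ) : ℝ≥0∞)⁻¹ * nestedSum N (form x U + x v)) =
                conicTerm (insert v U :: R) ((insert v U, N) :: T) x := by
              intro x
              simp only [conicTerm, List.map_cons, List.prod_cons, hform]
              ring
            simp_rw [this]
            refine ih _ _ ?_ ?_
            · intro S' hS'
              rcases List.mem_cons.1 hS' with rfl | hS'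
              · exact ⟨v, by simp⟩
              · exact hR _ hS'
            · simp only [List.map_cons, List.sum_cons]
              omega
          -- The remaining intervals.
          have h3 := ihS (insert v U) hSU
          have hsplit : ∀ x : V → ℕ+, conicTerm R T x *
              ∑ n ∈ Finset.Ioo 0 (form x (insert v S)),
                ((form x U + n : ℕ) : ℝ≥0∞)⁻¹ * nestedSum N (form x U + n) =
              conicTerm R T x * ∑ n ∈ Finset.Ioo 0 (x v : ℕ),
                ((form x U + n : ℕ) : ℝ≥0∞)⁻¹ * nestedSum N (form x U + n) +
              (conicTerm R T x *
                (((form x U + x v : ℕ) : ℝ≥0∞)⁻¹ * nestedSum N (form x U + x v)) +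
              conicTerm R T x * ∑ n ∈ Finset.Ioo 0 (form x S),
                ((form x (insert v U) + n : ℕ) : ℝ≥0∞)⁻¹ *
                  nestedSum N (form x (insert v U) + n)) := by
            intro x
            rw [← mul_add, ← mul_add]
            congr 1
            have hpos := form_pos x hSne
            have hfs : form x (insert v S) = x v + form x S := by
              simp [form, Finset.sum_insert hv]
            generalize hg : (fun n : ℕ => ((form x U + n : ℕ) : ℝ≥0∞)⁻¹ *
              nestedSum N (form x U + n)) = g
            have hg' : ∀ n, ((form x U + n : ℕ) : ℝ≥0∞)⁻¹ *
              nestedSum N (form x U + n) = g n := fun n => congrFun hg n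
            have hg'' : ∀ n, ((form x (insert v U) + n : ℕ) : ℝ≥0∞)⁻¹ *
              nestedSum N (form x (insert v U) + n) = g (x v + n) := fun n => by
                rw [hform, add_assoc, hg']
            simp_rw [hg'', hg', hfs]
            have hIoo : ∀ L : ℕ, Finset.Ioo 0 L = Finset.Ico 1 L := fun L => rfl
            simp_rw [hIoo]
            rw [← Finset.sum_Ico_consecutive g (show 1 ≤ (x v : ℕ) from (x v).pos)
              (show (x v : ℕ) ≤ x v + form x S by omega),
              Finset.sum_eq_sum_Ico_succ_bot (show (x v : ℕ) < x v + form x S by omega)]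
            congr 2
            rw [Finset.sum_Ico_eq_sum_range, Finset.sum_Ico_eq_sum_range]
            refine Finset.sum_congr (by congr 1; omega) fun n _ => by congr 1; omega
          simp_rw [hsplit]
          rw [ENNReal.tsum_add, ENNReal.tsum_add]
          exact h1.add (h2.add h3)
      have := key S ∅ (by simp)
      refine Eq.mpr (congrArg InB (tsum_congr fun x => ?_)) this
      simp only [conicTerm, List.map_cons, List.prod_cons, nestedSum, form, Finset.sum_empty,
        zero_add]
      ring

/-! ### Vectors of non-zero integers with prescribed positive and negative parts -/

theorem chainSum_zero (L : ℕ) : chainSum 0 L = 1 := by simp [chainSum]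

theorem chainSum_succ (N L : ℕ) :
    chainSum (N + 1) L = ∑ n ∈ Finset.Ioo 0 L, (n : ℝ)⁻¹ * chainSum N n := by
  induction L with
  | zero =>
    simp [chainSum, Finset.powersetCard_eq_empty.2 (show (∅ : Finset ℕ).card < N + 1 by simp)]
  | succ L ih =>
    rcases Nat.eq_zero_or_pos L with rfl | hL
    · simp [chainSum, Finset.powersetCard_eq_empty.2 (show (∅ : Finset ℕ).card < N + 1 by simp),
        show Finset.Ioo 0 1 = (∅ : Finset ℕ) from rfl]
    have hI : Finset.Ioo 0 (L + 1) = insert L (Finset.Ioo 0 L) := by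
      ext n; simp; omega
    have hL' : L ∉ Finset.Ioo 0 L := by simp
    rw [hI, Finset.sum_insert hL', ← ih]
    unfold chainSum
    rw [hI, Finset.powersetCard_succ_insert hL', Finset.sum_union, Finset.sum_image, add_comm,
      Finset.mul_sum]
    · congr 1
      refine Finset.sum_congr rfl fun s hs => ?_
      rw [Finset.prod_insert]
      exact fun h => hL' ((Finset.mem_powersetCard.1 hs).1 h)
    · intro s hs t ht hst
      have hs' : L ∉ s := fun h => hL' ((Finset.mem_powersetCard.1 hs).1 h)
      have ht' : L ∉ t := fun h => hL' ((Finset.mem_powersetCard.1 ht).1 h)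
      rw [← Finset.erase_insert hs', ← Finset.erase_insert ht', hst]
    · rw [Finset.disjoint_left]
      intro s hs hs'
      obtain ⟨t, -, rfl⟩ := Finset.mem_image.1 hs'
      exact hL' ((Finset.mem_powersetCard.1 hs).1 (Finset.mem_insert_self _ _))

theorem chainSum_nonneg (N L : ℕ) : 0 ≤ chainSum N L :=
  Finset.sum_nonneg fun _ _ => Finset.prod_nonneg fun _ _ => by positivity

theorem nestedSum_eq (N : ℕ) : ∀ L : ℕ, nestedSum N L = ENNReal.ofReal (chainSum N L) := by
  induction N with
  | zero => intro L; simp [nestedSum, chainSum_zero]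
  | succ N ih =>
    intro L
    rw [nestedSum, chainSum_succ, ENNReal.ofReal_sum_of_nonneg]
    · refine Finset.sum_congr rfl fun n hn => ?_
      have hn : (0 : ℝ) < n := by exact_mod_cast (Finset.mem_Ioo.1 hn).1
      rw [ih, ENNReal.ofReal_mul (by positivity), ENNReal.ofReal_inv_of_pos hn,
        ENNReal.ofReal_natCast]
    · exact fun n _ => mul_nonneg (by positivity) (chainSum_nonneg _ _)

/-- The coefficient of `x^p` in `(-log (1 - x))^i / i!`. -/
noncomputable def logCoeff (i p : ℕ) : ℝ :=
  if i = 0 then (if p = 0 then 1 else 0) else chainSum (i - 1) p / p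

theorem logCoeff_nonneg (i p : ℕ) : 0 ≤ logCoeff i p := by
  unfold logCoeff
  split_ifs <;> first | positivity | exact div_nonneg (chainSum_nonneg _ _) (by positivity)

theorem logCoeff_succ_zero (i : ℕ) : logCoeff (i + 1) 0 = 0 := by simp [logCoeff]

theorem logCoeff_succ_succ (i p : ℕ) :
    (p + 1 : ℝ) * logCoeff (i + 1) (p + 1) = ∑ q ∈ Finset.range (p + 1), logCoeff i q := by
  have h : (p + 1 : ℝ) ≠ 0 := by positivity
  have h1 : (p + 1 : ℝ) * logCoeff (i + 1) (p + 1) = chainSum i (p + 1) := by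
    simp only [logCoeff, Nat.succ_ne_zero, if_false, Nat.add_sub_cancel]
    push_cast
    field_simp
  rw [h1]
  cases i with
  | zero => simp [logCoeff, chainSum_zero]
  | succ i =>
    rw [chainSum_succ, Finset.sum_range_succ']
    simp only [logCoeff_succ_zero, add_zero]
    have : Finset.Ioo 0 (p + 1) = Finset.Ico 1 (p + 1) := rfl
    rw [this, Finset.sum_Ico_eq_sum_range]
    refine Finset.sum_congr rfl fun n _ => ?_
    simp only [logCoeff, Nat.succ_ne_zero, if_false, Nat.add_sub_cancel]
    rw [add_comm 1 n]
    ring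

open PowerSeries in
/-- The generating function of `logCoeff i` is the `i`-th power of `-log (1 - x)` divided by `i!`:
both sides have the same derivative and the same constant term. -/
theorem mk_logCoeff_eq (i : ℕ) :
    (i.factorial : ℝ) • PowerSeries.mk (logCoeff i) = PowerSeries.mk (logCoeff 1) ^ i := by
  have hd : ∀ i, d⁄dX ℝ (PowerSeries.mk (logCoeff (i + 1))) =
      PowerSeries.mk (logCoeff i) * PowerSeries.mk 1 := by
    intro i
    ext p
    rw [coeff_derivative, coeff_mk, coeff_mul, Finset.Nat.sum_antidiagonal_eq_sum_range_succ_mk,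
      mul_comm, logCoeff_succ_succ]
    simp
  have h0 : PowerSeries.mk (logCoeff 0) = 1 := by
    ext p
    simp [logCoeff, coeff_one]
  induction i with
  | zero => simp [h0]
  | succ i ih =>
    refine derivative.ext ?_ ?_
    · rw [Derivation.map_smul, hd, derivative_pow, hd, h0, Nat.add_sub_cancel, ← ih, one_mul,
        Nat.factorial_succ]
      simp only [Nat.cast_mul, Algebra.smul_def, map_mul, map_natCast]
      ring
    · simp [logCoeff_succ_zero, ← coeff_zero_eq_constantCoeff_apply, map_pow]

theorem sum_antidiagonal_logCoeff (i p : ℕ) :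
    ∑ q ∈ Finset.HasAntidiagonal.antidiagonal p, (q.1 : ℝ)⁻¹ * logCoeff i q.2 =
      (i + 1) * logCoeff (i + 1) p := by
  have h1 := mk_logCoeff_eq (i + 1)
  rw [pow_succ, ← mk_logCoeff_eq i, Nat.factorial_succ] at h1
  have h2 := congrArg (PowerSeries.coeff p) h1
  rw [map_smul, smul_mul_assoc, map_smul, PowerSeries.coeff_mk,
    mul_comm (PowerSeries.mk (logCoeff i)), PowerSeries.coeff_mul] at h2
  simp only [PowerSeries.coeff_mk, smul_eq_mul] at h2
  have hf : (i.factorial : ℝ) ≠ 0 := by positivity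
  have hl : ∀ q : ℕ, logCoeff 1 q = (q : ℝ)⁻¹ := fun q => by simp [logCoeff, chainSum_zero]
  simp only [hl] at h2
  push_cast at h2
  have : (i.factorial : ℝ) * ∑ q ∈ Finset.HasAntidiagonal.antidiagonal p,
        (q.1 : ℝ)⁻¹ * logCoeff i q.2 =
      i.factorial * ((i + 1) * logCoeff (i + 1) p) := by rw [← h2]; ring
  exact mul_left_cancel₀ hf this

/-- The sum of `1 / |k₁ ⋯ k_m|` over the vectors `k` of non-zero integers whose positive entries
have sum `p` and whose negative entries have sum `-n`: the coefficient of `x^p y^n` in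
`(-log (1 - x) - log (1 - y))^m`. -/
noncomputable def signedWeight (m p n : ℕ) : ℝ :=
  m.factorial * ∑ q ∈ Finset.HasAntidiagonal.antidiagonal m, logCoeff q.1 p * logCoeff q.2 n

theorem signedWeight_nonneg (m p n : ℕ) : 0 ≤ signedWeight m p n :=
  mul_nonneg (by positivity) (Finset.sum_nonneg fun _ _ =>
    mul_nonneg (logCoeff_nonneg _ _) (logCoeff_nonneg _ _))

theorem signedWeight_symm (m p n : ℕ) : signedWeight m p n = signedWeight m n p := by
  unfold signedWeight
  rw [← Finset.Nat.sum_antidiagonal_swap]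
  simp [mul_comm]

theorem signedWeight_zero (p n : ℕ) : signedWeight 0 p n = if p = 0 ∧ n = 0 then 1 else 0 := by
  simp only [signedWeight, logCoeff]
  by_cases hp : p = 0 <;> by_cases hn : n = 0 <;> simp [hp, hn]

theorem signedWeight_succ (m p n : ℕ) :
    signedWeight (m + 1) p n =
      ∑ q ∈ Finset.HasAntidiagonal.antidiagonal p, (q.1 : ℝ)⁻¹ * signedWeight m q.2 n +
      ∑ q ∈ Finset.HasAntidiagonal.antidiagonal n, (q.1 : ℝ)⁻¹ * signedWeight m p q.2 := by
  have e1 : ∑ q ∈ Finset.HasAntidiagonal.antidiagonal p, (q.1 : ℝ)⁻¹ * signedWeight m q.2 n =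
      m.factorial * ∑ r ∈ Finset.HasAntidiagonal.antidiagonal m,
        (r.1 + 1 : ℝ) * (logCoeff (r.1 + 1) p * logCoeff r.2 n) := by
    unfold signedWeight
    simp_rw [Finset.mul_sum]
    rw [Finset.sum_comm]
    refine Finset.sum_congr rfl fun r _ => ?_
    rw [← mul_assoc (r.1 + 1 : ℝ), ← sum_antidiagonal_logCoeff, Finset.sum_mul, Finset.mul_sum]
    exact Finset.sum_congr rfl fun q _ => by ring
  have e2 : ∑ q ∈ Finset.HasAntidiagonal.antidiagonal n, (q.1 : ℝ)⁻¹ * signedWeight m p q.2 =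
      m.factorial * ∑ r ∈ Finset.HasAntidiagonal.antidiagonal m,
        (r.2 + 1 : ℝ) * (logCoeff r.1 p * logCoeff (r.2 + 1) n) := by
    unfold signedWeight
    simp_rw [Finset.mul_sum]
    rw [Finset.sum_comm]
    refine Finset.sum_congr rfl fun r _ => ?_
    rw [mul_left_comm (r.2 + 1 : ℝ), ← sum_antidiagonal_logCoeff, Finset.mul_sum, Finset.mul_sum]
    exact Finset.sum_congr rfl fun q _ => by ring
  have e3 := Finset.Nat.sum_antidiagonal_succ (n := m)
    (f := fun r => (r.1 : ℝ) * (logCoeff r.1 p * logCoeff r.2 n))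
  have e4 := Finset.Nat.sum_antidiagonal_succ' (n := m)
    (f := fun r => (r.2 : ℝ) * (logCoeff r.1 p * logCoeff r.2 n))
  simp only [Nat.cast_zero, zero_mul, zero_add, Nat.cast_add, Nat.cast_one] at e3 e4
  rw [e1, e2, ← e3, ← e4, ← mul_add, ← Finset.sum_add_distrib, signedWeight, Nat.factorial_succ]
  have : ∀ r ∈ Finset.HasAntidiagonal.antidiagonal (m + 1),
      (r.1 : ℝ) * (logCoeff r.1 p * logCoeff r.2 n) +
      (r.2 : ℝ) * (logCoeff r.1 p * logCoeff r.2 n) =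
      (m + 1 : ℝ) * (logCoeff r.1 p * logCoeff r.2 n) := by
    intro r hr
    have : (r.1 : ℝ) + r.2 = m + 1 := by exact_mod_cast Finset.HasAntidiagonal.mem_antidiagonal.1 hr
    rw [← this]; ring
  rw [Finset.sum_congr rfl this, ← Finset.mul_sum]
  push_cast
  ring

theorem tsum_tsum_add_eq_tsum_antidiagonal (g : ℕ → ℕ → ℝ≥0∞) (F : ℕ → ℝ≥0∞) :
    ∑' j : ℕ, ∑' p : ℕ, g j p * F (p + j) =
      ∑' p : ℕ, (∑ q ∈ Finset.HasAntidiagonal.antidiagonal p, g q.1 q.2) * F p := by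
  rw [← ENNReal.tsum_prod (f := fun j p => g j p * F (p + j)),
    ← Finset.HasAntidiagonal.sigmaAntidiagonalEquivProd.tsum_eq
      (fun q : ℕ × ℕ => g q.1 q.2 * F (q.2 + q.1)),
    ENNReal.tsum_sigma']
  refine tsum_congr fun p => ?_
  rw [tsum_fintype]
  simp only [Finset.HasAntidiagonal.sigmaAntidiagonalEquivProd_apply]
  rw [Finset.sum_mul, Finset.sum_coe_sort (Finset.HasAntidiagonal.antidiagonal p)
    (fun q : ℕ × ℕ => g q.1 q.2 * F (q.2 + q.1))]
  refine Finset.sum_congr rfl fun q hq => ?_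
  rw [add_comm q.2, Finset.HasAntidiagonal.mem_antidiagonal.1 hq]

theorem tsum_ne_zero_int (f : ℤ → ℝ≥0∞) :
    ∑' z : {z : ℤ // z ≠ 0}, ENNReal.ofReal (|((z : ℤ) : ℝ)|⁻¹) * f z =
      ∑' j : ℕ, ENNReal.ofReal ((j : ℝ)⁻¹) * f j +
      ∑' j : ℕ, ENNReal.ofReal ((j : ℝ)⁻¹) * f (-j) := by
  have h1 : ∑' z : {z : ℤ // z ≠ 0}, ENNReal.ofReal (|((z : ℤ) : ℝ)|⁻¹) * f z =
      ∑' z : ℤ, ENNReal.ofReal (|(z : ℝ)|⁻¹) * f z := by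
    refine tsum_subtype_eq_of_support_subset
      (f := fun z : ℤ => ENNReal.ofReal (|(z : ℝ)|⁻¹) * f z) (s := {z : ℤ | z ≠ 0}) ?_
    intro z hz h0
    simp only [Function.mem_support] at hz
    rw [h0] at hz
    simp at hz
  rw [h1, tsum_of_add_one_of_neg_add_one ENNReal.summable ENNReal.summable,
    tsum_eq_zero_add' (f := fun j : ℕ => ENNReal.ofReal ((j : ℝ)⁻¹) * f j) ENNReal.summable,
    tsum_eq_zero_add' (f := fun j : ℕ => ENNReal.ofReal ((j : ℝ)⁻¹) * f (-j)) ENNReal.summable]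
  have h2 : ∀ n : ℕ, |(n + 1 : ℝ)| = n + 1 := fun n => abs_of_pos (by positivity)
  have h3 : ∀ n : ℕ, |(-1 + -n : ℝ)| = n + 1 := fun n => by
    rw [abs_of_neg (by linarith [n.cast_nonneg (α := ℝ)])]; ring
  simp [h2, h3]

/-- The sum of the positive entries. -/
def posPart {m : ℕ} (k : Fin m → {z : ℤ // z ≠ 0}) : ℕ := ∑ i, (k i : ℤ).toNat

/-- The absolute value of the sum of the negative entries. -/
def negPart {m : ℕ} (k : Fin m → {z : ℤ // z ≠ 0}) : ℕ := ∑ i, (-(k i : ℤ)).toNat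

theorem total_eq {m : ℕ} (k : Fin m → {z : ℤ // z ≠ 0}) :
    total k = (posPart k : ℤ) - negPart k := by
  unfold total posPart negPart
  push_cast
  rw [← Finset.sum_sub_distrib]
  exact Finset.sum_congr rfl fun i _ => by omega

theorem sumAbs_eq {m : ℕ} (k : Fin m → {z : ℤ // z ≠ 0}) :
    sumAbs k = (posPart k + negPart k : ℕ) := by
  unfold sumAbs posPart negPart
  rw [← Finset.sum_add_distrib]
  push_cast
  refine Finset.sum_congr rfl fun i _ => ?_
  rw [← Int.cast_abs]
  have : |(k i : ℤ)| = (((k i : ℤ).toNat + (-(k i : ℤ)).toNat : ℕ) : ℤ) := by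
    rcases abs_cases (k i : ℤ) with h | h <;> omega
  rw [this]
  push_cast
  rfl

theorem prodAbs_pos {m : ℕ} (k : Fin m → {z : ℤ // z ≠ 0}) : 0 < prodAbs k :=
  Finset.prod_pos fun i _ => abs_pos.2 (by exact_mod_cast (k i).2)

/-- Summation over vectors of non-zero integers by their positive and negative parts. The function
`F` is arbitrary, which makes the induction on the length of the vector work. -/
theorem tsum_prodAbs_inv (m : ℕ) : ∀ F : ℕ → ℕ → ℝ≥0∞,
    ∑' k : Fin m → {z : ℤ // z ≠ 0}, ENNReal.ofReal (prodAbs k)⁻¹ * F (posPart k) (negPart k) =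
      ∑' p : ℕ, ∑' n : ℕ, ENNReal.ofReal (signedWeight m p n) * F p n := by
  induction m with
  | zero =>
    intro F
    rw [tsum_fintype, tsum_eq_single 0, tsum_eq_single 0]
    · simp [prodAbs, posPart, negPart, signedWeight_zero]
    · intro n hn; simp [signedWeight_zero, hn]
    · intro n hn; simp [signedWeight_zero, hn]
  | succ m ih =>
    intro F
    rw [← (Fin.consEquiv fun _ => {z : ℤ // z ≠ 0}).tsum_eq, ENNReal.tsum_prod']
    have h1 : ∀ z : {z : ℤ // z ≠ 0}, ∑' k : Fin m → {z : ℤ // z ≠ 0},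
        ENNReal.ofReal (prodAbs (Fin.consEquiv (fun _ => {z : ℤ // z ≠ 0}) (z, k)))⁻¹ *
          F (posPart (Fin.consEquiv (fun _ => {z : ℤ // z ≠ 0}) (z, k)))
            (negPart (Fin.consEquiv (fun _ => {z : ℤ // z ≠ 0}) (z, k))) =
        ENNReal.ofReal (|((z : ℤ) : ℝ)|⁻¹) * ∑' p : ℕ, ∑' n : ℕ,
          ENNReal.ofReal (signedWeight m p n) *
            F (p + (z : ℤ).toNat) (n + (-(z : ℤ)).toNat) := by
      intro z
      rw [← ih (fun p n => F (p + (z : ℤ).toNat) (n + (-(z : ℤ)).toNat)), ← ENNReal.tsum_mul_left]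
      refine tsum_congr fun k => ?_
      rw [← mul_assoc, ← ENNReal.ofReal_mul (by positivity)]
      simp [Fin.consEquiv, prodAbs, posPart, negPart, Fin.prod_univ_succ, Fin.sum_univ_succ,
        add_comm, mul_comm]
    simp_rw [h1]
    rw [tsum_ne_zero_int (fun z => ∑' p : ℕ, ∑' n : ℕ, ENNReal.ofReal (signedWeight m p n) *
            F (p + z.toNat) (n + (-z).toNat))]
    simp only [Int.toNat_natCast, Int.toNat_neg_natCast, neg_neg, add_zero]
    simp_rw [← ENNReal.tsum_mul_left]
    have e1 : ∑' j : ℕ, ∑' p : ℕ, ∑' n : ℕ, ENNReal.ofReal ((j : ℝ)⁻¹) *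
        (ENNReal.ofReal (signedWeight m p n) * F (p + j) n) =
        ∑' p : ℕ, ∑' n : ℕ, (∑ q ∈ Finset.HasAntidiagonal.antidiagonal p,
          ENNReal.ofReal ((q.1 : ℝ)⁻¹) *
          ENNReal.ofReal (signedWeight m q.2 n)) * F p n := by
      have : ∀ j : ℕ, ∑' p : ℕ, ∑' n : ℕ, ENNReal.ofReal ((j : ℝ)⁻¹) *
        (ENNReal.ofReal (signedWeight m p n) * F (p + j) n) = ∑' n : ℕ, ∑' p : ℕ,
        (ENNReal.ofReal ((j : ℝ)⁻¹) * ENNReal.ofReal (signedWeight m p n)) * F (p + j) n := by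
          intro j
          rw [ENNReal.tsum_comm]
          simp_rw [mul_assoc]
      simp_rw [this]
      rw [ENNReal.tsum_comm, ENNReal.tsum_comm (f := fun p n : ℕ =>
        (∑ q ∈ Finset.HasAntidiagonal.antidiagonal p,
        ENNReal.ofReal ((q.1 : ℝ)⁻¹) * ENNReal.ofReal (signedWeight m q.2 n)) * F p n)]
      refine tsum_congr fun n => ?_
      exact tsum_tsum_add_eq_tsum_antidiagonal
        (fun j p => ENNReal.ofReal ((j : ℝ)⁻¹) * ENNReal.ofReal (signedWeight m p n))
        (fun p => F p n)
    have e2 : ∑' j : ℕ, ∑' p : ℕ, ∑' n : ℕ, ENNReal.ofReal ((j : ℝ)⁻¹) *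
        (ENNReal.ofReal (signedWeight m p n) * F p (n + j)) =
        ∑' p : ℕ, ∑' n : ℕ, (∑ q ∈ Finset.HasAntidiagonal.antidiagonal n,
          ENNReal.ofReal ((q.1 : ℝ)⁻¹) *
          ENNReal.ofReal (signedWeight m p q.2)) * F p n := by
      rw [ENNReal.tsum_comm]
      refine tsum_congr fun p => ?_
      simp_rw [← mul_assoc]
      exact tsum_tsum_add_eq_tsum_antidiagonal
        (fun j n => ENNReal.ofReal ((j : ℝ)⁻¹) * ENNReal.ofReal (signedWeight m p n))
        (fun n => F p n)
    rw [e1, e2, ← ENNReal.tsum_add]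
    refine tsum_congr fun p => ?_
    rw [← ENNReal.tsum_add]
    refine tsum_congr fun n => ?_
    rw [← add_mul, signedWeight_succ]
    congr 1
    have hnn : ∀ a b c : ℕ, 0 ≤ ((c : ℝ)⁻¹) * signedWeight m a b := fun a b c =>
      mul_nonneg (by positivity) (signedWeight_nonneg _ _ _)
    rw [ENNReal.ofReal_add (Finset.sum_nonneg fun _ _ => hnn _ _ _)
      (Finset.sum_nonneg fun _ _ => hnn _ _ _), ENNReal.ofReal_sum_of_nonneg (fun _ _ => hnn _ _ _),
      ENNReal.ofReal_sum_of_nonneg (fun _ _ => hnn _ _ _)]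
    congr 1 <;> exact Finset.sum_congr rfl fun q _ => (ENNReal.ofReal_mul (by positivity)).symm

/-! ### The sums `R` as sums over four natural numbers -/

/-- The denominators of the sums `R`, as a function of `a`, the common absolute value of the
totals, and of the sums `l₁, l₂, l₃` of the entries of the other sign. -/
noncomputable def denomFactor (α β a l₁ l₂ l₃ : ℕ) : ℝ :=
  1 / ((2 * (l₁ + l₂ + a : ℕ) : ℝ) ^ α * (2 * (l₁ + l₃ + a : ℕ) : ℝ) ^ β)

theorem denomFactor_nonneg (α β a l₁ l₂ l₃ : ℕ) : 0 ≤ denomFactor α β a l₁ l₂ l₃ := by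
  unfold denomFactor; positivity

/-- The summand of `R` in terms of `a` and `l₁, l₂, l₃`. -/
noncomputable def blockTerm (m₁ m₂ m₃ α β a l₁ l₂ l₃ : ℕ) : ℝ :=
  signedWeight m₁ (l₁ + a) l₁ * signedWeight m₂ (l₂ + a) l₂ * signedWeight m₃ (l₃ + a) l₃ *
    denomFactor α β a l₁ l₂ l₃

theorem blockTerm_nonneg (m₁ m₂ m₃ α β a l₁ l₂ l₃ : ℕ) :
    0 ≤ blockTerm m₁ m₂ m₃ α β a l₁ l₂ l₃ :=
  mul_nonneg (mul_nonneg (mul_nonneg (signedWeight_nonneg _ _ _) (signedWeight_nonneg _ _ _))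
    (signedWeight_nonneg _ _ _)) (denomFactor_nonneg _ _ _ _ _ _)

theorem termR_nonneg (m₁ m₂ m₃ α β : ℕ) (p) : 0 ≤ termR m₁ m₂ m₃ α β p := by
  unfold termR
  split_ifs
  · have h1 := (prodAbs_pos p.1).le
    have h2 := (prodAbs_pos p.2.1).le
    have h3 := (prodAbs_pos p.2.2).le
    have h4 : ∀ {m : ℕ} (k : Fin m → {z : ℤ // z ≠ 0}), 0 ≤ sumAbs k := fun k =>
      Finset.sum_nonneg fun _ _ => abs_nonneg _
    have := h4 p.1
    have := h4 p.2.1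
    have := h4 p.2.2
    positivity
  · rfl

/-- The pair of positive and negative part, by their difference and their minimum. -/
def diffMinEquiv : ℕ × ℕ ≃ ℤ × ℕ where
  toFun p := ((p.1 : ℤ) - p.2, min p.1 p.2)
  invFun q := (q.2 + q.1.toNat, q.2 + (-q.1).toNat)
  left_inv p := by ext <;> simp <;> omega
  right_inv q := by
    ext
    · simp
    · simp
      omega

theorem tsum_nat_nat_eq_tsum_int_nat (f : ℕ → ℕ → ℝ≥0∞) :
    ∑' p : ℕ, ∑' n : ℕ, f p n = ∑' a : ℤ, ∑' l : ℕ, f (l + a.toNat) (l + (-a).toNat) := by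
  rw [← ENNReal.tsum_prod (f := f), ← diffMinEquiv.symm.tsum_eq, ENNReal.tsum_prod']
  rfl

theorem tsum_prodAbs_inv_int (m : ℕ) (F : ℤ → ℕ → ℝ≥0∞) :
    ∑' k : Fin m → {z : ℤ // z ≠ 0}, ENNReal.ofReal (prodAbs k)⁻¹ *
        F (total k) (posPart k + negPart k) =
      ∑' a : ℤ, ∑' l : ℕ, ENNReal.ofReal (signedWeight m (l + a.natAbs) l) *
        F a (2 * l + a.natAbs) := by
  simp_rw [total_eq]
  rw [tsum_prodAbs_inv m (fun p n => F ((p : ℤ) - n) (p + n)), tsum_nat_nat_eq_tsum_int_nat]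
  refine tsum_congr fun a => tsum_congr fun l => ?_
  have h1 : ((l + a.toNat : ℕ) : ℤ) - ((l + (-a).toNat : ℕ) : ℤ) = a := by omega
  have h2 : l + a.toNat + (l + (-a).toNat) = 2 * l + a.natAbs := by omega
  rw [h1, h2]
  rcases le_total 0 a with ha | ha
  · rw [show a.toNat = a.natAbs by omega, show (-a).toNat = 0 by omega, add_zero]
  · rw [show (-a).toNat = a.natAbs by omega, show a.toNat = 0 by omega, add_zero,
      signedWeight_symm]

theorem tsum_int_eq_tsum_natAbs (f : ℕ → ℝ≥0∞) :
    ∑' a : ℤ, f a.natAbs = ∑' a : ℕ, (if a = 0 then 1 else 2) * f a := by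
  rw [tsum_of_add_one_of_neg_add_one ENNReal.summable ENNReal.summable,
    tsum_eq_zero_add' (f := fun a : ℕ => (if a = 0 then 1 else 2) * f a) ENNReal.summable]
  have h1 : ∀ n : ℕ, ((n : ℤ) + 1).natAbs = n + 1 := fun n => by omega
  have h2 : ∀ n : ℕ, (-((n : ℤ) + 1)).natAbs = n + 1 := fun n => by omega
  simp only [h1, h2, Nat.succ_ne_zero, if_false, if_true, Int.natAbs_zero, one_mul]
  rw [ENNReal.tsum_mul_left]
  ring

/-- The conditions on the totals leave `(total k, total h, total t) = (a, -a, -a)`; vectors of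
opposite totals have the same weights, which gives the factor `2` for `a ≠ 0`. -/
theorem tsum_termR (m₁ m₂ m₃ α β : ℕ) :
    ∑' p, ENNReal.ofReal (termR m₁ m₂ m₃ α β p) =
      ∑' a : ℕ, (if a = 0 then 1 else 2) * ∑' l₁ : ℕ, ∑' l₂ : ℕ, ∑' l₃ : ℕ,
        ENNReal.ofReal (blockTerm m₁ m₂ m₃ α β a l₁ l₂ l₃) := by
  rw [← tsum_int_eq_tsum_natAbs (fun a => ∑' l₁ : ℕ, ∑' l₂ : ℕ, ∑' l₃ : ℕ,
        ENNReal.ofReal (blockTerm m₁ m₂ m₃ α β a l₁ l₂ l₃)), ENNReal.tsum_prod']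
  simp_rw [ENNReal.tsum_prod']
  let Φ : ℤ → ℤ → ℤ → ℕ → ℕ → ℕ → ℝ≥0∞ := fun a b c x y z =>
    if a + b = 0 ∧ a + c = 0 then
      ENNReal.ofReal (1 / (((x + y : ℕ) : ℝ) ^ α * ((x + z : ℕ) : ℝ) ^ β)) else 0
  have h0 : ∀ k h t, ENNReal.ofReal (termR m₁ m₂ m₃ α β (k, h, t)) =
      ENNReal.ofReal (prodAbs k)⁻¹ * (ENNReal.ofReal (prodAbs h)⁻¹ *
        (ENNReal.ofReal (prodAbs t)⁻¹ * Φ (total k) (total h) (total t) (posPart k + negPart k)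
          (posPart h + negPart h) (posPart t + negPart t))) := by
    intro k h t
    have h1 := (prodAbs_pos k).le
    have h2 := (prodAbs_pos h).le
    have h3 := (prodAbs_pos t).le
    simp only [termR, Φ, sumAbs_eq]
    split_ifs
    · rw [← ENNReal.ofReal_mul (by positivity), ← ENNReal.ofReal_mul (by positivity),
        ← ENNReal.ofReal_mul (by positivity)]
      congr 1
      push_cast
      simp only [one_div, mul_inv]
      ring
    · simp
  simp_rw [h0, ENNReal.tsum_mul_left]
  have e3 : ∀ (k : Fin m₁ → {z : ℤ // z ≠ 0}) (h : Fin m₂ → {z : ℤ // z ≠ 0}), _ := fun k h =>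
    tsum_prodAbs_inv_int m₃ (fun c z => Φ (total k) (total h) c (posPart k + negPart k)
      (posPart h + negPart h) z)
  simp_rw [e3]
  have e2 : ∀ k : Fin m₁ → {z : ℤ // z ≠ 0}, _ := fun k => tsum_prodAbs_inv_int m₂ (fun b y =>
    ∑' c : ℤ, ∑' l₃ : ℕ, ENNReal.ofReal (signedWeight m₃ (l₃ + c.natAbs) l₃) *
      Φ (total k) b c (posPart k + negPart k) y (2 * l₃ + c.natAbs))
  simp_rw [e2]
  rw [tsum_prodAbs_inv_int m₁ (fun a x => ∑' b : ℤ, ∑' l₂ : ℕ,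
    ENNReal.ofReal (signedWeight m₂ (l₂ + b.natAbs) l₂) *
    ∑' c : ℤ, ∑' l₃ : ℕ, ENNReal.ofReal (signedWeight m₃ (l₃ + c.natAbs) l₃) *
      Φ a b c x (2 * l₂ + b.natAbs) (2 * l₃ + c.natAbs))]
  refine tsum_congr fun a => tsum_congr fun l₁ => ?_
  rw [tsum_eq_single (-a)]
  · rw [← ENNReal.tsum_mul_left]
    refine tsum_congr fun l₂ => ?_
    rw [tsum_eq_single (-a)]
    · rw [← ENNReal.tsum_mul_left, ← ENNReal.tsum_mul_left]
      refine tsum_congr fun l₃ => ?_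
      simp only [Φ, add_neg_cancel, and_self, if_true, Int.natAbs_neg]
      rw [blockTerm, ENNReal.ofReal_mul, ENNReal.ofReal_mul, ENNReal.ofReal_mul, mul_assoc,
        mul_assoc, denomFactor]
      · congr 5
        push_cast
        ring
      all_goals first
        | exact signedWeight_nonneg _ _ _
        | exact mul_nonneg (signedWeight_nonneg _ _ _) (signedWeight_nonneg _ _ _)
        | exact mul_nonneg (mul_nonneg (signedWeight_nonneg _ _ _) (signedWeight_nonneg _ _ _))
            (signedWeight_nonneg _ _ _)
    · intro c hc
      have : ¬ (a + c = 0) := fun h => hc (by omega)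
      simp [Φ, this]
  · intro b hb
    have : ¬ (a + b = 0) := fun h => hb (by omega)
    simp [Φ, this]

/-! ### Convergence -/

/-- The generating function of the sums `chainSum N L` is a product with positive coefficients, so
each of its terms is bounded by the product. -/
theorem chainSum_mul_pow_le (N L : ℕ) {x : ℝ} (hx : 0 ≤ x) :
    chainSum N L * x ^ N ≤ ∏ n ∈ Finset.Ioo 0 L, (1 + x / n) := by
  rw [Finset.prod_one_add, chainSum, Finset.sum_mul]
  refine (Finset.sum_le_sum fun s hs => ?_).trans
    (Finset.sum_le_sum_of_subset_of_nonneg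
      (fun s hs => Finset.mem_powerset.2 (Finset.mem_powersetCard.1 hs).1)
      fun _ _ _ => Finset.prod_nonneg fun _ _ => by positivity)
  rw [← (Finset.mem_powersetCard.1 hs).2]
  simp_rw [div_eq_mul_inv]
  rw [Finset.prod_mul_distrib, Finset.prod_const, mul_comm]

theorem sum_Ioo_inv_le (L : ℕ) :
    ∑ n ∈ Finset.Ioo 0 L, (n : ℝ)⁻¹ ≤ 1 + Real.log L := by
  refine le_trans ?_ (harmonic_le_one_add_log L)
  rw [harmonic_eq_sum_Icc]
  push_cast
  refine Finset.sum_le_sum_of_subset_of_nonneg ?_ fun _ _ _ => by positivity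
  intro n hn
  simp only [Finset.mem_Ioo, Finset.mem_Icc] at hn ⊢
  omega

/-- Nested harmonic sums grow more slowly than any power. The power `1/8` suffices for the
convergence of the sums `R`. -/
theorem exists_chainSum_le (N : ℕ) :
    ∃ C : ℝ, 0 ≤ C ∧ ∀ L : ℕ, 0 < L → chainSum N L ≤ C * (L : ℝ) ^ (1 / 8 : ℝ) := by
  refine ⟨8 ^ N * Real.exp (1 / 8), by positivity, fun L hL => ?_⟩
  have hL' : (0 : ℝ) < L := by exact_mod_cast hL
  have h1 := chainSum_mul_pow_le N L (x := 1 / 8) (by norm_num)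
  have h2 : ∏ n ∈ Finset.Ioo 0 L, (1 + (1 / 8 : ℝ) / n) ≤
      Real.exp (1 / 8) * (L : ℝ) ^ (1 / 8 : ℝ) := by
    refine (Finset.prod_le_prod (g := fun n : ℕ => Real.exp (1 / 8 / n))
      (fun n _ => by positivity)
      (fun n _ => by rw [add_comm]; exact Real.add_one_le_exp _)).trans ?_
    rw [← Real.exp_sum, Real.rpow_def_of_pos hL', ← Real.exp_add]
    refine Real.exp_le_exp.2 ?_
    have := sum_Ioo_inv_le L
    simp_rw [div_eq_mul_inv (1 / 8 : ℝ)]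
    rw [← Finset.mul_sum]
    linarith
  have h3 := h1.trans h2
  rw [one_div, inv_pow, ← div_eq_mul_inv, div_le_iff₀ (by positivity)] at h3
  linarith

theorem exists_logCoeff_le (i : ℕ) :
    ∃ C : ℝ, 0 ≤ C ∧ ∀ p : ℕ, logCoeff i p ≤ C * (p + 1 : ℝ) ^ (-(7 / 8) : ℝ) := by
  cases i with
  | zero =>
    refine ⟨1, zero_le_one, fun p => ?_⟩
    rcases Nat.eq_zero_or_pos p with rfl | hp
    · simp [logCoeff]
    · simp only [logCoeff, if_true, if_neg hp.ne']
      positivity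
  | succ i =>
    obtain ⟨C, hC, h⟩ := exists_chainSum_le i
    refine ⟨2 * C, by positivity, fun p => ?_⟩
    rcases Nat.eq_zero_or_pos p with rfl | hp
    · rw [logCoeff_succ_zero]; positivity
    have hp' : (0 : ℝ) < p := by exact_mod_cast hp
    have hp1 : (1 : ℝ) ≤ p := by exact_mod_cast hp
    simp only [logCoeff, Nat.succ_ne_zero, if_false, Nat.add_sub_cancel]
    have h1 : (p : ℝ) ^ (1 / 8 : ℝ) / p = (p : ℝ) ^ (-(7 / 8) : ℝ) := by
      rw [← Real.rpow_sub_one hp'.ne']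
      norm_num
    have h2 : (p : ℝ) ^ (-(7 / 8) : ℝ) ≤ 2 * (p + 1 : ℝ) ^ (-(7 / 8) : ℝ) := by
      have h3 : (2 * p : ℝ) ^ (-(7 / 8) : ℝ) ≤ (p + 1 : ℝ) ^ (-(7 / 8) : ℝ) :=
        Real.rpow_le_rpow_of_nonpos (by positivity) (by linarith) (by norm_num)
      rw [Real.mul_rpow (by norm_num) hp'.le] at h3
      have h4 : (1 / 2 : ℝ) ≤ 2 ^ (-(7 / 8) : ℝ) := by
        rw [one_div, ← Real.rpow_neg_one]
        exact Real.rpow_le_rpow_of_exponent_le (by norm_num) (by norm_num)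
      have h5 : 0 ≤ (p : ℝ) ^ (-(7 / 8) : ℝ) := by positivity
      nlinarith
    calc chainSum i p / p ≤ C * (p : ℝ) ^ (1 / 8 : ℝ) / p := by gcongr; exact h p hp
      _ = C * (p : ℝ) ^ (-(7 / 8) : ℝ) := by rw [mul_div_assoc, h1]
      _ ≤ 2 * C * (p + 1 : ℝ) ^ (-(7 / 8) : ℝ) := by nlinarith

/-- The decay `(l + a)^{-7/8} l^{-7/8}` is distributed so that the sum over `l` converges, as
`11/8 > 1`, and so does the sum over `a` of a product of three weights, as `3 · 3/8 > 1`. -/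
theorem exists_signedWeight_le (m : ℕ) :
    ∃ C : ℝ, 0 ≤ C ∧ ∀ l a : ℕ, signedWeight m (l + a) l ≤
      C * ((a + 1 : ℝ) ^ (-(3 / 8) : ℝ) * (l + 1 : ℝ) ^ (-(11 / 8) : ℝ)) := by
  choose C hC h using exists_logCoeff_le
  refine ⟨m.factorial * ∑ q ∈ Finset.HasAntidiagonal.antidiagonal m, C q.1 * C q.2,
    mul_nonneg (by positivity) (Finset.sum_nonneg fun _ _ => mul_nonneg (hC _) (hC _)),
    fun l a => ?_⟩
  rw [signedWeight, mul_assoc]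
  refine mul_le_mul_of_nonneg_left ?_ (by positivity)
  rw [Finset.sum_mul]
  refine Finset.sum_le_sum fun q _ => ?_
  have h1 : ((l + a : ℕ) + 1 : ℝ) ^ (-(7 / 8) : ℝ) ≤
      (a + 1 : ℝ) ^ (-(3 / 8) : ℝ) * (l + 1 : ℝ) ^ (-(4 / 8) : ℝ) := by
    have hp : (0 : ℝ) < (l + a : ℕ) + 1 := by positivity
    rw [show (-(7 / 8) : ℝ) = -(3 / 8) + -(4 / 8) by norm_num, Real.rpow_add hp]
    push_cast
    have ha : (0 : ℝ) ≤ a := by positivity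
    have hl : (0 : ℝ) ≤ l := by positivity
    exact mul_le_mul (Real.rpow_le_rpow_of_nonpos (by positivity) (by linarith) (by norm_num))
      (Real.rpow_le_rpow_of_nonpos (by positivity) (by linarith) (by norm_num))
      (by positivity) (by positivity)
  have h2 : (l + 1 : ℝ) ^ (-(4 / 8) : ℝ) * (l + 1 : ℝ) ^ (-(7 / 8) : ℝ) =
      (l + 1 : ℝ) ^ (-(11 / 8) : ℝ) := by
    rw [← Real.rpow_add (by positivity)]
    norm_num
  calc logCoeff q.1 (l + a) * logCoeff q.2 l
      ≤ (C q.1 * ((l + a : ℕ) + 1 : ℝ) ^ (-(7 / 8) : ℝ)) *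
        (C q.2 * (l + 1 : ℝ) ^ (-(7 / 8) : ℝ)) :=
        mul_le_mul (h _ _) (h _ _) (logCoeff_nonneg _ _) (mul_nonneg (hC _) (by positivity))
    _ = C q.1 * C q.2 * (((l + a : ℕ) + 1 : ℝ) ^ (-(7 / 8) : ℝ) *
        (l + 1 : ℝ) ^ (-(7 / 8) : ℝ)) := by ring
    _ ≤ C q.1 * C q.2 * (((a + 1 : ℝ) ^ (-(3 / 8) : ℝ) * (l + 1 : ℝ) ^ (-(4 / 8) : ℝ)) *
        (l + 1 : ℝ) ^ (-(7 / 8) : ℝ)) := by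
        refine mul_le_mul_of_nonneg_left ?_ (mul_nonneg (hC _) (hC _))
        exact mul_le_mul_of_nonneg_right h1 (by positivity)
    _ = _ := by rw [mul_assoc ((a + 1 : ℝ) ^ (-(3 / 8) : ℝ)), h2]

/-- A vanishing sum `l₁ + l₂ + a` or `l₁ + l₃ + a` is covered by the convention `1 / 0 = 0`. -/
theorem denomFactor_le_one (α β a l₁ l₂ l₃ : ℕ) : denomFactor α β a l₁ l₂ l₃ ≤ 1 := by
  have key : ∀ n e : ℕ, ((2 * (n : ℝ)) ^ e)⁻¹ ≤ 1 := by
    intro n e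
    rcases Nat.eq_zero_or_pos n with rfl | hn
    · rcases Nat.eq_zero_or_pos e with rfl | he
      · simp
      · simp [he.ne']
    · have : (1 : ℝ) ≤ n := by exact_mod_cast hn
      exact inv_le_one_of_one_le₀ (one_le_pow₀ (by linarith))
  unfold denomFactor
  rw [one_div, mul_inv]
  exact mul_le_one₀ (key _ _) (by positivity) (key _ _)

theorem tsum_rpow_ne_top {s : ℝ} (hs : s < -1) :
    ∑' n : ℕ, ENNReal.ofReal ((n + 1 : ℝ) ^ s) ≠ ∞ := by
  have h : Summable fun n : ℕ => ((n : ℝ)) ^ s := Real.summable_nat_rpow.2 hs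
  have h' := (summable_nat_add_iff 1).2 h
  push_cast at h'
  exact h'.tsum_ofReal_ne_top

theorem tsum_blockTerm_ne_top (m₁ m₂ m₃ α β : ℕ) :
    ∑' a : ℕ, ∑' l₁ : ℕ, ∑' l₂ : ℕ, ∑' l₃ : ℕ,
      ENNReal.ofReal (blockTerm m₁ m₂ m₃ α β a l₁ l₂ l₃) ≠ ∞ := by
  obtain ⟨C₁, hC₁, h₁⟩ := exists_signedWeight_le m₁
  obtain ⟨C₂, hC₂, h₂⟩ := exists_signedWeight_le m₂
  obtain ⟨C₃, hC₃, h₃⟩ := exists_signedWeight_le m₃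
  let g : ℕ → ℝ := fun l => (l + 1 : ℝ) ^ (-(11 / 8) : ℝ)
  let f : ℕ → ℝ := fun a => (a + 1 : ℝ) ^ (-(9 / 8) : ℝ)
  have hg : ∀ l, 0 ≤ g l := fun l => by positivity
  have hf : ∀ l, 0 ≤ f l := fun l => by positivity
  have hle : ∀ a l₁ l₂ l₃ : ℕ, ENNReal.ofReal (blockTerm m₁ m₂ m₃ α β a l₁ l₂ l₃) ≤
      ENNReal.ofReal (C₁ * C₂ * C₃) * (ENNReal.ofReal (f a) * (ENNReal.ofReal (g l₁) *
        (ENNReal.ofReal (g l₂) * ENNReal.ofReal (g l₃)))) := by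
    intro a l₁ l₂ l₃
    have hg1 := hg l₁
    have hg2 := hg l₂
    have hg3 := hg l₃
    have hfa := hf a
    rw [← ENNReal.ofReal_mul (by positivity), ← ENNReal.ofReal_mul (by positivity),
      ← ENNReal.ofReal_mul (by positivity), ← ENNReal.ofReal_mul (by positivity)]
    refine ENNReal.ofReal_le_ofReal ?_
    have h3 : (a + 1 : ℝ) ^ (-(3 / 8) : ℝ) * (a + 1 : ℝ) ^ (-(3 / 8) : ℝ) *
        (a + 1 : ℝ) ^ (-(3 / 8) : ℝ) = f a := by
      rw [← Real.rpow_add (by positivity), ← Real.rpow_add (by positivity)]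
      norm_num [f]
    calc blockTerm m₁ m₂ m₃ α β a l₁ l₂ l₃ ≤ _ :=
          mul_le_mul (mul_le_mul (mul_le_mul (h₁ l₁ a) (h₂ l₂ a) (signedWeight_nonneg _ _ _)
            (by positivity)) (h₃ l₃ a) (signedWeight_nonneg _ _ _) (by positivity))
            (denomFactor_le_one α β a l₁ l₂ l₃) (denomFactor_nonneg _ _ _ _ _ _) (by positivity)
      _ = C₁ * C₂ * C₃ * (((a + 1 : ℝ) ^ (-(3 / 8) : ℝ) * (a + 1 : ℝ) ^ (-(3 / 8) : ℝ) *
        (a + 1 : ℝ) ^ (-(3 / 8) : ℝ)) * (g l₁ * (g l₂ * g l₃))) := by ring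
      _ = _ := by rw [h3]
  refine ne_top_of_le_ne_top ?_ (ENNReal.tsum_le_tsum fun a => ENNReal.tsum_le_tsum fun l₁ =>
    ENNReal.tsum_le_tsum fun l₂ => ENNReal.tsum_le_tsum fun l₃ => hle a l₁ l₂ l₃)
  simp_rw [ENNReal.tsum_mul_left, ENNReal.tsum_mul_right]
  have G := tsum_rpow_ne_top (s := -(11 / 8)) (by norm_num)
  have F := tsum_rpow_ne_top (s := -(9 / 8)) (by norm_num)
  refine ENNReal.mul_ne_top ENNReal.ofReal_ne_top (ENNReal.mul_ne_top F ?_)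
  exact ENNReal.mul_ne_top G (ENNReal.mul_ne_top G G)

theorem tsum_termR_ne_top (m₁ m₂ m₃ α β : ℕ) :
    ∑' p, ENNReal.ofReal (termR m₁ m₂ m₃ α β p) ≠ ∞ := by
  rw [tsum_termR]
  refine ne_top_of_le_ne_top (ENNReal.mul_ne_top (a := 2) (by simp)
    (tsum_blockTerm_ne_top m₁ m₂ m₃ α β)) ?_
  rw [← ENNReal.tsum_mul_left]
  refine ENNReal.tsum_le_tsum fun a => mul_le_mul_left ?_ _
  split_ifs <;> norm_num

theorem summable_termR (m₁ m₂ m₃ α β : ℕ) : Summable (termR m₁ m₂ m₃ α β) := by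
  have h := ENNReal.summable_toReal (tsum_termR_ne_top m₁ m₂ m₃ α β)
  simpa only [ENNReal.toReal_ofReal (termR_nonneg m₁ m₂ m₃ α β _)] using h

theorem ofReal_tsum_termR (m₁ m₂ m₃ α β : ℕ) :
    ∑' p, termR m₁ m₂ m₃ α β p = (∑' p, ENNReal.ofReal (termR m₁ m₂ m₃ α β p)).toReal := by
  rw [ENNReal.tsum_toReal_eq (fun _ => ENNReal.ofReal_ne_top)]
  exact tsum_congr fun p => (ENNReal.toReal_ofReal (termR_nonneg _ _ _ _ _ p)).symm

/-! ### The sums `R` are conical sums -/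

/-- The non-negative rational combinations of the functions `conicTerm`. -/
inductive ConicFun {V : Type} : ((V → ℕ+) → ℝ≥0∞) → Prop
  | term (R : List (Finset V)) (T : List (Finset V × ℕ)) (hR : ∀ S ∈ R, S.Nonempty) :
      ConicFun (conicTerm R T)
  | zero : ConicFun fun _ => 0
  | add {f g : (V → ℕ+) → ℝ≥0∞} : ConicFun f → ConicFun g → ConicFun fun x => f x + g x
  | smul {f : (V → ℕ+) → ℝ≥0∞} (q : ℚ) (hq : 0 ≤ q) : ConicFun f →
      ConicFun fun x => ENNReal.ofReal q * f x

namespace ConicFun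

variable {V : Type} {f g : (V → ℕ+) → ℝ≥0∞}

theorem one : ConicFun fun _ : V → ℕ+ => 1 := by
  refine Eq.mpr (congrArg ConicFun (funext fun x => ?_)) (term (V := V) [] [] (by simp))
  simp [conicTerm]

theorem const (q : ℚ) (hq : 0 ≤ q) : ConicFun fun _ : V → ℕ+ => ENNReal.ofReal q := by
  simpa using smul q hq (one (V := V))

theorem mul (hf : ConicFun f) (hg : ConicFun g) : ConicFun fun x => f x * g x := by
  induction hf with
  | zero => simpa using zero
  | add _ _ h1 h2 => simpa only [add_mul] using add h1 h2
  | smul q hq _ h => simpa only [mul_assoc] using smul q hq h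
  | term R T hR =>
    induction hg with
    | zero => simpa using zero
    | add _ _ h1 h2 => simpa only [mul_add] using add h1 h2
    | smul q hq _ h => simpa only [mul_left_comm] using smul q hq h
    | term R' T' hR' =>
      have := term (R ++ R') (T ++ T') (by
        intro S hS
        rcases List.mem_append.1 hS with h | h
        · exact hR S h
        · exact hR' S h)
      refine Eq.mpr (congrArg ConicFun (funext fun x => ?_)) this
      simp only [conicTerm, List.map_append, List.prod_append]
      ring

theorem sum {ι : Type*} (s : Finset ι) {F : ι → (V → ℕ+) → ℝ≥0∞} (h : ∀ i ∈ s, ConicFun (F i)) :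
    ConicFun fun x => ∑ i ∈ s, F i x := by
  classical
  induction s using Finset.induction_on with
  | empty => simpa using zero
  | insert i s hi ih =>
    simp_rw [Finset.sum_insert hi]
    exact add (h i (by simp)) (ih fun j hj => h j (by simp [hj]))

theorem pow (hf : ConicFun f) (n : ℕ) : ConicFun fun x => f x ^ n := by
  induction n with
  | zero => simpa using one
  | succ n ih => simpa only [pow_succ] using ih.mul hf

theorem inB_tsum [Fintype V] [DecidableEq V] (hf : ConicFun f) : InB (∑' x, f x) := by
  induction hf with
  | zero => simpa using InB.zero
  | add _ _ h1 h2 => rw [ENNReal.tsum_add]; exact h1.add h2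
  | smul q hq _ h =>
    rw [ENNReal.tsum_mul_left]
    exact h.rat_mul q (ENNReal.toReal_ofReal (by exact_mod_cast hq))
  | term R T hR => exact inB_tsum_conicTerm _ R T hR le_rfl

theorem inv_form (S : Finset V) (hS : S.Nonempty) :
    ConicFun fun x : V → ℕ+ => (form x S : ℝ≥0∞)⁻¹ := by
  refine Eq.mpr (congrArg ConicFun (funext fun x => ?_)) (term (V := V) [S] [] (by simpa using hS))
  simp [conicTerm]

theorem nestedSum_form (N : ℕ) (S : Finset V) :
    ConicFun fun x : V → ℕ+ => nestedSum N (form x S) := by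
  refine Eq.mpr (congrArg ConicFun (funext fun x => ?_)) (term (V := V) [] [(S, N)] (by simp))
  simp [conicTerm]

theorem logCoeff_form (i : ℕ) (S : Finset V) :
    ConicFun fun x : V → ℕ+ => ENNReal.ofReal (logCoeff i (form x S)) := by
  rcases S.eq_empty_or_nonempty with rfl | hS
  · cases i with
    | zero => simpa [form, logCoeff] using one
    | succ i => simpa [form, logCoeff] using zero
  · cases i with
    | zero =>
      have : ∀ x : V → ℕ+, form x S ≠ 0 := fun x => (form_pos x hS).ne'
      simpa [logCoeff, this] using zero
    | succ i =>
      refine Eq.mpr (congrArg ConicFun (funext fun x => ?_))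
        ((nestedSum_form i S).mul (inv_form S hS))
      have : (0 : ℝ) < form x S := by exact_mod_cast form_pos x hS
      rw [nestedSum_eq, ← ENNReal.ofReal_natCast, ← ENNReal.ofReal_inv_of_pos this,
        ← ENNReal.ofReal_mul (chainSum_nonneg _ _)]
      simp [logCoeff, div_eq_mul_inv]

theorem signedWeight_form (m : ℕ) (S T : Finset V) :
    ConicFun fun x : V → ℕ+ => ENNReal.ofReal (signedWeight m (form x S) (form x T)) := by
  have := smul (m.factorial : ℚ) (by positivity) (sum (Finset.HasAntidiagonal.antidiagonal m)
    (F := fun q x => ENNReal.ofReal (logCoeff q.1 (form x S)) *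
      ENNReal.ofReal (logCoeff q.2 (form x T)))
    fun q _ => (logCoeff_form q.1 S).mul (logCoeff_form q.2 T))
  refine Eq.mpr (congrArg ConicFun (funext fun x => ?_)) this
  rw [signedWeight, ENNReal.ofReal_mul (by positivity), ENNReal.ofReal_sum_of_nonneg
    (fun _ _ => mul_nonneg (logCoeff_nonneg _ _) (logCoeff_nonneg _ _))]
  congr 1
  exact Finset.sum_congr rfl fun q _ => ENNReal.ofReal_mul (logCoeff_nonneg _ _)

theorem inv_two_mul_form_pow (S : Finset V) (α : ℕ) :
    ConicFun fun x : V → ℕ+ => ENNReal.ofReal ((2 * (form x S : ℝ)) ^ α)⁻¹ := by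
  rcases S.eq_empty_or_nonempty with rfl | hS
  -- the empty form gives the constant `(0 ^ α)⁻¹`, which is `0` or `1`
  · have h := const (V := V) (((0 : ℚ) ^ α)⁻¹) (by positivity)
    push_cast at h
    simpa [form] using h
  · refine Eq.mpr (congrArg ConicFun (funext fun x => ?_))
      (smul (((2 : ℚ) ^ α)⁻¹) (by positivity) ((inv_form S hS).pow α))
    have : (0 : ℝ) < form x S := by exact_mod_cast form_pos x hS
    rw [mul_pow, mul_inv, ENNReal.ofReal_mul (by positivity), ← ENNReal.ofReal_natCast,
      ← ENNReal.ofReal_inv_of_pos this, ← ENNReal.ofReal_pow (by positivity), inv_pow]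
    push_cast
    rfl

end ConicFun

/-- A sum over vectors of natural numbers, split according to the support. -/
theorem tsum_eq_sum_support {ι : Type} [Fintype ι] [DecidableEq ι] (F : (ι → ℕ) → ℝ≥0∞) :
    ∑' n, F n = ∑ S : Finset ι, ∑' x : S → ℕ+,
      F fun i => form x (Finset.univ.filter fun j => j.1 = i) := by
  have hform : ∀ (S : Finset ι) (x : S → ℕ+) (i : ι),
      form x (Finset.univ.filter fun j => j.1 = i) = if h : i ∈ S then (x ⟨i, h⟩ : ℕ) else 0 := by
    intro S x i
    unfold form
    split_ifs with h
    · rw [Finset.sum_eq_single ⟨i, h⟩]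
      · intro j hj hne
        exact absurd (Subtype.ext (Finset.mem_filter.1 hj).2) hne
      · simp
    · refine Finset.sum_eq_zero fun j hj => ?_
      exact absurd ((Finset.mem_filter.1 hj).2 ▸ j.2) h
  let e : (Σ S : Finset ι, (S → ℕ+)) → (ι → ℕ) := fun p i =>
    form p.2 (Finset.univ.filter fun j => j.1 = i)
  have he : Function.Bijective e := by
    constructor
    · rintro ⟨S, x⟩ ⟨T, y⟩ h
      have h' : ∀ i, (if h : i ∈ S then (x ⟨i, h⟩ : ℕ) else 0) =
          if h : i ∈ T then (y ⟨i, h⟩ : ℕ) else 0 := fun i => by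
        rw [← hform, ← hform]; exact congrFun h i
      have hST : S = T := by
        ext i
        have hi := h' i
        by_cases h1 : i ∈ S <;> by_cases h2 : i ∈ T
        · simp [h1, h2]
        · rw [dif_pos h1, dif_neg h2] at hi
          exact absurd hi (PNat.ne_zero _)
        · rw [dif_neg h1, dif_pos h2] at hi
          exact absurd hi.symm (PNat.ne_zero _)
        · simp [h1, h2]
      subst hST
      congr
      funext i
      have := h' i
      simpa using this
    · intro n
      refine ⟨⟨Finset.univ.filter fun i => n i ≠ 0, fun i => Nat.toPNat (n i)
        (Nat.pos_of_ne_zero (Finset.mem_filter.1 i.2).2)⟩, funext fun i => ?_⟩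
      simp only [e]
      rw [hform]
      by_cases h : n i = 0
      · simp [h]
      · rw [dif_pos (by simpa using h)]
        rfl
  rw [← (Equiv.ofBijective e he).tsum_eq, ENNReal.tsum_sigma', tsum_fintype]
  rfl

/-- A quadruple as a function on `Fin 4`. -/
def quadEquiv : ℕ × ℕ × ℕ × ℕ ≃ (Fin 4 → ℕ) where
  toFun p := ![p.1, p.2.1, p.2.2.1, p.2.2.2]
  invFun n := (n 0, n 1, n 2, n 3)
  left_inv _ := rfl
  right_inv n := by ext i; fin_cases i <;> rfl

/-- After splitting by support, each of the four numbers `a, l₁, l₂, l₃` is zero or a positive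
variable, and the summand is a combination of the functions `conicTerm` of these variables. -/
theorem inB_tsum_termR (m₁ m₂ m₃ α β : ℕ) : InB (∑' p, ENNReal.ofReal (termR m₁ m₂ m₃ α β p)) := by
  let F : (Fin 4 → ℕ) → ℝ≥0∞ := fun n => (if n 0 = 0 then 1 else 2) *
    ENNReal.ofReal (blockTerm m₁ m₂ m₃ α β (n 0) (n 1) (n 2) (n 3))
  have h : ∑' p, ENNReal.ofReal (termR m₁ m₂ m₃ α β p) = ∑' n, F n := by
    rw [tsum_termR, ← quadEquiv.tsum_eq, ENNReal.tsum_prod']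
    refine tsum_congr fun a => ?_
    rw [← ENNReal.tsum_mul_left, ENNReal.tsum_prod']
    refine tsum_congr fun l₁ => ?_
    rw [← ENNReal.tsum_mul_left, ENNReal.tsum_prod']
    refine tsum_congr fun l₂ => ?_
    rw [← ENNReal.tsum_mul_left]
    rfl
  rw [h, tsum_eq_sum_support]
  refine InB.sum _ fun S _ => ConicFun.inB_tsum ?_
  let s : Fin 4 → Finset S := fun i => Finset.univ.filter fun j => j.1 = i
  have hdisj : ∀ i j : Fin 4, i ≠ j → Disjoint (s i) (s j) := by
    intro i j hij
    rw [Finset.disjoint_left]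
    intro v hv hv'
    exact hij ((Finset.mem_filter.1 hv).2.symm.trans (Finset.mem_filter.1 hv').2)
  have hadd : ∀ (x : S → ℕ+) (i j : Fin 4), i ≠ j →
      form x (s i) + form x (s j) = form x (s i ∪ s j) := fun x i j hij =>
    (Finset.sum_union (hdisj i j hij)).symm
  have hadd3 : ∀ (x : S → ℕ+) (i j k : Fin 4), i ≠ j → i ≠ k → j ≠ k →
      form x (s i) + form x (s j) + form x (s k) = form x (s i ∪ s j ∪ s k) := by
    intro x i j k hij hik hjk
    rw [hadd x i j hij]
    exact (Finset.sum_union (Finset.disjoint_union_left.2 ⟨hdisj i k hik, hdisj j k hjk⟩)).symm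
  have hc : ConicFun fun x : S → ℕ+ => (if form x (s 0) = 0 then (1 : ℝ≥0∞) else 2) := by
    rcases (s 0).eq_empty_or_nonempty with h0 | h0
    · simpa [h0, form] using ConicFun.one
    · have : ∀ x : S → ℕ+, form x (s 0) ≠ 0 := fun x => (form_pos x h0).ne'
      simpa [this] using ConicFun.const (V := S) 2 (by norm_num)
  have key := hc.mul (((((ConicFun.signedWeight_form m₁ (s 1 ∪ s 0) (s 1)).mul
    (ConicFun.signedWeight_form m₂ (s 2 ∪ s 0) (s 2))).mul
    (ConicFun.signedWeight_form m₃ (s 3 ∪ s 0) (s 3))).mul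
    ((ConicFun.inv_two_mul_form_pow (s 1 ∪ s 2 ∪ s 0) α).mul
      (ConicFun.inv_two_mul_form_pow (s 1 ∪ s 3 ∪ s 0) β))))
  refine Eq.mpr (congrArg ConicFun (funext fun x => ?_)) key
  simp only [F]
  congr 1
  rw [blockTerm, ENNReal.ofReal_mul, ENNReal.ofReal_mul, ENNReal.ofReal_mul, denomFactor,
    one_div, mul_inv, ENNReal.ofReal_mul (by positivity), hadd x 1 0 (by decide),
    hadd x 2 0 (by decide), hadd x 3 0 (by decide), hadd3 x 1 2 0 (by decide) (by decide)
    (by decide), hadd3 x 1 3 0 (by decide) (by decide) (by decide)]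
  all_goals first
        | exact signedWeight_nonneg _ _ _
        | exact mul_nonneg (signedWeight_nonneg _ _ _) (signedWeight_nonneg _ _ _)
        | exact mul_nonneg (mul_nonneg (signedWeight_nonneg _ _ _) (signedWeight_nonneg _ _ _))
            (signedWeight_nonneg _ _ _)

theorem tsum_termR_mem (m₁ m₂ m₃ α β : ℕ) :
    ∑' p, termR m₁ m₂ m₃ α β p ∈ conicalAlgebra01 := by
  rw [ofReal_tsum_termR]
  exact inB_tsum_termR m₁ m₂ m₃ α β (tsum_termR_ne_top m₁ m₂ m₃ α β)

/-! ### The blocks of the explicit formula -/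

/-- The terms with `q.1 = 0` or `q.2 = 0` vanish, and the others are shifted by one in each index.
-/
theorem sum_logCoeff_mul (m p n : ℕ) (hp : p ≠ 0) (hn : n ≠ 0) :
    ∑ q ∈ Finset.HasAntidiagonal.antidiagonal (m + 2), logCoeff q.1 p * logCoeff q.2 n =
      ∑ q ∈ Finset.HasAntidiagonal.antidiagonal m,
        chainSum q.1 p * chainSum q.2 n / ((p : ℝ) * n) := by
  have h0 : ∀ p : ℕ, p ≠ 0 → logCoeff 0 p = 0 := fun p hp => by simp [logCoeff, hp]
  rw [Finset.Nat.sum_antidiagonal_succ, Finset.Nat.sum_antidiagonal_succ', h0 p hp, h0 n hn]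
  simp only [zero_mul, mul_zero, zero_add]
  refine Finset.sum_congr rfl fun q _ => ?_
  simp only [logCoeff, Nat.succ_ne_zero, if_false, Nat.add_sub_cancel]
  rw [div_mul_div_comm]

theorem signedWeight_eq_blockSum (m l a : ℕ) (hm : 1 ≤ m) (ha : 1 ≤ a) :
    signedWeight m (l + a) l = m.factorial * blockSum m l a := by
  obtain ⟨m, rfl⟩ : ∃ n, m = n + 1 := ⟨m - 1, by omega⟩
  rw [signedWeight, blockSum]
  congr 1
  split_ifs with hl
  · subst hl
    rw [Finset.sum_eq_single (m + 1, 0)]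
    · simp [logCoeff]
    · intro q hq hne
      have h1 := Finset.HasAntidiagonal.mem_antidiagonal.1 hq
      obtain ⟨i, hi⟩ : ∃ i, q.2 = i + 1 := ⟨q.2 - 1, by
        have : q.2 ≠ 0 := fun h => hne (Prod.ext (by simpa [h] using h1) h)
        omega⟩
      rw [hi, logCoeff_succ_zero, mul_zero]
    · intro h
      exact absurd (Finset.HasAntidiagonal.mem_antidiagonal.2 (by simp)) h
  · cases m with
    | zero =>
      rw [Finset.filter_false_of_mem (fun p _ => by omega), Finset.sum_empty, zero_add,
        Finset.Nat.antidiagonal_succ]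
      simp [logCoeff, hl]
    | succ k =>
      rw [sum_logCoeff_mul k (l + a) l (by omega) hl]
      have : (Finset.range (k + 1 + 1) ×ˢ Finset.range (k + 1 + 1)).filter
          (fun p => p.1 + p.2 + 2 = k + 1 + 1) = Finset.HasAntidiagonal.antidiagonal k := by
        ext p
        simp only [Finset.mem_filter, Finset.mem_product, Finset.mem_range,
          Finset.HasAntidiagonal.mem_antidiagonal]
        omega
      rw [this]
      push_cast
      rfl

theorem coeff_prod_one_add_X (c : ℝ) (N l : ℕ) :
    (∏ n ∈ Finset.Ioo 0 l, (1 + Polynomial.C (c * (n : ℝ)⁻¹) * Polynomial.X)).coeff N =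
      c ^ N * chainSum N l := by
  rw [Finset.prod_one_add, Polynomial.finsetSum_coeff, chainSum, Finset.mul_sum]
  have : ∀ s : Finset ℕ, (∏ n ∈ s, (Polynomial.C (c * (n : ℝ)⁻¹) * Polynomial.X)).coeff N =
      if s.card = N then c ^ N * ∏ n ∈ s, ((n : ℝ))⁻¹ else 0 := by
    intro s
    rw [Finset.prod_mul_distrib, Finset.prod_const, ← map_prod, Polynomial.coeff_C_mul,
      Polynomial.coeff_X_pow, Finset.prod_mul_distrib, Finset.prod_const]
    by_cases h : s.card = N
    · simp [h]
    · simp [h, Ne.symm h]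
  simp_rw [this]
  rw [← Finset.sum_filter, ← Finset.powersetCard_eq_filter]

/-- Both sides are coefficients of `∏ (1 + 4x/n + 4x²/n²) = ∏ (1 + 2x/n)²`. -/
theorem chainSum12_eq (m l : ℕ) :
    chainSum12 (m + 2) l =
      2 ^ m * ∑ q ∈ Finset.HasAntidiagonal.antidiagonal m, chainSum q.1 l * chainSum q.2 l := by
  have h1 : (∏ n ∈ Finset.Ioo 0 l, (1 + ∑ γ ∈ ({1, 2} : Finset ℕ),
      Polynomial.C (4 * ((n : ℝ) ^ γ)⁻¹) * Polynomial.X ^ γ)).coeff m = chainSum12 (m + 2) l := by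
    rw [Finset.prod_one_add, Polynomial.finsetSum_coeff, chainSum12]
    refine Finset.sum_congr rfl fun s _ => ?_
    rw [Finset.prod_sum, Polynomial.finsetSum_coeff, Finset.sum_filter]
    refine Finset.sum_congr rfl fun γ _ => ?_
    rw [Finset.prod_mul_distrib, ← map_prod, Polynomial.coeff_C_mul, Finset.prod_pow_eq_pow_sum,
      Polynomial.coeff_X_pow, Finset.prod_mul_distrib, Finset.prod_const, Finset.card_attach]
    by_cases h : ∑ n ∈ s.attach, γ n.1 n.2 = m
    · simp [h, div_eq_mul_inv]
    · have h' : ¬ (∑ n ∈ s.attach, γ n.1 n.2) + 2 = m + 2 := fun h' => h (by omega)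
      rw [if_neg h', if_neg (Ne.symm h), mul_zero]
  have h2 : ∀ n : ℕ, (1 + ∑ γ ∈ ({1, 2} : Finset ℕ),
      Polynomial.C (4 * ((n : ℝ) ^ γ)⁻¹) * Polynomial.X ^ γ) =
      (1 + Polynomial.C (2 * (n : ℝ)⁻¹) * Polynomial.X) *
        (1 + Polynomial.C (2 * (n : ℝ)⁻¹) * Polynomial.X) := by
    intro n
    have e1 : (4 * ((n : ℝ) ^ 2)⁻¹) = (2 * (n : ℝ)⁻¹) * (2 * (n : ℝ)⁻¹) := by
      ring
    have e2 : (4 * ((n : ℝ) ^ 1)⁻¹) = 2 * (n : ℝ)⁻¹ + 2 * (n : ℝ)⁻¹ := by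
      rw [pow_one]; ring
    rw [Finset.sum_pair (by norm_num), e1, e2, Polynomial.C_mul (a := 2 * (n : ℝ)⁻¹),
      Polynomial.C_add]
    ring
  simp_rw [h2] at h1
  rw [← h1, Finset.prod_mul_distrib, Polynomial.coeff_mul, Finset.mul_sum]
  refine Finset.sum_congr rfl fun q hq => ?_
  rw [coeff_prod_one_add_X, coeff_prod_one_add_X, ← Finset.HasAntidiagonal.mem_antidiagonal.1 hq,
    pow_add]
  ring

theorem chainSum12_one (l : ℕ) : chainSum12 1 l = 0 := by
  refine Finset.sum_eq_zero fun s _ => ?_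
  rw [Finset.filter_false_of_mem (fun γ _ => by omega), Finset.sum_empty]

theorem signedWeight_eq_chainSum12 (m l : ℕ) (hm : 1 ≤ m) (hl : l ≠ 0) :
    signedWeight m l l = m.factorial * (4 / 2 ^ m) * (chainSum12 m l / (l : ℝ) ^ 2) := by
  match m, hm with
  | 1, _ =>
    rw [chainSum12_one, signedWeight, Finset.Nat.antidiagonal_succ]
    simp [logCoeff, hl]
  | m + 2, _ =>
    rw [chainSum12_eq, signedWeight, sum_logCoeff_mul _ _ _ hl hl, ← Finset.sum_div]
    have : (l : ℝ) ≠ 0 := by exact_mod_cast hl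
    field_simp
    ring

theorem signedWeight_zero_zero (m : ℕ) (hm : 1 ≤ m) : signedWeight m 0 0 = 0 := by
  rw [signedWeight, Finset.sum_eq_zero, mul_zero]
  intro q hq
  have h1 := Finset.HasAntidiagonal.mem_antidiagonal.1 hq
  by_cases h : q.1 = 0
  · obtain ⟨i, hi⟩ : ∃ i, q.2 = i + 1 := ⟨q.2 - 1, by omega⟩
    rw [hi, logCoeff_succ_zero, mul_zero]
  · obtain ⟨i, hi⟩ : ∃ i, q.1 = i + 1 := ⟨q.1 - 1, by omega⟩
    rw [hi, logCoeff_succ_zero, zero_mul]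

theorem tsum_nat_eq_tsum_pnat (f : ℕ → ℝ≥0∞) (hf : f 0 = 0) : ∑' n, f n = ∑' n : ℕ+, f n := by
  refine (PNat.coe_injective.tsum_eq fun n hn => ?_).symm
  have : n ≠ 0 := by rintro rfl; exact hn hf
  exact ⟨⟨n, Nat.pos_of_ne_zero this⟩, rfl⟩

theorem blockTerm_eq_termPos (m₁ m₂ m₃ α β : ℕ) (h₁ : 1 ≤ m₁) (h₂ : 1 ≤ m₂) (h₃ : 1 ≤ m₃)
    (x : ℕ+ × ℕ × ℕ × ℕ) :
    blockTerm m₁ m₂ m₃ α β x.1 x.2.1 x.2.2.1 x.2.2.2 =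
      ((m₁.factorial * m₂.factorial * m₃.factorial : ℕ) : ℝ) / 2 ^ (α + β) *
        termPos m₁ m₂ m₃ α β x := by
  rw [blockTerm, signedWeight_eq_blockSum _ _ _ h₁ x.1.pos,
    signedWeight_eq_blockSum _ _ _ h₂ x.1.pos, signedWeight_eq_blockSum _ _ _ h₃ x.1.pos,
    denomFactor, termPos]
  push_cast
  rw [mul_pow, mul_pow, pow_add]
  simp only [div_eq_mul_inv, mul_inv]
  ring

theorem blockTerm_eq_termZero (m₁ m₂ m₃ α β : ℕ) (h₁ : 1 ≤ m₁) (h₂ : 1 ≤ m₂) (h₃ : 1 ≤ m₃)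
    (l : ℕ+ × ℕ+ × ℕ+) :
    blockTerm m₁ m₂ m₃ α β 0 l.1 l.2.1 l.2.2 =
      ((m₁.factorial * m₂.factorial * m₃.factorial : ℕ) : ℝ) /
        (2 : ℝ) ^ (((α + β + m₁ + m₂ + m₃ : ℕ) : ℤ) - 6) * termZero m₁ m₂ m₃ α β l := by
  simp only [blockTerm, add_zero]
  rw [signedWeight_eq_chainSum12 _ _ h₁ l.1.ne_zero,
    signedWeight_eq_chainSum12 _ _ h₂ l.2.1.ne_zero,
    signedWeight_eq_chainSum12 _ _ h₃ l.2.2.ne_zero,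
    denomFactor, termZero, zpow_sub₀ two_ne_zero, zpow_natCast]
  push_cast
  rw [mul_pow, mul_pow, pow_add, pow_add, pow_add, pow_add]
  simp only [div_eq_mul_inv, mul_inv, add_zero]
  norm_num
  ring

/-- The first sum collects the terms with `a = 0`, in which no `lᵢ` vanishes, and the second one
those with `a ≥ 1`. -/
theorem explicit_formula (m₁ m₂ m₃ α β : ℕ) (h₁ : 1 ≤ m₁) (h₂ : 1 ≤ m₂) (h₃ : 1 ≤ m₃) :
    Summable (termZero m₁ m₂ m₃ α β) ∧ Summable (termPos m₁ m₂ m₃ α β) ∧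
      ∑' p, termR m₁ m₂ m₃ α β p =
        ((m₁.factorial * m₂.factorial * m₃.factorial : ℕ) : ℝ) /
            (2 : ℝ) ^ (((α + β + m₁ + m₂ + m₃ : ℕ) : ℤ) - 6) *
          ∑' l, termZero m₁ m₂ m₃ α β l +
        2 * (((m₁.factorial * m₂.factorial * m₃.factorial : ℕ) : ℝ) / 2 ^ (α + β) *
          ∑' x, termPos m₁ m₂ m₃ α β x) := by
  have hR := tsum_termR m₁ m₂ m₃ α β
  have hfin := tsum_termR_ne_top m₁ m₂ m₃ α β
  have hz : ∀ m, 1 ≤ m → signedWeight m 0 0 = 0 := signedWeight_zero_zero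
  rw [tsum_eq_zero_add' ENNReal.summable] at hR
  simp only [if_true, one_mul, Nat.succ_ne_zero, if_false] at hR
  have e0 : ∑' l₁ : ℕ, ∑' l₂ : ℕ, ∑' l₃ : ℕ,
        ENNReal.ofReal (blockTerm m₁ m₂ m₃ α β 0 l₁ l₂ l₃) =
      ∑' l : ℕ+ × ℕ+ × ℕ+, ENNReal.ofReal (blockTerm m₁ m₂ m₃ α β 0 l.1 l.2.1 l.2.2) := by
    rw [tsum_nat_eq_tsum_pnat, ENNReal.tsum_prod']
    · refine tsum_congr fun l₁ => ?_
      rw [tsum_nat_eq_tsum_pnat, ENNReal.tsum_prod']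
      · refine tsum_congr fun l₂ => ?_
        rw [tsum_nat_eq_tsum_pnat]
        simp [blockTerm, hz _ h₃]
      · simp [blockTerm, hz _ h₂]
    · simp [blockTerm, hz _ h₁]
  have e1 : ∑' a : ℕ, 2 * ∑' l₁ : ℕ, ∑' l₂ : ℕ, ∑' l₃ : ℕ,
        ENNReal.ofReal (blockTerm m₁ m₂ m₃ α β (a + 1) l₁ l₂ l₃) =
      2 * ∑' x : ℕ+ × ℕ × ℕ × ℕ,
        ENNReal.ofReal (blockTerm m₁ m₂ m₃ α β x.1 x.2.1 x.2.2.1 x.2.2.2) := by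
    rw [ENNReal.tsum_mul_left, ENNReal.tsum_prod', ← Equiv.pnatEquivNat.symm.tsum_eq]
    simp_rw [ENNReal.tsum_prod']
    rfl
  rw [e0, e1] at hR
  rw [hR] at hfin
  have f0 := ne_top_of_le_ne_top hfin le_self_add
  have f1 : ∑' x : ℕ+ × ℕ × ℕ × ℕ,
      ENNReal.ofReal (blockTerm m₁ m₂ m₃ α β x.1 x.2.1 x.2.2.1 x.2.2.2) ≠ ∞ := by
    intro h
    rw [h] at hfin
    simp at hfin
  have s0 := ENNReal.summable_toReal f0
  have s1 := ENNReal.summable_toReal f1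
  simp only [ENNReal.toReal_ofReal (blockTerm_nonneg _ _ _ _ _ _ _ _ _)] at s0 s1
  simp only [blockTerm_eq_termZero m₁ m₂ m₃ α β h₁ h₂ h₃,
    blockTerm_eq_termPos m₁ m₂ m₃ α β h₁ h₂ h₃] at s0 s1
  refine ⟨(summable_mul_left_iff (by positivity)).1 s0,
    (summable_mul_left_iff (by positivity)).1 s1, ?_⟩
  rw [ofReal_tsum_termR, hR, ENNReal.toReal_add f0 (ENNReal.mul_ne_top (by simp) f1),
    ENNReal.toReal_mul, ENNReal.tsum_toReal_eq (fun _ => ENNReal.ofReal_ne_top),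
    ENNReal.tsum_toReal_eq (fun _ => ENNReal.ofReal_ne_top)]
  simp only [ENNReal.toReal_ofReal (blockTerm_nonneg _ _ _ _ _ _ _ _ _)]
  simp only [blockTerm_eq_termZero m₁ m₂ m₃ α β h₁ h₂ h₃,
    blockTerm_eq_termPos m₁ m₂ m₃ α β h₁ h₂ h₃]
  rw [tsum_mul_left, tsum_mul_left]
  simp

end Conical

section Theta

open Filter Topology

/-! ### The Jacobi triple product -/

/-- The Gaussian binomial coefficient `[M choose j]` at `q`. -/
def gaussBinom (q : ℂ) : ℕ → ℕ → ℂ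
  | _, 0 => 1
  | 0, _ + 1 => 0
  | M + 1, j + 1 => gaussBinom q M j + q ^ (j + 1) * gaussBinom q M (j + 1)

theorem gaussBinom_eq_zero (q : ℂ) : ∀ M j : ℕ, M < j → gaussBinom q M j = 0
  | 0, j + 1, _ => rfl
  | M + 1, j + 1, h => by
    rw [gaussBinom, gaussBinom_eq_zero q M j (by omega), gaussBinom_eq_zero q M (j + 1) (by omega)]
    simp

/-- The finite product `(1 - q) ⋯ (1 - q ^ k)`. -/
def qFactorial (q : ℂ) (k : ℕ) : ℂ := ∏ i ∈ Finset.range k, (1 - q ^ (i + 1))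

theorem gaussBinom_mul (q : ℂ) : ∀ j k : ℕ,
    gaussBinom q (j + k) j * (qFactorial q j * qFactorial q k) = qFactorial q (j + k)
  | 0, k => by simp [gaussBinom, qFactorial]
  | j + 1, 0 => by
    have h := gaussBinom_mul q j 0
    have h0 : gaussBinom q j (j + 1) = 0 := gaussBinom_eq_zero q j (j + 1) (by omega)
    simp only [add_zero] at h ⊢
    rw [gaussBinom, h0, mul_zero, add_zero]
    have e : qFactorial q (j + 1) = qFactorial q j * (1 - q ^ (j + 1)) := by
      simp [qFactorial, Finset.prod_range_succ]
    have e0 : qFactorial q 0 = 1 := by simp [qFactorial]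
    rw [e0, mul_one] at h ⊢
    rw [e, ← mul_assoc, h]
  | j + 1, k + 1 => by
    have h1 := gaussBinom_mul q j (k + 1)
    have h2 := gaussBinom_mul q (j + 1) k
    have e : ∀ j, qFactorial q (j + 1) = qFactorial q j * (1 - q ^ (j + 1)) := by
      simp [qFactorial, Finset.prod_range_succ]
    rw [show j + (k + 1) = j + 1 + k by ring] at h1
    rw [show j + 1 + (k + 1) = (j + 1 + k) + 1 by ring, gaussBinom, e (j + 1 + k)]
    rw [e j] at h2 ⊢
    rw [e k] at h1 ⊢
    have : (1 - q ^ (j + 1 + k + 1)) = (1 - q ^ (j + 1)) + q ^ (j + 1) * (1 - q ^ (k + 1)) := by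
      ring
    rw [this]
    linear_combination (1 - q ^ (j + 1)) * h1 + q ^ (j + 1) * (1 - q ^ (k + 1)) * h2
  termination_by j k => j + k

/-- The finite `q`-binomial theorem. -/
theorem prod_one_sub_mul_pow (q : ℂ) (M : ℕ) : ∀ x : ℂ,
    ∏ k ∈ Finset.range M, (1 - x * q ^ k) =
      ∑ j ∈ Finset.range (M + 1), (-1) ^ j * q ^ (j.choose 2) * gaussBinom q M j * x ^ j := by
  induction M with
  | zero => intro x; simp [gaussBinom]
  | succ M ih =>
    intro x
    rw [Finset.prod_range_succ']
    have h1 : ∏ k ∈ Finset.range M, (1 - x * q ^ (k + 1)) =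
        ∏ k ∈ Finset.range M, (1 - (x * q) * q ^ k) :=
      Finset.prod_congr rfl fun k _ => by ring
    rw [h1, ih, Finset.sum_range_succ' _ (M + 1)]
    have h2 : ∀ j, (-1 : ℂ) ^ (j + 1) * q ^ ((j + 1).choose 2) * gaussBinom q (M + 1) (j + 1) *
        x ^ (j + 1) = -((-1) ^ j * q ^ (j.choose 2) * gaussBinom q M j * (x * q) ^ j) * x +
        (-1) ^ (j + 1) * q ^ ((j + 1).choose 2) * gaussBinom q M (j + 1) * (x * q) ^ (j + 1) := by
      intro j
      have : (j + 1).choose 2 = j + j.choose 2 := by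
        rw [Nat.choose_succ_succ', Nat.choose_one_right]
      rw [gaussBinom, this]
      ring
    simp_rw [h2]
    rw [Finset.sum_add_distrib, ← Finset.sum_mul, Finset.sum_neg_distrib]
    have h3 := Finset.sum_range_succ'
      (fun j => (-1 : ℂ) ^ j * q ^ (j.choose 2) * gaussBinom q M j * (x * q) ^ j) (M + 1)
    rw [Finset.sum_range_succ, gaussBinom_eq_zero q M (M + 1) (by omega)] at h3
    simp only [mul_zero, zero_mul, add_zero] at h3
    have h4 : ∀ M, gaussBinom q M 0 = 1 := fun M => by cases M <;> rfl
    simp only [h4, pow_zero, mul_one] at h3 ⊢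
    linear_combination h3

/-- The finite form of the Jacobi triple product: the `q`-binomial theorem for `2N` factors, with
`x = u q^{-N}`. -/
theorem finite_triple_product {q u : ℂ} (hq : q ≠ 0) (hu : u ≠ 0) (N : ℕ) :
    ∏ n ∈ Finset.range N, ((1 - q ^ n * u) * (1 - q ^ (n + 1) / u)) =
      ∑ n ∈ Finset.Icc (-(N : ℤ)) N, (-1) ^ n * q ^ (n * (n - 1) / 2) * u ^ n *
        gaussBinom q (2 * N) (n + N).toNat := by
  have h1 : ∏ k ∈ Finset.range (2 * N), (1 - (u * (q ^ N)⁻¹) * q ^ k) =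
      (-1) ^ N * u ^ N * (q ^ ((N + 1).choose 2))⁻¹ *
        ∏ n ∈ Finset.range N, ((1 - q ^ n * u) * (1 - q ^ (n + 1) / u)) := by
    rw [two_mul, Finset.prod_range_add, Finset.prod_mul_distrib, ← Finset.prod_range_reflect]
    have e1 : ∀ k ∈ Finset.range N, 1 - (u * (q ^ N)⁻¹) * q ^ (N - 1 - k) =
        (-u * (q ^ (k + 1))⁻¹) * (1 - q ^ (k + 1) / u) := by
      intro k hk
      have hk := Finset.mem_range.1 hk
      have : q ^ N = q ^ (N - 1 - k) * q ^ (k + 1) := by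
        rw [← pow_add]; congr 1; omega
      rw [this]
      field_simp
      ring
    have e2 : ∀ k, 1 - (u * (q ^ N)⁻¹) * q ^ (N + k) = 1 - q ^ k * u := by
      intro k
      rw [pow_add]
      field_simp
    have e3 : ∏ k ∈ Finset.range N, (-u * (q ^ (k + 1))⁻¹) =
        (-1) ^ N * u ^ N * (q ^ ((N + 1).choose 2))⁻¹ := by
      rw [Finset.prod_mul_distrib, Finset.prod_const, Finset.card_range, neg_pow,
        Finset.prod_inv_distrib, Finset.prod_pow_eq_pow_sum]
      congr 3
      have := Finset.sum_range_id_mul_two (N + 1)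
      rw [Finset.sum_range_succ'] at this
      simp only [add_zero, Nat.add_sub_cancel] at this
      rw [Nat.choose_two_right, Nat.add_sub_cancel]
      omega
    rw [Finset.prod_congr rfl e1, Finset.prod_mul_distrib, e3]
    simp_rw [e2]
    ring
  rw [prod_one_sub_mul_pow] at h1
  have hc : (-1 : ℂ) ^ N * u ^ N * (q ^ ((N + 1).choose 2))⁻¹ ≠ 0 := by
    have : (-1 : ℂ) ≠ 0 := by norm_num
    positivity
  refine mul_left_cancel₀ hc (h1.symm.trans ?_)
  rw [Finset.mul_sum]
  refine Finset.sum_bij' (fun j _ => (j : ℤ) - N) (fun n _ => (n + N).toNat) ?_ ?_ ?_ ?_ ?_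
  · intro j hj
    have := Finset.mem_range.1 hj
    rw [Finset.mem_Icc]
    omega
  · intro n hn
    have := Finset.mem_Icc.1 hn
    rw [Finset.mem_range]
    omega
  · intro j hj; simp
  · intro n hn
    have := Finset.mem_Icc.1 hn
    omega
  · intro j hj
    have e1 : (-1 : ℂ) ^ ((j : ℤ) - N) = (-1) ^ j * ((-1) ^ N)⁻¹ := by
      rw [zpow_sub₀ (by norm_num)]; simp [div_eq_mul_inv]
    have e2 : u ^ ((j : ℤ) - N) = u ^ j * (u ^ N)⁻¹ := by
      rw [zpow_sub₀ hu]; simp [div_eq_mul_inv]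
    have e3 : q ^ (((j : ℤ) - N) * ((j : ℤ) - N - 1) / 2) =
        q ^ (j.choose 2) * q ^ ((N + 1).choose 2) * ((q ^ N) ^ j)⁻¹ := by
      have : ((j : ℤ) - N) * ((j : ℤ) - N - 1) / 2 =
          (j.choose 2 : ℤ) + ((N + 1).choose 2 : ℤ) - (N * j : ℕ) := by
        have h1 : (2 : ℤ) * (j.choose 2 : ℤ) = j * (j - 1) := by
          have := Nat.choose_two_right j
          have h2 := Nat.even_mul_pred_self j
          cases j with
          | zero => simp
          | succ j =>
            rw [this, Nat.add_sub_cancel] at *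
            have h3 : 2 * ((j + 1) * j / 2) = (j + 1) * j := by
              rw [mul_comm 2]
              exact Nat.div_mul_cancel h2.two_dvd
            push_cast
            have h4 : (2 : ℤ) * (((j + 1) * j / 2 : ℕ) : ℤ) = (((j + 1) * j : ℕ) : ℤ) := by
              exact_mod_cast h3
            push_cast at h4
            rw [h4]; ring
        have h2 : (2 : ℤ) * ((N + 1).choose 2 : ℤ) = (N + 1) * N := by
          have h2 := Nat.even_mul_pred_self (N + 1)
          rw [Nat.choose_two_right]
          have h3 : 2 * ((N + 1) * (N + 1 - 1) / 2) = (N + 1) * (N + 1 - 1) := by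
            rw [mul_comm 2]
            exact Nat.div_mul_cancel h2.two_dvd
          rw [Nat.add_sub_cancel] at h3 ⊢
          exact_mod_cast h3
        rw [Int.ediv_eq_of_eq_mul_right (by norm_num)]
        push_cast
        linear_combination -h1 - h2
      rw [this, zpow_sub₀ hq, zpow_add₀ hq, zpow_natCast, zpow_natCast, zpow_natCast, pow_mul]
      rfl
    have e4 : ((j : ℤ) - N + N).toNat = j := by simp
    rw [e1, e2, e3, e4, mul_pow, inv_pow]
    have : ((-1 : ℂ) ^ N) ≠ 0 := by simp
    have := pow_ne_zero N hu
    have := pow_ne_zero ((N + 1).choose 2) hq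
    field_simp

/-- The Jacobi triple product. Dominated convergence applies to the finite form, because the
Gaussian binomial coefficients are bounded and tend to the reciprocal of `∏ (1 - qⁿ)`. -/
theorem tendsto_triple_product {ξ τ : ℂ} (hτ : 0 < τ.im) :
    Tendsto (fun N : ℕ => ∏ n ∈ Finset.range N,
        ((1 - Complex.exp (2 * Real.pi * Complex.I * τ) ^ n *
            Complex.exp (2 * Real.pi * Complex.I * ξ)) *
          (1 - Complex.exp (2 * Real.pi * Complex.I * τ) ^ (n + 1) /
            Complex.exp (2 * Real.pi * Complex.I * ξ)))) atTop
      (𝓝 ((∏' n, (1 - ModularForm.eta_q n τ))⁻¹ * jacobiTheta₂ (ξ - τ / 2 + 1 / 2) τ)) := by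
  set q := Complex.exp (2 * Real.pi * Complex.I * τ) with hq
  set u := Complex.exp (2 * Real.pi * Complex.I * ξ) with hu
  have hq0 : q ≠ 0 := Complex.exp_ne_zero _
  have hu0 : u ≠ 0 := Complex.exp_ne_zero _
  have hqlt : ‖q‖ < 1 := by
    rw [hq, Complex.norm_exp]
    simp
    positivity
  set P : ℂ := ∏' n, (1 - ModularForm.eta_q n τ) with hP
  have hP0 : P ≠ 0 := ModularForm.eta_tprod_ne_zero hτ
  have hPt : Tendsto (qFactorial q) atTop (𝓝 P) := by
    have h := (ModularForm.multipliable_one_sub_pow hqlt).hasProd.tendsto_prod_nat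
    have e : P = ∏' n : ℕ, (1 - q ^ (n + 1)) := by
      simp only [hP, ModularForm.eta_q_eq_pow, hq]
    rw [e]
    exact h
  have hne : ∀ k, qFactorial q k ≠ 0 := by
    intro k
    refine Finset.prod_ne_zero_iff.2 fun i _ => ?_
    have := ModularForm.one_sub_eta_q_ne_zero i (z := τ) hτ
    rwa [ModularForm.eta_q_eq_pow] at this
  obtain ⟨C₁, hC₁⟩ := hPt.norm.bddAbove_range
  obtain ⟨C₂, hC₂⟩ := (hPt.inv₀ hP0).norm.bddAbove_range
  have hC₁' : ∀ k, ‖qFactorial q k‖ ≤ C₁ := fun k => hC₁ ⟨k, rfl⟩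
  have hC₂' : ∀ k, ‖(qFactorial q k)⁻¹‖ ≤ C₂ := fun k => hC₂ ⟨k, rfl⟩
  have hC₁0 : 0 ≤ C₁ := (norm_nonneg _).trans (hC₁' 0)
  have hC₂0 : 0 ≤ C₂ := (norm_nonneg _).trans (hC₂' 0)
  let A : ℕ → ℤ → ℂ := fun N n => if n ∈ Finset.Icc (-(N : ℤ)) N then
    gaussBinom q (2 * N) (n + N).toNat else 0
  have hA : ∀ (N : ℕ) (n : ℤ), n ∈ Finset.Icc (-(N : ℤ)) N → A N n =
      qFactorial q (2 * N) * ((qFactorial q (n + N).toNat)⁻¹ * (qFactorial q (N - n).toNat)⁻¹) := by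
    intro N n hn
    simp only [A, if_pos hn]
    have hn := Finset.mem_Icc.1 hn
    have h := gaussBinom_mul q (n + N).toNat (N - n).toNat
    rw [show (n + N).toNat + (N - n).toNat = 2 * N by omega] at h
    rw [← h]
    have h1 := hne (n + N).toNat
    have h2 := hne (N - n).toNat
    field_simp
  have hterm : ∀ n : ℤ, (-1) ^ n * q ^ (n * (n - 1) / 2) * u ^ n =
      jacobiTheta₂_term n (ξ - τ / 2 + 1 / 2) τ := by
    intro n
    have h2 : (2 : ℤ) ∣ n * (n - 1) := (Int.even_mul_pred_self n).two_dvd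
    obtain ⟨k, hk⟩ := h2
    rw [hk, Int.mul_ediv_cancel_left _ (by norm_num), jacobiTheta₂_term, hq, hu,
      ← Complex.exp_int_mul, ← Complex.exp_int_mul, ← Complex.exp_pi_mul_I, ← Complex.exp_int_mul,
      ← Complex.exp_add, ← Complex.exp_add]
    congr 1
    have hk' : (n : ℂ) * (n - 1) = 2 * k := by exact_mod_cast hk
    linear_combination (-Real.pi * Complex.I * τ) * hk'
  have hfin : ∀ N : ℕ, ∏ n ∈ Finset.range N, ((1 - q ^ n * u) * (1 - q ^ (n + 1) / u)) =
      ∑' n : ℤ, jacobiTheta₂_term n (ξ - τ / 2 + 1 / 2) τ * A N n := by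
    intro N
    rw [finite_triple_product hq0 hu0, tsum_eq_sum (s := Finset.Icc (-(N : ℤ)) N)]
    · refine Finset.sum_congr rfl fun n hn => ?_
      rw [hterm]
      simp only [A, if_pos hn]
    · intro n hn
      simp only [A, if_neg hn, mul_zero]
  simp_rw [hfin]
  have hsum : Summable fun n : ℤ => ‖jacobiTheta₂_term n (ξ - τ / 2 + 1 / 2) τ‖ :=
    ((summable_jacobiTheta₂_term_iff _ _).2 hτ).norm
  rw [mul_comm, jacobiTheta₂, ← tsum_mul_right]
  refine tendsto_tsum_of_dominated_convergence
    (bound := fun n => ‖jacobiTheta₂_term n (ξ - τ / 2 + 1 / 2) τ‖ * (C₁ * (C₂ * C₂)))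
    (hsum.mul_right _) (fun n => ?_) (Eventually.of_forall fun N n => ?_)
  · refine Tendsto.const_mul _ ?_
    have hev : ∀ᶠ N : ℕ in atTop, qFactorial q (2 * N) *
        ((qFactorial q (n + N).toNat)⁻¹ * (qFactorial q (N - n).toNat)⁻¹) = A N n := by
      filter_upwards [eventually_ge_atTop n.natAbs] with N hN
      exact (hA N n (Finset.mem_Icc.2 (by omega))).symm
    refine Tendsto.congr' hev ?_
    have t1 : Tendsto (fun N : ℕ => 2 * N) atTop atTop :=
      tendsto_atTop_atTop.2 fun b => ⟨b, fun N hN => by omega⟩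
    have t2 : Tendsto (fun N : ℕ => (n + N).toNat) atTop atTop :=
      tendsto_atTop_atTop.2 fun b => ⟨b + n.natAbs, fun N hN => by omega⟩
    have t3 : Tendsto (fun N : ℕ => (N - n).toNat) atTop atTop :=
      tendsto_atTop_atTop.2 fun b => ⟨b + n.natAbs, fun N hN => by omega⟩
    have h := (hPt.comp t1).mul (((hPt.comp t2).inv₀ hP0).mul ((hPt.comp t3).inv₀ hP0))
    rw [← mul_assoc, mul_inv_cancel₀ hP0, one_mul] at h
    exact h
  · rw [norm_mul]
    refine mul_le_mul_of_nonneg_left ?_ (norm_nonneg _)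
    by_cases hn : n ∈ Finset.Icc (-(N : ℤ)) N
    · rw [hA N n hn, norm_mul, norm_mul]
      exact mul_le_mul (hC₁' _) (mul_le_mul (hC₂' _) (hC₂' _) (norm_nonneg _) hC₂0)
        (by positivity) hC₁0
    · simp only [A, if_neg hn, norm_zero]
      positivity

/-! ### The Fourier expansion of the propagator -/

theorem theta_eq (ξ τ : ℂ) :
    theta ξ τ = Complex.exp (2 * Real.pi * Complex.I * (τ / 8 + ξ / 2)) *
      jacobiTheta₂ (ξ + τ / 2 + 1 / 2) τ := by
  rw [theta, jacobiTheta₂, ← tsum_mul_left]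
  refine tsum_congr fun n => ?_
  rw [jacobiTheta₂_term, ← Complex.exp_add, ← Complex.exp_pi_mul_I, ← Complex.exp_int_mul,
    ← Complex.exp_add]
  congr 1
  ring

theorem theta_neg (ξ τ : ℂ) : theta (-ξ) τ = -theta ξ τ := by
  rw [theta, theta, ← tsum_neg, ← (Equiv.subLeft (-1 : ℤ)).tsum_eq]
  refine tsum_congr fun n => ?_
  rw [Equiv.subLeft_apply, zpow_sub₀ (by norm_num), zpow_neg_one, ← neg_mul]
  congr 1
  · rw [div_eq_mul_inv, ← inv_zpow]
    norm_num
  · congr 1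
    push_cast
    ring

theorem propagator_neg (ξ τ : ℂ) : propagator (-ξ) τ = propagator ξ τ := by
  simp [propagator, theta_neg, neg_div]

/-- The distance from `1` to the point of absolute value `ρ` and argument `2πθ`. -/
noncomputable def circleDist (ρ θ : ℝ) : ℝ :=
  ‖1 - (ρ : ℂ) * Complex.exp (2 * Real.pi * Complex.I * θ)‖

theorem circleDist_neg (ρ θ : ℝ) : circleDist ρ (-θ) = circleDist ρ θ := by
  unfold circleDist
  rw [← Complex.norm_conj]
  congr 1
  simp [← Complex.exp_conj, map_ofNat]

theorem circleDist_pos {ρ : ℝ} (h0 : 0 ≤ ρ) (h1 : ρ < 1) (θ : ℝ) : 0 < circleDist ρ θ := by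
  rw [circleDist, norm_pos_iff, sub_ne_zero]
  intro h
  have := congrArg norm h
  rw [norm_mul, Complex.norm_exp] at this
  simp [abs_of_nonneg h0] at this
  linarith

/-- The Fourier series of `-2 log |1 - ρ e^{2πiθ}|`. -/
theorem hasSum_log_circleDist {ρ : ℝ} (h0 : 0 ≤ ρ) (h1 : ρ < 1) (θ : ℝ) :
    HasSum (fun m : {z : ℤ // z ≠ 0} => ((|((m : ℤ) : ℝ)|⁻¹ * ρ ^ (m : ℤ).natAbs : ℝ) : ℂ) *
      Complex.exp (2 * Real.pi * Complex.I * ((m : ℤ) * θ)))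
      ((-2 * Real.log (circleDist ρ θ) : ℝ) : ℂ) := by
  let f : ℤ → ℂ := fun m => ((|(m : ℝ)|⁻¹ * ρ ^ m.natAbs : ℝ) : ℂ) *
      Complex.exp (2 * Real.pi * Complex.I * (m * θ))
  have hf : Function.support f ⊆ {z : ℤ | z ≠ 0} := by
    intro z hz hz0
    apply hz
    subst hz0
    simp [f]
  have key : HasSum f ((-2 * Real.log (circleDist ρ θ) : ℝ) : ℂ) := by
    set w : ℂ := (ρ : ℂ) * Complex.exp (2 * Real.pi * Complex.I * θ) with hw
    have hwn : ‖w‖ < 1 := by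
      rw [hw, norm_mul, Complex.norm_exp]
      simpa [abs_of_nonneg h0] using h1
    have hwn' : ‖(starRingEnd ℂ) w‖ < 1 := by rwa [Complex.norm_conj]
    have s1 := Complex.hasSum_taylorSeries_neg_log hwn
    have s2 := Complex.hasSum_taylorSeries_neg_log hwn'
    rw [← hasSum_nat_add_iff' 1] at s1 s2
    simp only [Finset.range_one, Finset.sum_singleton, Nat.cast_zero, div_zero, sub_zero] at s1 s2
    have t1 : HasSum (fun n : ℕ => f (n + 1)) (-Complex.log (1 - w)) := by
      refine s1.congr_fun fun n => ?_
      have e : ((n : ℤ) + 1).natAbs = n + 1 := by omega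
      have e' : |((n + 1 : ℤ) : ℝ)| = n + 1 := by
        push_cast; exact abs_of_pos (by positivity)
      simp only [f, e, hw, e']
      rw [mul_pow, ← Complex.exp_nat_mul]
      push_cast
      ring_nf
    have t2 : HasSum (fun n : ℕ => f (-(n + 1))) (-Complex.log (1 - (starRingEnd ℂ) w)) := by
      refine s2.congr_fun fun n => ?_
      have e : (-((n : ℤ) + 1)).natAbs = n + 1 := by omega
      have e' : |((-(n + 1) : ℤ) : ℝ)| = n + 1 := by
        push_cast
        rw [abs_of_neg (by linarith [n.cast_nonneg (α := ℝ)])]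
        ring
      have e'' : (starRingEnd ℂ) w = (ρ : ℂ) * Complex.exp (-(2 * Real.pi * Complex.I * θ)) := by
        rw [hw]
        simp [← Complex.exp_conj, map_ofNat]
      simp only [f, e, e', e'']
      rw [mul_pow, ← Complex.exp_nat_mul]
      push_cast
      ring_nf
    have := t1.of_add_one_of_neg_add_one t2
    have hval : -Complex.log (1 - w) + f 0 + -Complex.log (1 - (starRingEnd ℂ) w) =
        ((-2 * Real.log (circleDist ρ θ) : ℝ) : ℂ) := by
      have hre : 0 < (1 - w).re := by
        have := Complex.re_le_norm w
        simp
        linarith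
      have hc : Complex.log (1 - (starRingEnd ℂ) w) = (starRingEnd ℂ) (Complex.log (1 - w)) := by
        rw [← Complex.log_conj]
        · simp
        · intro h
          rw [Complex.arg_eq_pi_iff] at h
          linarith [h.1]
      have hf0 : f 0 = 0 := by simp [f]
      rw [hc, hf0, add_zero, ← neg_add, Complex.add_conj, Complex.log_re, circleDist]
      push_cast
      ring
    rw [hval] at this
    exact this
  exact (hasSum_subtype_iff_of_support_subset hf).2 key

/-- The Fourier coefficient, at the frequency `m` and the winding number `n`, of the propagator at
`rτ + s`. -/
noncomputable def waveTerm (τ : ℂ) (r s : ℝ) (p : ℤ × {z : ℤ // z ≠ 0}) : ℂ :=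
  ((|((p.2 : ℤ) : ℝ)|⁻¹ * Real.exp (-(2 * Real.pi * τ.im * (|((p.2 : ℤ) : ℝ)| * |p.1 + r|))) : ℝ) :
      ℂ) * Complex.exp (2 * Real.pi * Complex.I * ((p.2 : ℤ) * (s + (p.1 + r) * τ.re)))

theorem norm_waveTerm (τ : ℂ) (r s : ℝ) (p : ℤ × {z : ℤ // z ≠ 0}) :
    ‖waveTerm τ r s p‖ = |((p.2 : ℤ) : ℝ)|⁻¹ *
      Real.exp (-(2 * Real.pi * τ.im * (|((p.2 : ℤ) : ℝ)| * |p.1 + r|))) := by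
  rw [waveTerm, norm_mul, Complex.norm_real, Complex.norm_exp]
  simp

theorem one_le_abs_intCast (m : {z : ℤ // z ≠ 0}) : (1 : ℝ) ≤ |((m : ℤ) : ℝ)| := by
  rw [← Int.cast_abs]
  exact_mod_cast Int.one_le_abs m.2

/-- A bound by a product of a function of the winding number and a function of the frequency, where
`d` is a lower bound for the distance from `r` to the integers. -/
theorem norm_waveTerm_le (τ : ℂ) (hτ : 0 < τ.im) (r s d : ℝ) (p : ℤ × {z : ℤ // z ≠ 0})
    (hd : d ≤ |p.1 + r|) : ‖waveTerm τ r s p‖ ≤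
      Real.exp (-(Real.pi * τ.im * |p.1 + r|)) *
        Real.exp (-(Real.pi * τ.im * d * |((p.2 : ℤ) : ℝ)|)) := by
  rw [norm_waveTerm, ← Real.exp_add]
  have h1 := one_le_abs_intCast p.2
  have h2 : |((p.2 : ℤ) : ℝ)|⁻¹ ≤ 1 := inv_le_one_of_one_le₀ h1
  refine (mul_le_of_le_one_left (Real.exp_pos _).le h2).trans (Real.exp_le_exp.2 ?_)
  have h3 : 0 ≤ |(p.1 : ℝ) + r| := abs_nonneg _
  have h4 : |(p.1 : ℝ) + r| ≤ |((p.2 : ℤ) : ℝ)| * |p.1 + r| := le_mul_of_one_le_left h3 h1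
  have h5 : d * |((p.2 : ℤ) : ℝ)| ≤ |((p.2 : ℤ) : ℝ)| * |p.1 + r| := by
    rw [mul_comm]
    exact mul_le_mul_of_nonneg_left hd (abs_nonneg _)
  have hpos : 0 < Real.pi * τ.im := mul_pos Real.pi_pos hτ
  nlinarith

theorem summable_exp_neg_abs {c : ℝ} (hc : 0 < c) :
    Summable fun n : ℤ => Real.exp (-(c * |(n : ℝ)|)) := by
  have h : Summable fun n : ℕ => Real.exp (-(c * n)) := by
    have := summable_geometric_of_lt_one (Real.exp_pos (-c)).le
      (Real.exp_lt_one_iff.2 (by linarith))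
    refine this.congr fun n => ?_
    rw [← Real.exp_nat_mul]
    congr 1
    ring
  refine Summable.of_nat_of_neg ?_ ?_ <;> simpa using h

theorem summable_exp_neg_abs_ne_zero {c : ℝ} (hc : 0 < c) :
    Summable fun n : {z : ℤ // z ≠ 0} => Real.exp (-(c * |((n : ℤ) : ℝ)|)) :=
  (summable_exp_neg_abs hc).subtype {z : ℤ | z ≠ 0}

theorem min_le_abs_add {r : ℝ} (h0 : 0 < r) (h1 : r < 1) (n : ℤ) : min r (1 - r) ≤ |n + r| := by
  rcases le_or_gt 0 n with hn | hn
  · have : (0 : ℝ) ≤ n := by exact_mod_cast hn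
    rw [abs_of_pos (by linarith)]
    exact (min_le_left _ _).trans (by linarith)
  · have : (n : ℝ) ≤ -1 := by exact_mod_cast (by omega : n ≤ -1)
    rw [abs_of_neg (by linarith)]
    exact (min_le_right _ _).trans (by linarith)

theorem summable_norm_waveTerm {τ : ℂ} (hτ : 0 < τ.im) {r : ℝ} (h0 : 0 < r) (h1 : r < 1) (s : ℝ) :
    Summable fun p => ‖waveTerm τ r s p‖ := by
  set d := min r (1 - r) with hd
  have hdpos : 0 < d := lt_min h0 (by linarith)
  have hc : 0 < Real.pi * τ.im := mul_pos Real.pi_pos hτ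
  have s1 : Summable fun n : ℤ => Real.exp (-(Real.pi * τ.im * |n + r|)) := by
    refine Summable.of_nonneg_of_le (fun _ => (Real.exp_pos _).le) (fun n => ?_)
      ((summable_exp_neg_abs hc).mul_left (Real.exp (Real.pi * τ.im * r)))
    rw [← Real.exp_add]
    refine Real.exp_le_exp.2 ?_
    have : |(n : ℝ)| ≤ |n + r| + r := by
      calc |(n : ℝ)| = |(n + r) - r| := by ring_nf
        _ ≤ |n + r| + |r| := abs_sub _ _
        _ = _ := by rw [abs_of_pos h0]
    nlinarith
  have s2 := summable_exp_neg_abs_ne_zero (mul_pos hc hdpos)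
  refine Summable.of_nonneg_of_le (fun _ => norm_nonneg _) (fun p => ?_)
    (s1.mul_of_nonneg s2 (fun _ => (Real.exp_pos _).le) (fun _ => (Real.exp_pos _).le))
  exact norm_waveTerm_le τ hτ r s d p (min_le_abs_add h0 h1 p.1)

theorem hasSum_waveTerm_snd {τ : ℂ} (hτ : 0 < τ.im) {r : ℝ} (h0 : 0 < r) (h1 : r < 1) (s : ℝ)
    (n : ℤ) : HasSum (fun m => waveTerm τ r s (n, m))
      ((-2 * Real.log (circleDist (Real.exp (-(2 * Real.pi * τ.im * |n + r|)))
        (s + (n + r) * τ.re)) : ℝ) : ℂ) := by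
  have hpos : 0 < |n + r| := (lt_min h0 (by linarith)).trans_le (min_le_abs_add h0 h1 n)
  have hc : 0 < 2 * Real.pi * τ.im * |n + r| := by positivity
  refine (hasSum_log_circleDist (Real.exp_pos _).le (Real.exp_lt_one_iff.2 (by linarith))
    (s + (n + r) * τ.re)).congr_fun fun m => ?_
  rw [waveTerm, ← Real.exp_nat_mul, Nat.cast_natAbs]
  push_cast
  congr 4
  ring

/-- The propagator without its polynomial part: `4 G(rτ + s) - 2πτ₂ (r² - r + 1/6)`. -/
noncomputable def fluct (τ : ℂ) (r s : ℝ) : ℝ :=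
  4 * propagator (torusPoint τ (r, s)) τ - 2 * Real.pi * τ.im * (r ^ 2 - r + 1 / 6)

/-- The logarithm of the infinite product for `θ / η`: the factors `n` and `-(n + 1)` are the two
factors of the `n`-th term of the triple product. -/
theorem fluct_eq_tsum {τ : ℂ} (hτ : 0 < τ.im) {r : ℝ} (h0 : 0 < r) (h1 : r < 1) (s : ℝ) :
    HasSum (fun n : ℤ => -2 * Real.log (circleDist (Real.exp (-(2 * Real.pi * τ.im * |n + r|)))
      (s + (n + r) * τ.re))) (fluct τ r s) := by
  set E : ℤ → ℝ := fun n => Real.log (circleDist (Real.exp (-(2 * Real.pi * τ.im * |n + r|)))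
      (s + (n + r) * τ.re)) with hE
  set ξ := torusPoint τ (r, s) with hξ
  have hsum : Summable E := by
    have h := ((summable_norm_waveTerm hτ h0 h1 s).of_norm).prod
    simp_rw [fun n => (hasSum_waveTerm_snd hτ h0 h1 s n).tsum_eq] at h
    have h' := Complex.reCLM.summable h
    simp only [Complex.reCLM_apply, Complex.ofReal_re] at h'
    exact (summable_mul_left_iff (by norm_num)).1 h'
  have hs2 : Tendsto (fun N : ℕ => ∑ n ∈ Finset.range N, (E n + E (-(n + 1)))) atTop
      (𝓝 (∑' n, E n)) := by
    have := hsum.hasSum.nat_add_neg_add_one.tendsto_sum_nat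
    simpa using this
  have hfac : ∀ n : ℕ, ‖(1 - Complex.exp (2 * Real.pi * Complex.I * τ) ^ n *
            Complex.exp (2 * Real.pi * Complex.I * ξ)) *
          (1 - Complex.exp (2 * Real.pi * Complex.I * τ) ^ (n + 1) /
            Complex.exp (2 * Real.pi * Complex.I * ξ))‖ = Real.exp (E n + E (-(n + 1))) := by
    intro n
    have hc : ∀ n : ℤ, Real.exp (E n) = circleDist (Real.exp (-(2 * Real.pi * τ.im * |n + r|)))
      (s + (n + r) * τ.re) := by
      intro n
      have hpos : 0 < |n + r| := (lt_min h0 (by linarith)).trans_le (min_le_abs_add h0 h1 n)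
      have hc : 0 < 2 * Real.pi * τ.im * |n + r| := by positivity
      exact Real.exp_log (circleDist_pos (Real.exp_pos _).le
        (Real.exp_lt_one_iff.2 (by linarith)) _)
    have hτ' : τ = τ.re + τ.im * Complex.I := (Complex.re_add_im τ).symm
    have hI := Complex.I_sq
    rw [Real.exp_add, norm_mul, hc, hc]
    congr 1
    · rw [circleDist, ← Complex.exp_nat_mul, ← Complex.exp_add, Complex.ofReal_exp,
        ← Complex.exp_add]
      congr 3
      have : |((n : ℤ) : ℝ) + r| = n + r := by
        push_cast; exact abs_of_pos (by positivity)
      rw [this, hξ, torusPoint]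
      conv_lhs => rw [hτ']
      push_cast
      linear_combination (2 * Real.pi * (n + r) * τ.im) * hI
    · rw [← circleDist_neg, circleDist, ← Complex.exp_nat_mul, ← Complex.exp_sub,
        Complex.ofReal_exp, ← Complex.exp_add]
      congr 3
      have : |((-(n + 1) : ℤ) : ℝ) + r| = n + 1 - r := by
        push_cast
        rw [abs_of_neg (by linarith [n.cast_nonneg (α := ℝ)])]
        ring
      rw [this, hξ, torusPoint]
      conv_lhs => rw [hτ']
      push_cast
      linear_combination (2 * Real.pi * (n + 1 - r) * τ.im) * hI
  have hlim := (tendsto_triple_product (ξ := ξ) hτ).norm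
  simp_rw [norm_prod, hfac, ← Real.exp_sum] at hlim
  have hnorm := tendsto_nhds_unique hlim ((Real.continuous_exp.tendsto _).comp hs2)
  -- the infinite product computes `θ / η` up to an elementary factor
  have hth : ‖theta ξ τ / ModularForm.eta τ‖ =
      Real.exp (∑' n, E n + (Real.pi * τ.im * r - Real.pi * τ.im / 6)) := by
    rw [Real.exp_add, ← hnorm, norm_div, ← norm_neg (theta ξ τ), ← theta_neg, theta_eq,
      ModularForm.eta, norm_mul, norm_mul, norm_mul, norm_inv]
    have e1 : jacobiTheta₂ (-ξ + τ / 2 + 1 / 2) τ = jacobiTheta₂ (ξ - τ / 2 + 1 / 2) τ := by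
      rw [← jacobiTheta₂_neg_left, ← jacobiTheta₂_add_left]
      congr 1
      ring
    have e2 : ‖Complex.exp (2 * Real.pi * Complex.I * (τ / 8 + -ξ / 2))‖ =
        Real.exp (Real.pi * τ.im * r - Real.pi * τ.im / 4) := by
      rw [Complex.norm_exp]
      congr 1
      rw [hξ, torusPoint]
      simp
      ring
    have e3 : ‖Function.Periodic.qParam 24 τ‖ = Real.exp (-(Real.pi * τ.im / 12)) := by
      rw [Function.Periodic.norm_qParam]
      congr 1
      ring
    rw [e1, e2, e3]
    have : Real.exp (Real.pi * τ.im * r - Real.pi * τ.im / 6) =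
        Real.exp (Real.pi * τ.im * r - Real.pi * τ.im / 4) /
          Real.exp (-(Real.pi * τ.im / 12)) := by
      rw [← Real.exp_sub]
      congr 1
      ring
    rw [this]
    have := Real.exp_pos (-(Real.pi * τ.im / 12))
    have hP0 : ‖∏' n, (1 - ModularForm.eta_q n τ)‖ ≠ 0 :=
      norm_ne_zero_iff.2 (ModularForm.eta_tprod_ne_zero hτ)
    field_simp
  have hval : fluct τ r s = -2 * ∑' n, E n := by
    have him : ξ.im = r * τ.im := by simp [hξ, torusPoint]
    rw [fluct, ← hξ, propagator, hth, him, Real.log_pow, Real.log_exp]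
    field_simp
    push_cast
    ring
  rw [hval]
  exact hsum.hasSum.mul_left _

theorem hasSum_waveTerm {τ : ℂ} (hτ : 0 < τ.im) {r : ℝ} (h0 : 0 < r) (h1 : r < 1) (s : ℝ) :
    HasSum (waveTerm τ r s) (fluct τ r s : ℂ) := by
  have hs := (summable_norm_waveTerm hτ h0 h1 s).of_norm
  have h2 := (Complex.ofRealCLM.hasSum (fluct_eq_tsum hτ h0 h1 s))
  have h3 := hs.hasSum.prod_fiberwise (fun n => hasSum_waveTerm_snd hτ h0 h1 s n)
  have := h3.unique h2
  rw [Complex.ofRealCLM_apply] at this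
  rw [← this]
  exact hs.hasSum

end Theta

section Modes

open MeasureTheory Filter Topology
open scoped ENNReal

/-! ### Integrability of the logarithmic singularities -/

/-- Lebesgue measure on the unit interval. -/
noncomputable def unitMeas : Measure ℝ := volume.restrict (Set.Ioo 0 1)

/-- Lebesgue measure on the unit square. -/
noncomputable def squareMeas : Measure (ℝ × ℝ) := unitMeas.prod unitMeas

instance : IsProbabilityMeasure unitMeas := ⟨by simp [unitMeas]⟩

instance : IsProbabilityMeasure squareMeas := by
  unfold squareMeas; infer_instance

/-- A power of the distance from `1` to `e^{2πiφ}`, infinite at the integers. -/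
noncomputable def logWeight (φ : ℝ) : ℝ≥0∞ := ENNReal.ofReal (circleDist 1 φ) ^ (-(1 / 2) : ℝ)

theorem circleDist_eq (ρ θ : ℝ) :
    circleDist ρ θ = ‖1 - (ρ : ℂ) * Complex.exp (Complex.I * ((2 * Real.pi * θ : ℝ) : ℂ))‖ := by
  rw [circleDist]
  congr 3
  push_cast
  congr 1
  ring

theorem measurable_circleDist (ρ : ℝ) : Measurable (circleDist ρ) := by
  unfold circleDist
  have : Continuous fun θ : ℝ => ‖1 - (ρ : ℂ) * Complex.exp (2 * Real.pi * Complex.I * θ)‖ := by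
    fun_prop
  exact this.measurable

theorem measurable_logWeight : Measurable logWeight :=
  (measurable_circleDist 1).ennreal_ofReal.pow_const _

theorem circleDist_periodic (ρ : ℝ) : Function.Periodic (circleDist ρ) 1 := by
  intro θ
  unfold circleDist
  push_cast
  rw [mul_add, mul_one, Complex.exp_periodic]

theorem logWeight_periodic : Function.Periodic logWeight 1 := fun φ => by
  rw [logWeight, circleDist_periodic, logWeight]

/-- Integrals of periodic functions over a period are invariant under translation. -/
theorem lintegral_unitMeas_add {h : ℝ → ℝ≥0∞} (hp : Function.Periodic h 1) (c : ℝ) :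
    ∫⁻ s, h (s + c) ∂unitMeas = ∫⁻ s, h s ∂unitMeas := by
  have e : unitMeas = volume.restrict (Set.Ioc 0 1) := Measure.restrict_congr_set Ioo_ae_eq_Ioc
  have h1 : ∫⁻ s in Set.Ioc (0 : ℝ) 1, h (s + c) = ∫⁻ s in Set.Ioc (0 + c) (1 + c), h s := by
    have := (measurePreserving_add_right (volume : Measure ℝ) c).setLIntegral_comp_preimage_emb
      (measurableEmbedding_addRight c) h (Set.Ioc (0 + c) (1 + c))
    simpa using this
  rw [e, h1, show (1 : ℝ) + c = (0 + c) + 1 by ring]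
  have h2 := (isAddFundamentalDomain_Ioc zero_lt_one (0 + c)).setLIntegral_eq
    (isAddFundamentalDomain_Ioc (zero_lt_one' ℝ) 0) h hp.map_vadd_zmultiples
  rw [h2, zero_add]

theorem le_circleDist_one {φ : ℝ} (h0 : 0 ≤ φ) (h1 : φ ≤ 1 / 2) : 4 * φ ≤ circleDist 1 φ := by
  rw [circleDist_eq, Complex.ofReal_one, one_mul, norm_sub_rev,
    Complex.norm_exp_I_mul_ofReal_sub_one]
  have hpi := Real.pi_pos
  have h2 := Real.mul_le_sin (x := 2 * Real.pi * φ / 2) (by positivity) (by nlinarith)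
  have h3 : 2 / Real.pi * (2 * Real.pi * φ / 2) = 2 * φ := by field_simp
  rw [h3] at h2
  rw [Real.norm_eq_abs, abs_of_nonneg (by linarith)]
  linarith

theorem lintegral_logWeight_ne_top : ∫⁻ φ, logWeight φ ∂unitMeas ≠ ∞ := by
  have hle : ∀ φ ∈ Set.Ioo (0 : ℝ) 1, logWeight φ ≤
      ENNReal.ofReal (φ ^ (-(1 / 2) : ℝ)) + ENNReal.ofReal ((1 - φ) ^ (-(1 / 2) : ℝ)) := by
    intro φ hφ
    have key : ∀ x : ℝ, 0 < x → x ≤ circleDist 1 φ →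
        logWeight φ ≤ ENNReal.ofReal (x ^ (-(1 / 2) : ℝ)) := by
      intro x hx hle
      rw [logWeight, ENNReal.ofReal_rpow_of_pos (hx.trans_le hle)]
      exact ENNReal.ofReal_le_ofReal (Real.rpow_le_rpow_of_nonpos hx hle (by norm_num))
    rcases le_total φ (1 / 2) with h | h
    · refine (key φ hφ.1 ?_).trans le_self_add
      linarith [le_circleDist_one hφ.1.le h, hφ.1]
    · refine (key (1 - φ) (by linarith [hφ.2]) ?_).trans le_add_self
      have h1 := le_circleDist_one (φ := 1 - φ) (by linarith [hφ.2]) (by linarith)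
      have h2 : circleDist 1 (1 - φ) = circleDist 1 φ := by
        rw [sub_eq_neg_add, circleDist_periodic, circleDist_neg]
      rw [h2] at h1
      linarith [hφ.2]
  refine ne_top_of_le_ne_top ?_ (setLIntegral_mono' measurableSet_Ioo hle)
  have i1 : IntervalIntegrable (fun φ : ℝ => φ ^ (-(1 / 2) : ℝ)) volume 0 1 :=
    intervalIntegral.intervalIntegrable_rpow' (by norm_num)
  have i2 : IntervalIntegrable (fun φ : ℝ => (1 - φ) ^ (-(1 / 2) : ℝ)) volume 0 1 := by
    have := (i1.comp_sub_left 1).symm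
    simpa using this
  rw [lintegral_add_left (by fun_prop)]
  have fin : ∀ f : ℝ → ℝ, IntervalIntegrable f volume 0 1 →
      ∫⁻ φ in Set.Ioo (0 : ℝ) 1, ENNReal.ofReal (f φ) ≠ ∞ := by
    intro f hf
    rw [intervalIntegrable_iff_integrableOn_Ioo_of_le zero_le_one] at hf
    exact hf.lintegral_lt_top.ne
  exact ENNReal.add_ne_top.2 ⟨fin _ i1, fin _ i2⟩

/-- Moving a point of the closed unit disc radially to the circle at most doubles its distance
to `1`. -/
theorem half_circleDist_one_le {ρ : ℝ} (h0 : 0 ≤ ρ) (h1 : ρ ≤ 1) (θ : ℝ) :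
    circleDist 1 θ / 2 ≤ circleDist ρ θ := by
  set e := Complex.exp (2 * Real.pi * Complex.I * θ) with he
  have hn : ‖e‖ = 1 := by rw [he, Complex.norm_exp]; simp
  have h2 : circleDist 1 θ ≤ circleDist ρ θ + (1 - ρ) := by
    unfold circleDist
    rw [← he]
    calc ‖1 - ((1 : ℝ) : ℂ) * e‖ = ‖(1 - (ρ : ℂ) * e) - ((1 - ρ : ℝ) : ℂ) * e‖ := by
          push_cast; congr 1; ring
      _ ≤ ‖1 - (ρ : ℂ) * e‖ + ‖((1 - ρ : ℝ) : ℂ) * e‖ := norm_sub_le _ _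
      _ = _ := by rw [norm_mul, hn, Complex.norm_real, Real.norm_eq_abs,
                    abs_of_nonneg (by linarith), mul_one]
  have h3 : 1 - ρ ≤ circleDist ρ θ := by
    unfold circleDist
    rw [← he]
    have := norm_sub_norm_le 1 ((ρ : ℂ) * e)
    rw [norm_mul, hn, Complex.norm_real, Real.norm_eq_abs, abs_of_nonneg h0, norm_one] at this
    linarith
  linarith

theorem circleDist_le_two {ρ : ℝ} (h0 : 0 ≤ ρ) (h1 : ρ ≤ 1) (θ : ℝ) : circleDist ρ θ ≤ 2 := by
  unfold circleDist
  refine (norm_sub_le _ _).trans ?_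
  rw [norm_mul, Complex.norm_exp, Complex.norm_real, Real.norm_eq_abs, abs_of_nonneg h0]
  simp
  linarith

/-- Powers of the logarithm are dominated by `logWeight`. -/
theorem abs_log_circleDist_pow_le (n : ℕ) : ∃ C : ℝ, 0 ≤ C ∧ ∀ ρ θ : ℝ, 0 ≤ ρ → ρ < 1 →
    ENNReal.ofReal (|Real.log (circleDist ρ θ)| ^ n) ≤ ENNReal.ofReal C * (logWeight θ) := by
  refine ⟨n.factorial * 2 ^ n * 4 ^ (1 / 2 : ℝ), by positivity, fun ρ θ h0 h1 => ?_⟩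
  have hc := circleDist_pos h0 h1 θ
  set d := circleDist 1 θ with hd
  have hd0 : 0 ≤ d := norm_nonneg _
  rcases hd0.eq_or_lt with hd0 | hd0
  · have : logWeight θ = ∞ := by
      rw [logWeight, ← hd, ← hd0, ENNReal.ofReal_zero, ENNReal.zero_rpow_of_neg (by norm_num)]
    rw [this, ENNReal.mul_top]
    · exact le_top
    · rw [ENNReal.ofReal_ne_zero_iff]
      positivity
  rw [logWeight, ← hd, ENNReal.ofReal_rpow_of_pos hd0, ← ENNReal.ofReal_mul (by positivity)]
  refine ENNReal.ofReal_le_ofReal ?_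
  set x := |Real.log (circleDist ρ θ)| with hx
  have hx0 : 0 ≤ x := abs_nonneg _
  have hd2 : d ≤ 2 := circleDist_le_two zero_le_one le_rfl θ
  have hexp : Real.exp x ≤ 4 / d := by
    rw [le_div_iff₀ hd0]
    rcases abs_cases (Real.log (circleDist ρ θ)) with h | h
    · rw [hx, h.1, Real.exp_log hc]
      nlinarith [circleDist_le_two h0 h1.le θ]
    · rw [hx, h.1, Real.exp_neg, Real.exp_log hc, inv_mul_le_iff₀ hc]
      linarith [half_circleDist_one_le h0 h1.le θ]
  have h2 : (x / 2) ^ n ≤ n.factorial * Real.exp (x / 2) := by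
    have := Real.pow_div_factorial_le_exp (x / 2) (by positivity) n
    rwa [div_le_iff₀ (by positivity), mul_comm] at this
  have h3 : Real.exp (x / 2) ≤ 4 ^ (1 / 2 : ℝ) * d ^ (-(1 / 2) : ℝ) := by
    have : Real.exp (x / 2) = Real.exp x ^ (1 / 2 : ℝ) := by
      rw [← Real.exp_mul]; congr 1; ring
    rw [this, Real.rpow_neg hd0.le, ← div_eq_mul_inv, ← Real.div_rpow (by norm_num) hd0.le]
    exact Real.rpow_le_rpow (Real.exp_pos _).le hexp (by norm_num)
  rw [div_pow, div_le_iff₀ (by positivity)] at h2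
  calc x ^ n ≤ n.factorial * Real.exp (x / 2) * 2 ^ n := h2
    _ ≤ n.factorial * (4 ^ (1 / 2 : ℝ) * d ^ (-(1 / 2) : ℝ)) * 2 ^ n := by gcongr
    _ = _ := by ring

/-- Away from its two logarithmic singularities the fluctuating part of the propagator is
bounded. -/
theorem exists_abs_fluct_le {τ : ℂ} (hτ : 0 < τ.im) : ∃ C : ℝ, 0 ≤ C ∧ ∀ r s : ℝ, 0 < r → r < 1 →
    ∃ ρ₀ ρ₁ : ℝ, 0 ≤ ρ₀ ∧ ρ₀ < 1 ∧ 0 ≤ ρ₁ ∧ ρ₁ < 1 ∧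
    |fluct τ r s| ≤ C + 2 * |Real.log (circleDist ρ₀ (s + r * τ.re))| +
      2 * |Real.log (circleDist ρ₁ (s + r * τ.re - τ.re))| := by
  have hc : 0 < Real.pi * τ.im := mul_pos Real.pi_pos hτ
  have hs1 := summable_exp_neg_abs (c := Real.pi * τ.im / 2) (by positivity)
  have hs2 := summable_exp_neg_abs_ne_zero hc
  set K := ∑' m : {z : ℤ // z ≠ 0}, Real.exp (-(Real.pi * τ.im * |((m : ℤ) : ℝ)|)) with hK
  refine ⟨∑' n : ℤ, Real.exp (-(Real.pi * τ.im / 2 * |(n : ℝ)|)) * K,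
    tsum_nonneg fun n => mul_nonneg (Real.exp_pos _).le (tsum_nonneg fun _ => (Real.exp_pos _).le),
    fun r s h0 h1 => ?_⟩
  set E : ℤ → ℝ := fun n => -2 * Real.log (circleDist
    (Real.exp (-(2 * Real.pi * τ.im * |n + r|))) (s + (n + r) * τ.re)) with hE
  have hρ : ∀ n : ℤ, Real.exp (-(2 * Real.pi * τ.im * |n + r|)) < 1 := fun n => by
    have hpos : 0 < |n + r| := (lt_min h0 (by linarith)).trans_le (min_le_abs_add h0 h1 n)
    exact Real.exp_lt_one_iff.2 (neg_neg_of_pos (by positivity))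
  refine ⟨_, _, (Real.exp_pos _).le, hρ 0, (Real.exp_pos _).le, hρ (-1), ?_⟩
  have hsum : HasSum E (fluct τ r s) := fluct_eq_tsum hτ h0 h1 s
  have hbound : ∀ n : ℤ, n ≠ 0 → n ≠ -1 →
      |E n| ≤ Real.exp (-(Real.pi * τ.im / 2 * |(n : ℝ)|)) * K := by
    intro n hn0 hn1
    have h := hasSum_waveTerm_snd hτ h0 h1 s n
    have hge1 : 1 ≤ |n + r| ∧ |(n : ℝ)| ≤ 2 * |n + r| := by
      rcases lt_or_gt_of_ne hn0 with hn | hn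
      · have : (n : ℝ) ≤ -2 := by exact_mod_cast (by omega : n ≤ -2)
        rw [abs_of_neg (by linarith), abs_of_neg (by linarith : (n : ℝ) < 0)]
        constructor <;> linarith
      · have : (1 : ℝ) ≤ n := by exact_mod_cast hn
        rw [abs_of_pos (by linarith), abs_of_pos (by linarith : (0 : ℝ) < n)]
        constructor <;> linarith
    have hle : ∀ m, ‖waveTerm τ r s (n, m)‖ ≤ Real.exp (-(Real.pi * τ.im / 2 * |(n : ℝ)|)) *
        Real.exp (-(Real.pi * τ.im * |((m : ℤ) : ℝ)|)) := by
      intro m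
      refine (norm_waveTerm_le τ hτ r s 1 (n, m) hge1.1).trans ?_
      rw [mul_one]
      refine mul_le_mul_of_nonneg_right (Real.exp_le_exp.2 ?_) (Real.exp_pos _).le
      simp only
      nlinarith [hge1.2]
    have h2 : ‖((E n : ℝ) : ℂ)‖ ≤ Real.exp (-(Real.pi * τ.im / 2 * |(n : ℝ)|)) * K := by
      rw [← h.tsum_eq, hK, ← tsum_mul_left]
      exact tsum_of_norm_bounded (hs2.mul_left _).hasSum hle
    rwa [Complex.norm_real, Real.norm_eq_abs] at h2
  have hE' : HasSum (fun n => if n = 0 ∨ n = -1 then 0 else E n) (fluct τ r s - E 0 - E (-1)) := by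
    have t0 := hasSum_ite_eq (0 : ℤ) (E 0)
    have t1 := hasSum_ite_eq (-1 : ℤ) (E (-1))
    refine ((hsum.sub t0).sub t1).congr_fun fun n => ?_
    by_cases hn0 : n = 0
    · subst hn0; simp
    · by_cases hn1 : n = -1
      · subst hn1; simp
      · simp [hn0, hn1]
  have hrest : |fluct τ r s - E 0 - E (-1)| ≤
      ∑' n : ℤ, Real.exp (-(Real.pi * τ.im / 2 * |(n : ℝ)|)) * K := by
    rw [← hE'.tsum_eq, ← Real.norm_eq_abs]
    refine tsum_of_norm_bounded (hs1.mul_right K).hasSum fun n => ?_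
    split_ifs with hn
    · rw [norm_zero]
      exact mul_nonneg (Real.exp_pos _).le (tsum_nonneg fun _ => (Real.exp_pos _).le)
    · rw [not_or] at hn
      exact hbound n hn.1 hn.2
  have e0 : |E 0| = 2 * |Real.log (circleDist
      (Real.exp (-(2 * Real.pi * τ.im * |((0 : ℤ) : ℝ) + r|)))
      (s + r * τ.re))| := by
    simp only [hE, abs_mul]
    norm_num
  have e1 : |E (-1)| = 2 * |Real.log (circleDist
      (Real.exp (-(2 * Real.pi * τ.im * |((-1 : ℤ) : ℝ) + r|))) (s + r * τ.re - τ.re))| := by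
    simp only [hE, abs_mul]
    rw [show s + (((-1 : ℤ) : ℝ) + r) * τ.re = s + r * τ.re - τ.re by push_cast; ring]
    norm_num
  rw [← e0, ← e1]
  have := abs_add_three (fluct τ r s - E 0 - E (-1)) (E 0) (E (-1))
  rw [show fluct τ r s - E 0 - E (-1) + E 0 + E (-1) = fluct τ r s by ring] at this
  linarith

/-- The bound does not depend on `r`: only translates of one integrable function of `s` occur. -/
theorem exists_fluct_pow_le {τ : ℂ} (hτ : 0 < τ.im) (n : ℕ) : ∃ C : ℝ, ∀ r s : ℝ, 0 < r → r < 1 →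
    ENNReal.ofReal (|fluct τ r s| ^ n) ≤ ENNReal.ofReal C *
      (1 + logWeight (s + r * τ.re) + logWeight (s + (r * τ.re - τ.re))) := by
  obtain ⟨C, hC, h⟩ := exists_abs_fluct_le hτ
  obtain ⟨B, hB, hb⟩ := abs_log_circleDist_pow_le n
  refine ⟨3 ^ n * (C ^ n + 2 ^ n * B), fun r s h0 h1 => ?_⟩
  obtain ⟨ρ₀, ρ₁, h00, h01, h10, h11, hle⟩ := h r s h0 h1
  set x := |Real.log (circleDist ρ₀ (s + r * τ.re))|
  set y := |Real.log (circleDist ρ₁ (s + r * τ.re - τ.re))|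
  have hx : 0 ≤ x := abs_nonneg _
  have hy : 0 ≤ y := abs_nonneg _
  have h3 : |fluct τ r s| ^ n ≤ 3 ^ n * (C ^ n + 2 ^ n * x ^ n + 2 ^ n * y ^ n) := by
    -- the power of a sum of three terms is at most the power of three times the largest one
    have hm : ∃ M, |fluct τ r s| ≤ 3 * M ∧ 0 ≤ M ∧
        M ^ n ≤ C ^ n + 2 ^ n * x ^ n + 2 ^ n * y ^ n := by
      have p1 : 0 ≤ C ^ n := by positivity
      have p2 : 0 ≤ 2 ^ n * x ^ n := by positivity
      have p3 : 0 ≤ 2 ^ n * y ^ n := by positivity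
      rcases le_total C (2 * x) with h1 | h1
      · rcases le_total (2 * x) (2 * y) with h2 | h2
        · exact ⟨2 * y, by linarith, by positivity, by rw [mul_pow]; linarith⟩
        · exact ⟨2 * x, by linarith, by positivity, by rw [mul_pow]; linarith⟩
      · rcases le_total C (2 * y) with h2 | h2
        · exact ⟨2 * y, by linarith, by positivity, by rw [mul_pow]; linarith⟩
        · exact ⟨C, by linarith, by positivity, by linarith⟩
    obtain ⟨M, hM1, hM0, hM2⟩ := hm
    calc |fluct τ r s| ^ n ≤ (3 * M) ^ n := pow_le_pow_left₀ (abs_nonneg _) hM1 n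
      _ = 3 ^ n * M ^ n := mul_pow _ _ _
      _ ≤ _ := by gcongr
  refine (ENNReal.ofReal_le_ofReal h3).trans ?_
  have hb0 := hb ρ₀ (s + r * τ.re) h00 h01
  have hb1 : ENNReal.ofReal (y ^ n) ≤
      ENNReal.ofReal B * logWeight (s + (r * τ.re - τ.re)) := by
    rw [← add_sub_assoc]
    exact hb ρ₁ (s + r * τ.re - τ.re) h10 h11
  rw [ENNReal.ofReal_mul (by positivity), ENNReal.ofReal_add (by positivity) (by positivity),
    ENNReal.ofReal_add (by positivity) (by positivity), ENNReal.ofReal_mul (by positivity),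
    ENNReal.ofReal_mul (by positivity), ENNReal.ofReal_mul (by positivity),
    ENNReal.ofReal_add (by positivity) (by positivity), ENNReal.ofReal_mul (by positivity),
    mul_assoc]
  refine mul_le_mul_right ?_ _
  calc ENNReal.ofReal (C ^ n) + ENNReal.ofReal (2 ^ n) * ENNReal.ofReal (x ^ n) +
        ENNReal.ofReal (2 ^ n) * ENNReal.ofReal (y ^ n)
      ≤ ENNReal.ofReal (C ^ n) + ENNReal.ofReal (2 ^ n) * (ENNReal.ofReal B *
          logWeight (s + r * τ.re)) + ENNReal.ofReal (2 ^ n) * (ENNReal.ofReal B *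
          logWeight (s + (r * τ.re - τ.re))) := by gcongr
    _ ≤ ENNReal.ofReal (C ^ n) * (1 + logWeight (s + r * τ.re) +
          logWeight (s + (r * τ.re - τ.re))) + ENNReal.ofReal (2 ^ n) * ENNReal.ofReal B *
          (logWeight (s + r * τ.re) + logWeight (s + (r * τ.re - τ.re))) := by
        rw [mul_add (ENNReal.ofReal (2 ^ n) * ENNReal.ofReal B), ← mul_assoc, ← mul_assoc,
          add_assoc]
        gcongr
        rw [add_assoc]
        exact le_mul_of_one_le_right bot_le le_self_add
    _ ≤ _ := by
        rw [add_mul, add_assoc (1 : ℝ≥0∞)]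
        exact add_le_add le_rfl (mul_le_mul_right le_add_self _)

/-! ### Integrability of products of propagators -/

theorem measurable_propagator {X : Type*} [TopologicalSpace X] [MeasurableSpace X]
    [OpensMeasurableSpace X] {f g : X → ℂ} (hf : Continuous f) (hg : Continuous g)
    (h : ∀ x, 0 < (g x).im) : Measurable fun x => propagator (f x) (g x) := by
  have hθ : Measurable fun x => theta (f x) (g x) := by
    simp_rw [theta_eq]
    refine Measurable.mul (Continuous.measurable (by fun_prop)) (Continuous.measurable ?_)
    refine continuous_iff_continuousAt.2 fun x => ?_
    have h1 := continuousAt_jacobiTheta₂ (f x + g x / 2 + 1 / 2) (h x)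
    exact h1.comp_of_eq (f := fun x => (f x + g x / 2 + 1 / 2, g x))
      (Continuous.continuousAt (by fun_prop)) rfl
  have hη : Measurable fun x => ModularForm.eta (g x) := by
    refine Continuous.measurable (continuous_iff_continuousAt.2 fun x => ?_)
    exact (ModularForm.differentiableAt_eta_of_mem_upperHalfPlaneSet (h x)).continuousAt.comp
      hg.continuousAt
  unfold propagator
  refine Measurable.add (((hθ.div hη).norm.pow_const 2).log.const_mul _) ?_
  exact ((Complex.measurable_im.comp hf.measurable).pow_const 2 |>.const_mul _).div
    ((Complex.measurable_im.comp hg.measurable).const_mul _)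

theorem measurable_fluct {τ : ℂ} (hτ : 0 < τ.im) : Measurable fun p : ℝ × ℝ => fluct τ p.1 p.2 := by
  unfold fluct
  refine Measurable.sub (Measurable.const_mul ?_ _) (Continuous.measurable (by fun_prop))
  exact measurable_propagator (by unfold torusPoint; fun_prop) continuous_const fun _ => hτ

/-- The function lies in every space `Lᵖ` with a finite integer exponent. -/
def AllLp {X : Type*} [MeasurableSpace X] (μ : Measure X) (f : X → ℝ) : Prop :=
  ∀ n : ℕ, MemLp f n μ

section AllLp

variable {X : Type*} [MeasurableSpace X] {μ : Measure X} {f g : X → ℝ}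

theorem AllLp.add (hf : AllLp μ f) (hg : AllLp μ g) : AllLp μ fun x => f x + g x :=
  fun n => (hf n).add (hg n)

/-- By the Cauchy–Schwarz inequality. -/
theorem AllLp.mul (hf : AllLp μ f) (hg : AllLp μ g) : AllLp μ fun x => f x * g x := by
  intro n
  have : ENNReal.HolderTriple ((2 * n : ℕ) : ℝ≥0∞) ((2 * n : ℕ) : ℝ≥0∞) n := by
    refine ⟨?_⟩
    push_cast
    rw [ENNReal.mul_inv (by simp) (by simp), ← add_mul, ENNReal.inv_two_add_inv_two, one_mul]
  exact (hg (2 * n)).mul' (hf (2 * n))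

theorem AllLp.const [IsFiniteMeasure μ] (c : ℝ) : AllLp μ fun _ => c :=
  fun _ => memLp_const c

theorem AllLp.pow [IsFiniteMeasure μ] (hf : AllLp μ f) (k : ℕ) : AllLp μ fun x => f x ^ k := by
  induction k with
  | zero => simpa using AllLp.const 1
  | succ k ih => simpa [pow_succ] using ih.mul hf

theorem AllLp.integrable (hf : AllLp μ f) : Integrable f μ := by
  have := hf 1
  rwa [Nat.cast_one, memLp_one_iff_integrable] at this

theorem AllLp.of_bound [IsFiniteMeasure μ] (hf : AEStronglyMeasurable f μ) (C : ℝ)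
    (h : ∀ᵐ x ∂μ, ‖f x‖ ≤ C) : AllLp μ f :=
  fun _ => MemLp.of_bound hf C h

theorem AllLp.of_lintegral (hf : AEStronglyMeasurable f μ)
    (h : ∀ n : ℕ, ∫⁻ x, ENNReal.ofReal (|f x| ^ n) ∂μ ≠ ∞) : AllLp μ f := by
  intro n
  refine ⟨hf, ?_⟩
  rcases eq_or_ne n 0 with rfl | hn
  · simp
  rw [eLpNorm_lt_top_iff_lintegral_rpow_enorm_lt_top (by simpa using hn) (by simp)]
  refine lt_of_le_of_lt (lintegral_mono fun x => ?_) (h n).lt_top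
  rw [ENNReal.toReal_natCast, ENNReal.rpow_natCast, ← ofReal_norm,
    ← ENNReal.ofReal_pow (norm_nonneg _), Real.norm_eq_abs]

end AllLp

/-- The simplex of the ordered pairs `0 < r₂ < r₁ < 1`. -/
def orderedPairs : Set (ℝ × ℝ) := {p | 0 < p.2 ∧ p.2 < p.1 ∧ p.1 < 1}

theorem measurableSet_orderedPairs : MeasurableSet orderedPairs :=
  (measurableSet_lt measurable_const measurable_snd).inter
    ((measurableSet_lt measurable_snd measurable_fst).inter
      (measurableSet_lt measurable_fst measurable_const))

/-- Lebesgue measure on the simplex of the ordered pairs. -/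
noncomputable def orderedMeas : Measure (ℝ × ℝ) := volume.restrict orderedPairs

theorem squareMeas_eq : squareMeas = volume.restrict (Set.Ioo (0 : ℝ) 1 ×ˢ Set.Ioo (0 : ℝ) 1) := by
  rw [squareMeas, unitMeas, Measure.prod_restrict, ← Measure.volume_eq_prod]

theorem orderedMeas_eq : orderedMeas = squareMeas.restrict {p | p.2 < p.1} := by
  rw [squareMeas_eq, Measure.restrict_restrict (measurableSet_lt measurable_snd measurable_fst),
    orderedMeas]
  congr 1
  ext p
  simp only [orderedPairs, Set.mem_ofPred_eq, Set.mem_inter_iff, Set.mem_prod, Set.mem_Ioo]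
  constructor
  · rintro ⟨h1, h2, h3⟩
    exact ⟨h2, ⟨by linarith, h3⟩, h1, by linarith⟩
  · rintro ⟨h1, ⟨h2, h3⟩, h4, h5⟩
    exact ⟨h4, h1, h3⟩

instance : IsFiniteMeasure orderedMeas := by
  rw [orderedMeas_eq]; infer_instance

theorem ae_mem_orderedPairs : ∀ᵐ p ∂orderedMeas, p ∈ orderedPairs :=
  ae_restrict_mem measurableSet_orderedPairs

/-- The fluctuating part of the propagator of one edge has finite moments: `ℓ` is one of `s₁`, `s₂`,
`s₁ - s₂`, and `ρ` one of `r₁`, `r₂`, `r₁ - r₂`. -/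
theorem AllLp.fluct_comp {τ : ℂ} (hτ : 0 < τ.im) {ρ ℓ : ℝ × ℝ → ℝ} (hρ : Measurable ρ)
    (hℓ : Measurable ℓ) (h01 : ∀ p ∈ orderedPairs, 0 < ρ p ∧ ρ p < 1)
    (hℓs : ∀ c, ∫⁻ p, logWeight (ℓ p + c) ∂squareMeas = ∫⁻ s, logWeight s ∂unitMeas) :
    AllLp (orderedMeas.prod squareMeas) fun x => fluct τ (ρ x.1) (ℓ x.2) := by
  have hm : Measurable fun x : (ℝ × ℝ) × (ℝ × ℝ) => fluct τ (ρ x.1) (ℓ x.2) :=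
    Measurable.comp (g := fun p : ℝ × ℝ => fluct τ p.1 p.2)
      (f := fun x : (ℝ × ℝ) × (ℝ × ℝ) => (ρ x.1, ℓ x.2)) (measurable_fluct hτ)
      ((hρ.comp measurable_fst).prodMk (hℓ.comp measurable_snd))
  refine AllLp.of_lintegral hm.aestronglyMeasurable fun n => ?_
  obtain ⟨C, hC⟩ := exists_fluct_pow_le hτ n
  refine ne_top_of_le_ne_top ?_ (lintegral_prod_le _)
  have hbound : ∀ᵐ p ∂orderedMeas,
      ∫⁻ s, ENNReal.ofReal (|fluct τ (ρ p) (ℓ s)| ^ n) ∂squareMeas ≤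
        ENNReal.ofReal C * (1 + ∫⁻ s, logWeight s ∂unitMeas + ∫⁻ s, logWeight s ∂unitMeas) := by
    filter_upwards [ae_mem_orderedPairs] with p hp
    refine (lintegral_mono fun s => hC (ρ p) (ℓ s) (h01 p hp).1 (h01 p hp).2).trans (le_of_eq ?_)
    have hw : ∀ c, Measurable fun s => logWeight (ℓ s + c) := fun c =>
      measurable_logWeight.comp (hℓ.add_const c)
    rw [lintegral_const_mul' _ _ ENNReal.ofReal_ne_top, lintegral_add_right _ (hw _),
      lintegral_add_right _ (hw _),
      hℓs, hℓs]
    simp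
  refine ne_top_of_le_ne_top ?_ (lintegral_mono_ae hbound)
  rw [lintegral_const]
  have := lintegral_logWeight_ne_top
  exact ENNReal.mul_ne_top (ENNReal.mul_ne_top ENNReal.ofReal_ne_top (by simp [this]))
    (measure_ne_top _ _)

theorem lintegral_logWeight_fst (c : ℝ) :
    ∫⁻ p, logWeight (p.1 + c) ∂squareMeas = ∫⁻ s, logWeight s ∂unitMeas := by
  have hw : Measurable fun s : ℝ × ℝ => logWeight (s.1 + c) :=
    measurable_logWeight.comp (measurable_fst.add_const c)
  rw [squareMeas, lintegral_prod_symm' _ hw]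
  simp_rw [lintegral_unitMeas_add logWeight_periodic]
  simp

theorem lintegral_logWeight_snd (c : ℝ) :
    ∫⁻ p, logWeight (p.2 + c) ∂squareMeas = ∫⁻ s, logWeight s ∂unitMeas := by
  have hw : Measurable fun s : ℝ × ℝ => logWeight (s.2 + c) :=
    measurable_logWeight.comp (measurable_snd.add_const c)
  rw [squareMeas, lintegral_prod _ hw.aemeasurable]
  simp_rw [lintegral_unitMeas_add logWeight_periodic]
  simp

theorem lintegral_logWeight_sub (c : ℝ) :
    ∫⁻ p, logWeight (p.1 - p.2 + c) ∂squareMeas = ∫⁻ s, logWeight s ∂unitMeas := by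
  have hw : Measurable fun s : ℝ × ℝ => logWeight (s.1 - s.2 + c) :=
    measurable_logWeight.comp ((measurable_fst.sub measurable_snd).add_const c)
  rw [squareMeas, lintegral_prod_symm' _ hw]
  simp_rw [sub_add, sub_eq_add_neg (_ : ℝ) (_ - c), lintegral_unitMeas_add logWeight_periodic]
  simp

/-- The product of powers of the three fluctuations, as a function of `((r₁,r₂),(s₁,s₂))`. -/
noncomputable def fluctProd (τ : ℂ) (a b c : ℕ) (p s : ℝ × ℝ) : ℝ :=
  fluct τ p.1 s.1 ^ a * fluct τ p.2 s.2 ^ b * fluct τ (p.1 - p.2) (s.1 - s.2) ^ c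

theorem orderedPairs_mem_Ioo {p : ℝ × ℝ} (hp : p ∈ orderedPairs) :
    (0 < p.1 ∧ p.1 < 1) ∧ (0 < p.2 ∧ p.2 < 1) ∧ (0 < p.1 - p.2 ∧ p.1 - p.2 < 1) := by
  obtain ⟨h1, h2, h3⟩ := hp
  exact ⟨⟨by linarith, h3⟩, ⟨h1, by linarith⟩, by linarith, by linarith⟩

theorem allLp_fluct_fst {τ : ℂ} (hτ : 0 < τ.im) :
    AllLp (orderedMeas.prod squareMeas) fun x => fluct τ x.1.1 x.2.1 :=
  AllLp.fluct_comp (ρ := Prod.fst) (ℓ := Prod.fst) hτ measurable_fst measurable_fst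
    (fun _ hp => (orderedPairs_mem_Ioo hp).1)
    lintegral_logWeight_fst

theorem allLp_fluct_snd {τ : ℂ} (hτ : 0 < τ.im) :
    AllLp (orderedMeas.prod squareMeas) fun x => fluct τ x.1.2 x.2.2 :=
  AllLp.fluct_comp (ρ := Prod.snd) (ℓ := Prod.snd) hτ measurable_snd measurable_snd
    (fun _ hp => (orderedPairs_mem_Ioo hp).2.1)
    lintegral_logWeight_snd

theorem allLp_fluct_sub {τ : ℂ} (hτ : 0 < τ.im) :
    AllLp (orderedMeas.prod squareMeas) fun x => fluct τ (x.1.1 - x.1.2) (x.2.1 - x.2.2) :=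
  AllLp.fluct_comp (ρ := fun p => p.1 - p.2) (ℓ := fun s => s.1 - s.2) hτ
    (measurable_fst.sub measurable_snd) (measurable_fst.sub measurable_snd)
    (fun _ hp => (orderedPairs_mem_Ioo hp).2.2) lintegral_logWeight_sub

theorem allLp_fluctProd {τ : ℂ} (hτ : 0 < τ.im) (a b c : ℕ) :
    AllLp (orderedMeas.prod squareMeas) fun x => fluctProd τ a b c x.1 x.2 :=
  (((allLp_fluct_fst hτ).pow a).mul ((allLp_fluct_snd hτ).pow b)).mul ((allLp_fluct_sub hτ).pow c)

/-! ### The constant Fourier mode of a product of propagators -/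

theorem hasSum_mul_prod {ι κ : Type*} {f : ι → ℂ} {g : κ → ℂ} {x y : ℂ}
    (hf : HasSum f x ∧ Summable fun i => ‖f i‖) (hg : HasSum g y ∧ Summable fun i => ‖g i‖) :
    HasSum (fun p : ι × κ => f p.1 * g p.2) (x * y) ∧
      Summable fun p : ι × κ => ‖f p.1 * g p.2‖ :=
  ⟨hf.1.mul hg.1 (summable_mul_of_summable_norm (f := f) (g := g) hf.2 hg.2),
    Summable.mul_norm (f := f) (g := g) hf.2 hg.2⟩

theorem hasSum_prod_fin {ι : Type*} {f : ι → ℂ} {x : ℂ} (hf : HasSum f x)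
    (hs : Summable fun i => ‖f i‖) (j : ℕ) :
    HasSum (fun v : Fin j → ι => ∏ i, f (v i)) (x ^ j) ∧
      Summable fun v : Fin j → ι => ‖∏ i, f (v i)‖ := by
  induction j with
  | zero =>
    refine ⟨?_, ?_⟩
    · simp [hasSum_unique]
    · exact (hasSum_unique fun v : Fin 0 → ι => ‖∏ i, f (v i)‖).summable
  | succ j ih =>
    have e : (fun v : Fin (j + 1) → ι => ∏ i, f (v i)) ∘ Fin.consEquiv (fun _ => ι) =
        fun p : ι × (Fin j → ι) => f p.1 * ∏ i, f (p.2 i) := by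
      funext p
      simp [Fin.prod_univ_succ, Fin.consEquiv]
    have h := hasSum_mul_prod ⟨hf, hs⟩ ih
    rw [pow_succ']
    refine ⟨(Fin.consEquiv fun _ => ι).hasSum_iff.1 ?_,
      (Fin.consEquiv fun _ => ι).summable_iff.1 ?_⟩
    · rw [e]
      exact h.1
    · refine h.2.congr fun p => ?_
      rw [← congrFun e p]
      rfl

/-- Vectors of non-zero integers attached to the three edges. -/
abbrev Freq (a b c : ℕ) : Type :=
  (Fin a → {z : ℤ // z ≠ 0}) × (Fin b → {z : ℤ // z ≠ 0}) × (Fin c → {z : ℤ // z ≠ 0})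

/-- Vectors of integers attached to the three edges. -/
abbrev Wind (a b c : ℕ) : Type := (Fin a → ℤ) × (Fin b → ℤ) × (Fin c → ℤ)

/-- The sum `∑ |mᵢ| |nᵢ + r|`, the rate of decay of a Fourier mode of one edge. -/
noncomputable def edgeEnergy {j : ℕ} (r : ℝ) (n : Fin j → ℤ) (m : Fin j → {z : ℤ // z ≠ 0}) : ℝ :=
  ∑ i, |((m i : ℤ) : ℝ)| * |(n i : ℝ) + r|

/-- The pairing `∑ mᵢ nᵢ`. -/
def edgePairing {j : ℕ} (n : Fin j → ℤ) (m : Fin j → {z : ℤ // z ≠ 0}) : ℤ := ∑ i, (m i : ℤ) * n i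

theorem prod_waveTerm (τ : ℂ) (r s : ℝ) {j : ℕ} (n : Fin j → ℤ) (m : Fin j → {z : ℤ // z ≠ 0}) :
    ∏ i, waveTerm τ r s (n i, m i) =
      (((prodAbs m)⁻¹ * Real.exp (-(2 * Real.pi * τ.im * edgeEnergy r n m)) : ℝ) : ℂ) *
        (Complex.exp (2 * Real.pi * Complex.I * ((edgePairing n m + total m * r) * τ.re)) *
          Complex.exp (2 * Real.pi * Complex.I * (total m * s))) := by
  simp only [waveTerm, Finset.prod_mul_distrib]
  rw [← Complex.exp_add, ← Complex.exp_sum]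
  congr 1
  · rw [← Complex.ofReal_prod, Finset.prod_mul_distrib, Finset.prod_inv_distrib, ← Real.exp_sum,
      prodAbs, edgeEnergy, Finset.mul_sum, Finset.sum_neg_distrib]
  · congr 1
    rw [← Finset.mul_sum, ← mul_add, edgePairing, total]
    congr 1
    push_cast
    simp only [Finset.sum_mul, add_mul, ← Finset.sum_add_distrib]
    refine Finset.sum_congr rfl fun i _ => ?_
    ring

theorem hasSum_fluct_pow {τ : ℂ} (hτ : 0 < τ.im) {r : ℝ} (h0 : 0 < r) (h1 : r < 1) (s : ℝ)
    (j : ℕ) :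
    HasSum (fun w : (Fin j → ℤ) × (Fin j → {z : ℤ // z ≠ 0}) =>
        ∏ i, waveTerm τ r s (w.1 i, w.2 i)) ((fluct τ r s : ℂ) ^ j) ∧
      Summable fun w : (Fin j → ℤ) × (Fin j → {z : ℤ // z ≠ 0}) =>
        ‖∏ i, waveTerm τ r s (w.1 i, w.2 i)‖ := by
  have h := hasSum_prod_fin (hasSum_waveTerm hτ h0 h1 s) (summable_norm_waveTerm hτ h0 h1 s) j
  rw [← (Equiv.arrowProdEquivProdArrow (Fin j) (fun _ => ℤ)
      fun _ => {z : ℤ // z ≠ 0}).symm.hasSum_iff,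
    ← (Equiv.arrowProdEquivProdArrow (Fin j) (fun _ => ℤ)
      fun _ => {z : ℤ // z ≠ 0}).symm.summable_iff] at h
  exact h

/-- The weight `1 / ∏ |mᵢ|` of a set of frequencies without total frequency at the two vertices
of integration. -/
noncomputable def balancedWeight {a b c : ℕ} (m : Freq a b c) : ℝ :=
  if total m.1 + total m.2.2 = 0 ∧ total m.2.1 - total m.2.2 = 0 then
    (prodAbs m.1 * prodAbs m.2.1 * prodAbs m.2.2)⁻¹ else 0

/-- The rate of decay of a Fourier mode of the product of propagators. -/
noncomputable def energy {a b c : ℕ} (p : ℝ × ℝ) (n : Wind a b c) (m : Freq a b c) : ℝ :=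
  edgeEnergy p.1 n.1 m.1 + edgeEnergy p.2 n.2.1 m.2.1 + edgeEnergy (p.1 - p.2) n.2.2 m.2.2

/-- The pairing of winding numbers and frequencies, over all edges. -/
def pairing {a b c : ℕ} (n : Wind a b c) (m : Freq a b c) : ℤ :=
  edgePairing n.1 m.1 + edgePairing n.2.1 m.2.1 + edgePairing n.2.2 m.2.2

/-- The unit complex number through which a Fourier mode depends on `Re τ`. -/
noncomputable def phase {a b c : ℕ} (τ : ℂ) (n : Wind a b c) (m : Freq a b c) : ℂ :=
  Complex.exp (2 * Real.pi * Complex.I * (pairing n m * τ.re))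

theorem norm_phase {a b c : ℕ} (τ : ℂ) (n : Wind a b c) (m : Freq a b c) : ‖phase τ n m‖ = 1 := by
  rw [phase, Complex.norm_exp]
  simp

theorem integral_unitMeas_exp (k : ℤ) :
    ∫ s, Complex.exp (2 * Real.pi * Complex.I * (k * s)) ∂unitMeas = if k = 0 then 1 else 0 := by
  split_ifs with hk
  · simp [hk]
  have hc : 2 * Real.pi * Complex.I * k ≠ 0 := by simp [hk, Real.pi_ne_zero]
  have h1 : ∫ s, Complex.exp (2 * Real.pi * Complex.I * (k * s)) ∂unitMeas =
      ∫ s in (0 : ℝ)..1, Complex.exp ((2 * Real.pi * Complex.I * k) * s) := by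
    rw [intervalIntegral.integral_of_le zero_le_one, integral_Ioc_eq_integral_Ioo, unitMeas]
    simp only [mul_assoc]
  rw [h1, integral_exp_mul_complex hc]
  have : Complex.exp (2 * Real.pi * Complex.I * k) = 1 := by
    rw [mul_comm]; exact Complex.exp_int_mul_two_pi_mul_I k
  simp [this]

/-- The equivalence sorting winding numbers and frequencies by edges. -/
def windFreqEquiv (a b c : ℕ) : Wind a b c × Freq a b c ≃
    ((Fin a → ℤ) × (Fin a → {z : ℤ // z ≠ 0})) × ((Fin b → ℤ) × (Fin b → {z : ℤ // z ≠ 0})) ×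
      ((Fin c → ℤ) × (Fin c → {z : ℤ // z ≠ 0})) where
  toFun x := ((x.1.1, x.2.1), (x.1.2.1, x.2.2.1), (x.1.2.2, x.2.2.2))
  invFun y := ((y.1.1, y.2.1.1, y.2.2.1), (y.1.2, y.2.1.2, y.2.2.2))
  left_inv _ := rfl
  right_inv _ := rfl

/-- Integrating over `s₁, s₂` keeps the Fourier modes without total frequency. -/
theorem hasSum_integral_fluctProd {τ : ℂ} (hτ : 0 < τ.im) (a b c : ℕ) {p : ℝ × ℝ}
    (hp : p ∈ orderedPairs) :
    HasSum (fun w : Wind a b c × Freq a b c =>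
        ((balancedWeight w.2 * Real.exp (-(2 * Real.pi * τ.im * energy p w.1 w.2)) : ℝ) : ℂ) *
          phase τ w.1 w.2)
      ((∫ s, fluctProd τ a b c p s ∂squareMeas : ℝ) : ℂ) := by
  obtain ⟨⟨h1, h1'⟩, ⟨h2, h2'⟩, h3, h3'⟩ := orderedPairs_mem_Ioo hp
  let F : Wind a b c × Freq a b c → ℝ × ℝ → ℂ := fun w s =>
    (∏ i, waveTerm τ p.1 s.1 (w.1.1 i, w.2.1 i)) *
      ((∏ i, waveTerm τ p.2 s.2 (w.1.2.1 i, w.2.2.1 i)) *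
      ∏ i, waveTerm τ (p.1 - p.2) (s.1 - s.2) (w.1.2.2 i, w.2.2.2 i))
  have hsum : ∀ s, HasSum (fun w => F w s) (fluctProd τ a b c p s : ℂ) ∧
      Summable fun w => ‖F w s‖ := by
    intro s
    have t1 := hasSum_fluct_pow hτ h1 h1' s.1 a
    have t2 := hasSum_fluct_pow hτ h2 h2' s.2 b
    have t3 := hasSum_fluct_pow hτ h3 h3' (s.1 - s.2) c
    have t := hasSum_mul_prod t1 (hasSum_mul_prod t2 t3)
    refine ⟨?_, (windFreqEquiv a b c).summable_iff.2 t.2⟩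
    have h := (windFreqEquiv a b c).hasSum_iff.2 t.1
    rw [fluctProd, mul_assoc]
    push_cast
    exact h
  have hF : ∀ w s, F w s = ((((prodAbs w.2.1 * prodAbs w.2.2.1 * prodAbs w.2.2.2)⁻¹ *
      Real.exp (-(2 * Real.pi * τ.im * energy p w.1 w.2)) : ℝ) : ℂ) * (phase τ w.1 w.2 *
        Complex.exp (2 * Real.pi * Complex.I * ((total w.2.1 * p.1 + total w.2.2.1 * p.2 +
          total w.2.2.2 * (p.1 - p.2)) * τ.re)))) *
      (Complex.exp (2 * Real.pi * Complex.I * ((total w.2.1 + total w.2.2.2 : ℤ) * s.1)) *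
        Complex.exp (2 * Real.pi * Complex.I * ((total w.2.2.1 - total w.2.2.2 : ℤ) * s.2))) := by
    intro w s
    simp only [F, prod_waveTerm]
    have e1 : (((prodAbs w.2.1 * prodAbs w.2.2.1 * prodAbs w.2.2.2)⁻¹ *
        Real.exp (-(2 * Real.pi * τ.im * energy p w.1 w.2)) : ℝ) : ℂ) =
        (((prodAbs w.2.1)⁻¹ *
          Real.exp (-(2 * Real.pi * τ.im * edgeEnergy p.1 w.1.1 w.2.1)) : ℝ) : ℂ) *
        ((((prodAbs w.2.2.1)⁻¹ *
          Real.exp (-(2 * Real.pi * τ.im * edgeEnergy p.2 w.1.2.1 w.2.2.1)) : ℝ) : ℂ) *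
        (((prodAbs w.2.2.2)⁻¹ *
          Real.exp (-(2 * Real.pi * τ.im * edgeEnergy (p.1 - p.2) w.1.2.2 w.2.2.2)) : ℝ) : ℂ)) := by
      rw [← Complex.ofReal_mul, ← Complex.ofReal_mul]
      congr 1
      have : Real.exp (-(2 * Real.pi * τ.im * energy p w.1 w.2)) =
          Real.exp (-(2 * Real.pi * τ.im * edgeEnergy p.1 w.1.1 w.2.1)) *
          Real.exp (-(2 * Real.pi * τ.im * edgeEnergy p.2 w.1.2.1 w.2.2.1)) *
          Real.exp (-(2 * Real.pi * τ.im * edgeEnergy (p.1 - p.2) w.1.2.2 w.2.2.2)) := by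
        rw [← Real.exp_add, ← Real.exp_add, energy]
        congr 1
        ring
      rw [this, mul_inv, mul_inv]
      ring
    have e2 : phase τ w.1 w.2 *
        Complex.exp (2 * Real.pi * Complex.I * ((total w.2.1 * p.1 + total w.2.2.1 * p.2 +
          total w.2.2.2 * (p.1 - p.2)) * τ.re)) *
      (Complex.exp (2 * Real.pi * Complex.I * ((total w.2.1 + total w.2.2.2 : ℤ) * s.1)) *
        Complex.exp (2 * Real.pi * Complex.I * ((total w.2.2.1 - total w.2.2.2 : ℤ) * s.2))) =
      (Complex.exp (2 * Real.pi * Complex.I *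
          ((edgePairing w.1.1 w.2.1 + total w.2.1 * p.1) * τ.re)) *
          Complex.exp (2 * Real.pi * Complex.I * (total w.2.1 * s.1))) *
      ((Complex.exp (2 * Real.pi * Complex.I *
          ((edgePairing w.1.2.1 w.2.2.1 + total w.2.2.1 * p.2) * τ.re)) *
          Complex.exp (2 * Real.pi * Complex.I * (total w.2.2.1 * s.2))) *
      (Complex.exp (2 * Real.pi * Complex.I *
          ((edgePairing w.1.2.2 w.2.2.2 + total w.2.2.2 * ((p.1 - p.2 : ℝ) : ℂ)) * τ.re)) *
          Complex.exp (2 * Real.pi * Complex.I * (total w.2.2.2 * ((s.1 - s.2 : ℝ) : ℂ))))) := by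
      simp only [phase, ← Complex.exp_add]
      congr 1
      simp only [pairing]
      push_cast
      ring
    rw [e1, mul_assoc _ (phase τ w.1 w.2 * _), e2]
    ring
  -- absolute convergence at one point `s` gives termwise integrability, as the norms of the modes
  -- are independent of `s`
  have hnorm : ∀ w s, ‖F w s‖ = ‖F w 0‖ := by
    intro w s
    rw [hF, hF, norm_mul, norm_mul _ (Complex.exp _ * _)]
    congr 1
    rw [norm_mul, norm_mul, Complex.norm_exp, Complex.norm_exp, Complex.norm_exp, Complex.norm_exp]
    simp
  have hcont : ∀ w, Continuous (F w) := by
    intro w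
    have : F w = _ := funext (hF w)
    rw [this]
    fun_prop
  have hint : ∀ w, Integrable (F w) squareMeas := fun w =>
    Integrable.of_bound (hcont w).aestronglyMeasurable ‖F w 0‖ (ae_of_all _ fun s => (hnorm w s).le)
  have hsn : Summable fun w => ∫ s, ‖F w s‖ ∂squareMeas := by
    simp_rw [hnorm]
    refine (hsum 0).2.congr fun w => ?_
    rw [integral_const, probReal_univ, one_smul]
  have key := hasSum_integral_of_summable_integral_norm hint hsn
  simp_rw [fun s => (hsum s).1.tsum_eq] at key
  rw [integral_complex_ofReal] at key
  refine key.congr_fun fun w => ?_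
  simp_rw [hF]
  rw [integral_const_mul, squareMeas, integral_prod_mul
    (fun x : ℝ => Complex.exp (2 * Real.pi * Complex.I * ((total w.2.1 + total w.2.2.2 : ℤ) * x)))
    (fun x : ℝ =>
      Complex.exp (2 * Real.pi * Complex.I * ((total w.2.2.1 - total w.2.2.2 : ℤ) * x))),
    integral_unitMeas_exp, integral_unitMeas_exp, balancedWeight]
  by_cases hA : total w.2.1 + total w.2.2.2 = 0
  · by_cases hB : total w.2.2.1 - total w.2.2.2 = 0
    · have hz : (total w.2.1 : ℂ) * p.1 + total w.2.2.1 * p.2 +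
          total w.2.2.2 * (p.1 - p.2) = 0 := by
        -- for balanced frequencies the dependence on `Re τ` through `r₁, r₂` cancels
        have hA' : (total w.2.1 : ℂ) + total w.2.2.2 = 0 := by exact_mod_cast hA
        have hB' : (total w.2.2.1 : ℂ) - total w.2.2.2 = 0 := by exact_mod_cast hB
        linear_combination p.1 * hA' + p.2 * hB'
      rw [hz]
      simp [hA, hB]
    · simp [hB]
  · simp [hA]

/-! ### Integration over the simplex and the exponentially small modes -/

theorem edgeEnergy_nonneg {j : ℕ} (r : ℝ) (n : Fin j → ℤ) (m : Fin j → {z : ℤ // z ≠ 0}) :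
    0 ≤ edgeEnergy r n m := Finset.sum_nonneg fun _ _ => by positivity

theorem energy_nonneg {a b c : ℕ} (p : ℝ × ℝ) (n : Wind a b c) (m : Freq a b c) :
    0 ≤ energy p n m :=
  add_nonneg (add_nonneg (edgeEnergy_nonneg _ _ _) (edgeEnergy_nonneg _ _ _))
    (edgeEnergy_nonneg _ _ _)

theorem continuous_energy {a b c : ℕ} (n : Wind a b c) (m : Freq a b c) :
    Continuous fun p => energy p n m := by
  unfold energy edgeEnergy
  fun_prop

theorem balancedWeight_nonneg {a b c : ℕ} (m : Freq a b c) : 0 ≤ balancedWeight m := by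
  rw [balancedWeight]
  split_ifs
  · have := prodAbs_pos m.1
    have := prodAbs_pos m.2.1
    have := prodAbs_pos m.2.2
    positivity
  · exact le_rfl

/-- The average of a Fourier mode over the simplex, with a weight `q`. -/
noncomputable def modeIntegral {a b c : ℕ} (q : ℝ × ℝ → ℝ) (y : ℝ) (n : Wind a b c)
    (m : Freq a b c) : ℝ :=
  ∫ p, q p * Real.exp (-(2 * y * energy p n m)) ∂orderedMeas

theorem exp_neg_energy_le_one {a b c : ℕ} {y : ℝ} (hy : 0 ≤ y) (p : ℝ × ℝ) (n : Wind a b c)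
    (m : Freq a b c) : Real.exp (-(2 * y * energy p n m)) ≤ 1 := by
  rw [Real.exp_le_one_iff]
  have := energy_nonneg p n m
  have : 0 ≤ 2 * y * energy p n m := by positivity
  linarith

theorem integrable_exp_neg_energy {a b c : ℕ} {y : ℝ} (hy : 0 ≤ y) (n : Wind a b c)
    (m : Freq a b c) : Integrable (fun p => Real.exp (-(2 * y * energy p n m))) orderedMeas := by
  have hc := continuous_energy n m
  refine Integrable.of_bound (C := 1) (Continuous.aestronglyMeasurable (by fun_prop))
    (ae_of_all _ fun p => ?_)
  rw [Real.norm_eq_abs, Real.abs_exp]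
  exact exp_neg_energy_le_one hy p n m

theorem integrable_mul_exp_neg_energy {a b c : ℕ} {q : ℝ × ℝ → ℝ} (hq : Measurable q)
    (hq1 : ∀ p ∈ orderedPairs, |q p| ≤ 1) {y : ℝ} (hy : 0 ≤ y) (n : Wind a b c)
    (m : Freq a b c) :
    Integrable (fun p => q p * Real.exp (-(2 * y * energy p n m))) orderedMeas := by
  refine (integrable_exp_neg_energy hy n m).bdd_mul (c := 1) hq.aestronglyMeasurable ?_
  filter_upwards [ae_mem_orderedPairs] with p hp
  exact hq1 p hp

theorem modeIntegral_one_nonneg {a b c : ℕ} (y : ℝ) (n : Wind a b c) (m : Freq a b c) :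
    0 ≤ modeIntegral (fun _ => 1) y n m :=
  integral_nonneg fun p => by positivity

theorem abs_modeIntegral_le {a b c : ℕ} {q : ℝ × ℝ → ℝ}
    (hq1 : ∀ p ∈ orderedPairs, |q p| ≤ 1) {y : ℝ} (hy : 0 ≤ y) (n : Wind a b c)
    (m : Freq a b c) : |modeIntegral q y n m| ≤ modeIntegral (fun _ => 1) y n m := by
  rw [modeIntegral, modeIntegral, ← Real.norm_eq_abs]
  refine norm_integral_le_of_norm_le ?_ ?_
  · simpa using integrable_exp_neg_energy hy n m
  · filter_upwards [ae_mem_orderedPairs] with p hp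
    rw [norm_mul, Real.norm_eq_abs, Real.norm_eq_abs, Real.abs_exp]
    exact mul_le_mul_of_nonneg_right (hq1 p hp) (Real.exp_pos _).le

/-- For purely imaginary `τ` all phases are `1`, so that the Fourier expansion is a series of
non-negative functions, and Tonelli's theorem applies to it. -/
theorem summable_modeIntegral {a b c : ℕ} {T : ℝ} (hT : 0 < T) :
    Summable fun w : Wind a b c × Freq a b c =>
      balancedWeight w.2 * modeIntegral (fun _ => 1) (Real.pi * T) w.1 w.2 := by
  set τ : ℂ := T * Complex.I with hτdef
  have him : τ.im = T := by simp [hτdef]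
  have hre : τ.re = 0 := by simp [hτdef]
  have hτ : 0 < τ.im := him ▸ hT
  let f : Wind a b c × Freq a b c → ℝ × ℝ → ℝ := fun w p =>
    balancedWeight w.2 * Real.exp (-(2 * (Real.pi * T) * energy p w.1 w.2))
  have hf0 : ∀ w p, 0 ≤ f w p := fun w p => mul_nonneg (balancedWeight_nonneg _) (Real.exp_pos _).le
  have hfc : ∀ w, Continuous (f w) := fun w => by
    have := continuous_energy w.1 w.2
    fun_prop
  have hsum : ∀ p ∈ orderedPairs,
      HasSum (fun w => f w p) (∫ s, fluctProd τ a b c p s ∂squareMeas) := by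
    intro p hp
    have h := hasSum_integral_fluctProd hτ a b c hp
    rw [← Complex.hasSum_ofReal]
    refine h.congr_fun fun w => ?_
    rw [phase, hre, him]
    simp only [f]
    simp [mul_assoc]
  have hint : Integrable (fun p => ∫ s, fluctProd τ a b c p s ∂squareMeas) orderedMeas :=
    (allLp_fluctProd hτ a b c).integrable.integral_prod_left
  have hfin : ∑' w, ∫⁻ p, ENNReal.ofReal (f w p) ∂orderedMeas ≠ ∞ := by
    rw [← lintegral_tsum fun w => (hfc w).measurable.ennreal_ofReal.aemeasurable]
    have e : ∫⁻ p, ∑' w, ENNReal.ofReal (f w p) ∂orderedMeas =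
        ∫⁻ p, ENNReal.ofReal (∫ s, fluctProd τ a b c p s ∂squareMeas) ∂orderedMeas := by
      refine lintegral_congr_ae ?_
      filter_upwards [ae_mem_orderedPairs] with p hp
      rw [← (hsum p hp).tsum_eq, ENNReal.ofReal_tsum_of_nonneg (fun w => hf0 w p)
        (hsum p hp).summable]
    rw [e]
    exact hint.lintegral_lt_top.ne
  refine (ENNReal.summable_toReal hfin).congr fun w => ?_
  rw [← integral_eq_lintegral_of_nonneg_ae (ae_of_all _ (hf0 w)) (hfc w).aestronglyMeasurable,
    modeIntegral, ← integral_const_mul]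
  simp only [one_mul, f]

/-- The integral of a product of fluctuations, weighted by a function of `(r₁,r₂)`, over
`0 < r₂ < r₁ < 1`. -/
noncomputable def sectorIntegral (q : ℝ × ℝ → ℝ) (a b c : ℕ) (τ : ℂ) : ℝ :=
  ∫ x, q x.1 * fluctProd τ a b c x.1 x.2 ∂orderedMeas.prod squareMeas

/-- The Fourier expansion may be integrated termwise for every `τ`, since the sum of the absolute
values of the modes depends on `Im τ` only. -/
theorem hasSum_sectorIntegral {q : ℝ × ℝ → ℝ} (hq : Measurable q)
    (hq1 : ∀ p ∈ orderedPairs, |q p| ≤ 1) (a b c : ℕ) {τ : ℂ} (hτ : 0 < τ.im) :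
    HasSum (fun w : Wind a b c × Freq a b c =>
        ((balancedWeight w.2 * modeIntegral q (Real.pi * τ.im) w.1 w.2 : ℝ) : ℂ) *
          phase τ w.1 w.2) (sectorIntegral q a b c τ : ℂ) := by
  have hy : 0 ≤ Real.pi * τ.im := (mul_pos Real.pi_pos hτ).le
  let F : Wind a b c × Freq a b c → ℝ × ℝ → ℂ := fun w p =>
    (balancedWeight w.2 * (q p * Real.exp (-(2 * (Real.pi * τ.im) * energy p w.1 w.2))) : ℝ) *
      phase τ w.1 w.2
  have hFi : ∀ w, Integrable (F w) orderedMeas := fun w =>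
    (((integrable_mul_exp_neg_energy hq hq1 hy w.1 w.2).const_mul _).ofReal).mul_const _
  have hFn : ∀ w, ∫ p, ‖F w p‖ ∂orderedMeas ≤
      balancedWeight w.2 * modeIntegral (fun _ => 1) (Real.pi * τ.im) w.1 w.2 := by
    intro w
    rw [modeIntegral, ← integral_const_mul]
    refine integral_mono_ae (hFi w).norm ?_ ?_
    · simpa using (integrable_exp_neg_energy hy w.1 w.2).const_mul (balancedWeight w.2)
    · filter_upwards [ae_mem_orderedPairs] with p hp
      simp only [F]
      rw [norm_mul, norm_phase, mul_one, Complex.norm_real, norm_mul, norm_mul,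
        Real.norm_of_nonneg (balancedWeight_nonneg _), Real.norm_of_nonneg (Real.exp_pos _).le,
        Real.norm_eq_abs]
      have := hq1 p hp
      have := balancedWeight_nonneg w.2
      gcongr
  have key := hasSum_integral_of_summable_integral_norm hFi
    (Summable.of_nonneg_of_le (fun w => integral_nonneg fun _ => norm_nonneg _) hFn
      (summable_modeIntegral hτ))
  have hval : ∫ p, (∑' w, F w p) ∂orderedMeas = (sectorIntegral q a b c τ : ℂ) := by
    have hI : Integrable (fun x : (ℝ × ℝ) × (ℝ × ℝ) => q x.1 * fluctProd τ a b c x.1 x.2)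
        (orderedMeas.prod squareMeas) := by
      refine (allLp_fluctProd hτ a b c).integrable.bdd_mul (c := 1)
        (hq.comp measurable_fst).aestronglyMeasurable ?_
      have : ∀ᵐ x ∂orderedMeas.prod squareMeas, x.1 ∈ orderedPairs :=
        Measure.quasiMeasurePreserving_fst.ae ae_mem_orderedPairs
      filter_upwards [this] with x hx
      exact hq1 _ hx
    rw [sectorIntegral, integral_prod _ hI, ← integral_complex_ofReal]
    refine integral_congr_ae ?_
    filter_upwards [ae_mem_orderedPairs] with p hp
    rw [integral_const_mul]
    have h := (hasSum_integral_fluctProd hτ a b c hp).mul_left (q p : ℂ)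
    push_cast at h ⊢
    rw [← h.tsum_eq]
    refine tsum_congr fun w => ?_
    simp only [F]
    push_cast
    ring_nf
  rw [hval] at key
  refine key.congr_fun fun w => ?_
  simp only [F]
  rw [integral_mul_const, integral_complex_ofReal, integral_const_mul, modeIntegral]

/-- The winding numbers of the modes whose energy vanishes at a vertex of the simplex: at `(0,0)`,
`(1,1)` and `(1,0)`, in this order. -/
def slowModes (a b c : ℕ) : Finset (Wind a b c) :=
  {(fun _ => 0, fun _ => 0, fun _ => 0), (fun _ => -1, fun _ => -1, fun _ => 0),
    (fun _ => -1, fun _ => 0, fun _ => -1)}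

/-- As `0 < r < 1`, the function `|n + r|` is the linear interpolation of `|n|` and `|n + 1|`. -/
theorem le_edgeEnergy {j : ℕ} {r : ℝ} (h0 : 0 < r) (h1 : r < 1) (n : Fin j → ℤ)
    (m : Fin j → {z : ℤ // z ≠ 0}) :
    ((∑ i, |n i + 1| : ℤ) : ℝ) * r + ((∑ i, |n i| : ℤ) : ℝ) * (1 - r) ≤ edgeEnergy r n m := by
  rw [edgeEnergy]
  push_cast
  rw [Finset.sum_mul, Finset.sum_mul, ← Finset.sum_add_distrib]
  refine Finset.sum_le_sum fun i _ => ?_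
  have e : |(n i : ℝ) + 1| * r + |(n i : ℝ)| * (1 - r) = |(n i : ℝ) + r| := by
    rcases le_or_gt 0 (n i) with hn | hn
    · have : (0 : ℝ) ≤ n i := by exact_mod_cast hn
      rw [abs_of_nonneg (by linarith), abs_of_nonneg this, abs_of_nonneg (by linarith)]
      ring
    · have : (n i : ℝ) ≤ -1 := by exact_mod_cast (by omega : n i ≤ -1)
      rw [abs_of_nonpos (by linarith), abs_of_nonpos (by linarith), abs_of_nonpos (by linarith)]
      ring
  rw [e]
  exact le_mul_of_one_le_left (abs_nonneg _) (one_le_abs_intCast _)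

/-- The energy is at least a convex combination, with weights `1 - r₁`, `r₂` and `r₁ - r₂`, of three
natural numbers, one for each vertex. Such a number vanishes only for the slow modes of its
vertex. -/
theorem one_le_energy {a b c : ℕ} {p : ℝ × ℝ} (hp : p ∈ orderedPairs) {n : Wind a b c}
    (hn : n ∉ slowModes a b c) (m : Freq a b c) : 1 ≤ energy p n m := by
  obtain ⟨⟨h1, h1'⟩, ⟨h2, h2'⟩, h3, h3'⟩ := orderedPairs_mem_Ioo hp
  have e1 := le_edgeEnergy h1 h1' n.1 m.1
  have e2 := le_edgeEnergy h2 h2' n.2.1 m.2.1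
  have e3 := le_edgeEnergy h3 h3' n.2.2 m.2.2
  have z0 : ∀ {j : ℕ} (v : Fin j → ℤ), 0 ≤ ∑ i, |v i| ∧ (∑ i, |v i| = 0 → v = fun _ => 0) := by
    intro j v
    refine ⟨Finset.sum_nonneg fun _ _ => abs_nonneg _, fun h => funext fun i => ?_⟩
    rw [Finset.sum_eq_zero_iff_of_nonneg fun _ _ => abs_nonneg _] at h
    exact abs_eq_zero.1 (h i (Finset.mem_univ i))
  have z1 : ∀ {j : ℕ} (v : Fin j → ℤ),
      0 ≤ ∑ i, |v i + 1| ∧ (∑ i, |v i + 1| = 0 → v = fun _ => -1) := by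
    intro j v
    refine ⟨(z0 fun i => v i + 1).1, fun h => funext fun i => ?_⟩
    have := congrFun ((z0 fun i => v i + 1).2 h) i
    omega
  obtain ⟨p1, q1⟩ := z0 n.1
  obtain ⟨p2, q2⟩ := z0 n.2.1
  obtain ⟨p3, q3⟩ := z0 n.2.2
  obtain ⟨p1', q1'⟩ := z1 n.1
  obtain ⟨p2', q2'⟩ := z1 n.2.1
  obtain ⟨p3', q3'⟩ := z1 n.2.2
  simp only [slowModes, Finset.mem_insert, Finset.mem_singleton, not_or] at hn
  obtain ⟨n1, n2, n3⟩ := hn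
  set S₁ := ∑ i, |n.1 i|
  set S₂ := ∑ i, |n.2.1 i|
  set S₃ := ∑ i, |n.2.2 i|
  set S₁' := ∑ i, |n.1 i + 1|
  set S₂' := ∑ i, |n.2.1 i + 1|
  set S₃' := ∑ i, |n.2.2 i + 1|
  have c1 : 1 ≤ S₁ + S₂ + S₃ := by
    by_contra h
    exact n1 (Prod.ext (q1 (by omega)) (Prod.ext (q2 (by omega)) (q3 (by omega))))
  have c2 : 1 ≤ S₁' + S₂' + S₃ := by
    by_contra h
    exact n2 (Prod.ext (q1' (by omega)) (Prod.ext (q2' (by omega)) (q3 (by omega))))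
  have c3 : 1 ≤ S₁' + S₂ + S₃' := by
    by_contra h
    exact n3 (Prod.ext (q1' (by omega)) (Prod.ext (q2 (by omega)) (q3' (by omega))))
  have c1' : (1 : ℝ) ≤ S₁ + S₂ + S₃ := by exact_mod_cast c1
  have c2' : (1 : ℝ) ≤ S₁' + S₂' + S₃ := by exact_mod_cast c2
  have c3' : (1 : ℝ) ≤ S₁' + S₂ + S₃' := by exact_mod_cast c3
  rw [energy]
  nlinarith [mul_nonneg (sub_nonneg.2 c1') (by linarith : 0 ≤ 1 - p.1),
    mul_nonneg (sub_nonneg.2 c2') h2.le, mul_nonneg (sub_nonneg.2 c3') h3.le]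

/-- An energy of at least `1` allows to split off the factor `exp (-3y/2)` and to keep a convergent
series, with the fixed parameter `y₀`. -/
theorem modeIntegral_one_le {a b c : ℕ} {y₀ y : ℝ} (hy₀ : 0 ≤ y₀) (hy : 4 * y₀ ≤ y)
    {n : Wind a b c} (hn : n ∉ slowModes a b c) (m : Freq a b c) :
    modeIntegral (fun _ => 1) y n m ≤
      Real.exp (-(3 / 2 * y)) * modeIntegral (fun _ => 1) y₀ n m := by
  rw [modeIntegral, modeIntegral, ← integral_const_mul]
  have hy' : 0 ≤ y := by linarith
  refine integral_mono_ae ?_ ?_ ?_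
  · simpa using integrable_exp_neg_energy hy' n m
  · simpa using (integrable_exp_neg_energy hy₀ n m).const_mul _
  · filter_upwards [ae_mem_orderedPairs] with p hp
    have h1 := one_le_energy hp hn m
    rw [one_mul, one_mul, ← Real.exp_add, Real.exp_le_exp]
    nlinarith [mul_nonneg (sub_nonneg.2 hy) (sub_nonneg.2 h1)]

/-- The slow modes with balanced frequencies do not depend on `Re τ`. -/
theorem phase_of_mem_slowModes {a b c : ℕ} (τ : ℂ) {n : Wind a b c} (hn : n ∈ slowModes a b c)
    (m : Freq a b c) : (balancedWeight m : ℂ) * phase τ n m = balancedWeight m := by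
  rw [balancedWeight]
  split_ifs with h
  swap
  · simp
  have : pairing n m = 0 := by
    simp only [slowModes, Finset.mem_insert, Finset.mem_singleton] at hn
    simp only [total] at h
    rcases hn with rfl | rfl | rfl <;>
      simp only [pairing, edgePairing, mul_zero, mul_neg, mul_one, Finset.sum_neg_distrib,
        Finset.sum_const_zero] <;> omega
  simp [phase, this]

/-- Up to an exponentially small error, only the slow modes contribute to `sectorIntegral`. -/
theorem exists_abs_sectorIntegral_sub_le {q : ℝ × ℝ → ℝ} (hq : Measurable q)
    (hq1 : ∀ p ∈ orderedPairs, |q p| ≤ 1) (a b c : ℕ) :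
    ∃ C : ℝ, ∀ τ : ℂ, 4 ≤ τ.im →
      |sectorIntegral q a b c τ - ∑ n ∈ slowModes a b c, ∑' m : Freq a b c,
          balancedWeight m * modeIntegral q (Real.pi * τ.im) n m| ≤
        C * Real.exp (-(3 / 2 * (Real.pi * τ.im))) := by
  have hZ := summable_modeIntegral (a := a) (b := b) (c := c) (T := 1) one_pos
  refine ⟨∑' w : Wind a b c × Freq a b c,
      balancedWeight w.2 * modeIntegral (fun _ => 1) (Real.pi * 1) w.1 w.2, fun τ h4 => ?_⟩
  have hτ : 0 < τ.im := by linarith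
  set y := Real.pi * τ.im with hy
  have hy0 : 0 ≤ y := (mul_pos Real.pi_pos hτ).le
  have hy4 : 4 * (Real.pi * 1) ≤ y := by nlinarith [Real.pi_pos]
  have hS := hasSum_sectorIntegral hq hq1 a b c hτ
  let G : Wind a b c × Freq a b c → ℂ := fun w =>
    ((balancedWeight w.2 * modeIntegral q y w.1 w.2 : ℝ) : ℂ) * phase τ w.1 w.2
  have hG : Summable G := hS.summable
  have hGs : ∀ n ∈ slowModes a b c, ∑' m, G (n, m) =
      ((∑' m : Freq a b c, balancedWeight m * modeIntegral q y n m : ℝ) : ℂ) := by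
    intro n hn
    rw [Complex.ofReal_tsum]
    refine tsum_congr fun m => ?_
    simp only [G]
    push_cast
    rw [mul_right_comm, phase_of_mem_slowModes τ hn]
  let H : Wind a b c × Freq a b c → ℂ := fun w => if w.1 ∈ slowModes a b c then G w else 0
  have hH : Summable H := by
    refine Summable.of_norm_bounded hG.norm fun w => ?_
    simp only [H]
    split_ifs
    · exact le_rfl
    · simp
  have hHt : ∑' w, H w = ((∑ n ∈ slowModes a b c, ∑' m : Freq a b c,
      balancedWeight m * modeIntegral q y n m : ℝ) : ℂ) := by
    rw [hH.tsum_prod, tsum_eq_sum (s := slowModes a b c)]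
    · push_cast
      refine Finset.sum_congr rfl fun n hn => ?_
      have := hGs n hn
      push_cast at this
      rw [← this]
      simp [H, hn]
    · intro n hn
      simp [H, hn]
  have hdiff := (hS.sub hH.hasSum).tsum_eq
  rw [hHt, ← Complex.ofReal_sub] at hdiff
  rw [← Real.norm_eq_abs, ← Complex.norm_real, ← hdiff, ← tsum_mul_right]
  refine tsum_of_norm_bounded (hZ.mul_right _).hasSum fun w => ?_
  have hb := balancedWeight_nonneg w.2
  by_cases hw : w.1 ∈ slowModes a b c
  · simp only [H, hw, if_true, G]
    rw [← hy, sub_self, norm_zero]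
    exact mul_nonneg (mul_nonneg hb (modeIntegral_one_nonneg _ _ _)) (Real.exp_pos _).le
  · simp only [H, hw, if_false, sub_zero]
    rw [norm_mul, norm_phase, mul_one, Complex.norm_real, norm_mul, Real.norm_of_nonneg hb,
      Real.norm_eq_abs, mul_assoc, mul_comm (modeIntegral _ _ _ _)]
    refine mul_le_mul_of_nonneg_left ?_ hb
    exact (abs_modeIntegral_le hq1 hy0 _ _).trans
      (modeIntegral_one_le (by positivity) hy4 hw _)

/-! ### Laplace integrals over the simplex -/

/-- The sum of the monomials `q y^{-(α+β)} A^{-α} B^{-β}` given by a list of triples `(q, α, β)`. -/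
noncomputable def expansion (L : List (ℚ × ℕ × ℕ)) (y A B : ℝ) : ℝ :=
  (L.map fun t => (t.1 : ℝ) / (y ^ (t.2.1 + t.2.2) * (A ^ t.2.1 * B ^ t.2.2))).sum

/-- The value of a rate of decay: it vanishes if `s` is false, and is at least `1` otherwise. -/
def IsRate (s : Bool) (A : ℝ) : Prop := (s = true → 1 ≤ A) ∧ (s = false → A = 0)

/-- `F y A B` agrees with an expansion in `1/y, 1/A, 1/B` with rational coefficients up to an
exponentially small error that is uniform in the rates `A` and `B`. -/
def HasExpansion (s t : Bool) (F : ℝ → ℝ → ℝ → ℝ) : Prop :=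
  ∃ (L : List (ℚ × ℕ × ℕ)) (C : ℝ), ∀ y A B : ℝ, 1 ≤ y → IsRate s A → IsRate t B →
    |F y A B - expansion L y A B| ≤ C * Real.exp (-(3 / 2 * y))

theorem HasExpansion.add {s t : Bool} {F G : ℝ → ℝ → ℝ → ℝ} (hF : HasExpansion s t F)
    (hG : HasExpansion s t G) : HasExpansion s t fun y A B => F y A B + G y A B := by
  obtain ⟨L, C, h⟩ := hF
  obtain ⟨L', C', h'⟩ := hG
  refine ⟨L ++ L', C + C', fun y A B hy hA hB => ?_⟩
  have e : expansion (L ++ L') y A B = expansion L y A B + expansion L' y A B := by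
    simp [expansion]
  rw [e, add_sub_add_comm, add_mul]
  exact (abs_add_le _ _).trans (add_le_add (h y A B hy hA hB) (h' y A B hy hA hB))

theorem HasExpansion.smul {s t : Bool} {F : ℝ → ℝ → ℝ → ℝ} (hF : HasExpansion s t F) (q : ℚ) :
    HasExpansion s t fun y A B => q * F y A B := by
  obtain ⟨L, C, h⟩ := hF
  refine ⟨L.map fun x => (q * x.1, x.2), |(q : ℝ)| * C, fun y A B hy hA hB => ?_⟩
  have e : expansion (L.map fun x => (q * x.1, x.2)) y A B = q * expansion L y A B := by
    simp only [expansion, List.map_map, ← List.sum_map_mul_left]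
    congr 1
    refine List.map_congr_left fun x _ => ?_
    simp only [Function.comp_apply]
    push_cast
    rw [mul_div_assoc]
  rw [e, ← mul_sub, abs_mul, mul_assoc]
  exact mul_le_mul_of_nonneg_left (h y A B hy hA hB) (abs_nonneg _)

theorem HasExpansion.congr {s t : Bool} {F G : ℝ → ℝ → ℝ → ℝ} (hF : HasExpansion s t F)
    (h : ∀ y A B : ℝ, 1 ≤ y → IsRate s A → IsRate t B → G y A B = F y A B) :
    HasExpansion s t G := by
  obtain ⟨L, C, hL⟩ := hF
  exact ⟨L, C, fun y A B hy hA hB => by rw [h y A B hy hA hB]; exact hL y A B hy hA hB⟩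

theorem HasExpansion.swap {s t : Bool} {F : ℝ → ℝ → ℝ → ℝ} (hF : HasExpansion s t F) :
    HasExpansion t s fun y A B => F y B A := by
  obtain ⟨L, C, h⟩ := hF
  refine ⟨L.map fun x => (x.1, x.2.2, x.2.1), C, fun y A B hy hA hB => ?_⟩
  have e : expansion (L.map fun x => (x.1, x.2.2, x.2.1)) y A B = expansion L y B A := by
    simp only [expansion, List.map_map]
    congr 1
    refine List.map_congr_left fun x _ => ?_
    simp only [Function.comp_apply]
    rw [add_comm, mul_comm (A ^ _)]
  rw [e]
  exact h y B A hy hB hA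

theorem integral_pow_mul_exp_neg (n : ℕ) {c : ℝ} (hc : 0 < c) :
    ∫ u in Set.Ioi (0 : ℝ), u ^ n * Real.exp (-(c * u)) = n.factorial / c ^ (n + 1) := by
  have h := Real.integral_rpow_mul_exp_neg_mul_Ioi (a := n + 1) (by positivity) hc
  rw [Real.Gamma_nat_eq_factorial] at h
  have e : (1 / c) ^ ((n : ℝ) + 1) = (c ^ (n + 1))⁻¹ := by
    rw [← Nat.cast_succ, Real.rpow_natCast, one_div, inv_pow]
  rw [e, inv_mul_eq_div] at h
  simpa using h

theorem integrableOn_pow_mul_exp_neg (n : ℕ) {c : ℝ} (hc : 0 < c) :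
    IntegrableOn (fun u : ℝ => u ^ n * Real.exp (-(c * u))) (Set.Ioi 0) := by
  refine not_imp_comm.1 integral_undef ?_
  rw [integral_pow_mul_exp_neg n hc]
  positivity

theorem hasExpansion_monomial_segment (s t : Bool) (n : ℕ) :
    HasExpansion s t fun y A _ =>
      ∫ u in Set.Ioo (0 : ℝ) 1, u ^ n * Real.exp (-(2 * y * A * u)) := by
  cases s
  · refine ⟨[(1 / (n + 1), 0, 0)], 0, fun y A B hy hA hB => ?_⟩
    rw [hA.2 rfl]
    have : ∫ u in Set.Ioo (0 : ℝ) 1, u ^ n = 1 / (n + 1) := by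
      rw [← integral_Ioc_eq_integral_Ioo, ← intervalIntegral.integral_of_le zero_le_one,
        integral_pow]
      simp
    simp only [mul_zero, zero_mul, neg_zero, Real.exp_zero, mul_one, this]
    simp [expansion]
  · refine ⟨[(n.factorial / 2 ^ (n + 1), n + 1, 0)],
      ∫ u in Set.Ioi (0 : ℝ), u ^ n * Real.exp (-(1 / 2 * u)), fun y A B hy hA hB => ?_⟩
    have hA1 := hA.1 rfl
    have hc : 0 < 2 * y * A := by positivity
    -- the main term is the integral over the half-line, and the error the integral over `[1, ∞)`
    have e : expansion [((n.factorial / 2 ^ (n + 1) : ℚ), n + 1, 0)] y A B =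
        n.factorial / (2 * y * A) ^ (n + 1) := by
      simp only [expansion, List.map_cons, List.map_nil, List.sum_cons, List.sum_nil]
      push_cast
      rw [mul_pow, mul_pow, div_div]
      simp [mul_assoc]
    have hi := integrableOn_pow_mul_exp_neg n hc
    have hi2 := integrableOn_pow_mul_exp_neg n (c := 1 / 2) (by norm_num)
    have hsub : Set.Ioo (0 : ℝ) 1 ⊆ Set.Ioi 0 := Set.Ioo_subset_Ioi_self
    rw [e, ← integral_pow_mul_exp_neg n hc, abs_sub_comm,
      ← setIntegral_sdiff measurableSet_Ioo hi hsub, ← Real.norm_eq_abs, ← integral_mul_const]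
    have hnn : ∀ u ∈ Set.Ioi (0 : ℝ),
        0 ≤ u ^ n * Real.exp (-(1 / 2 * u)) * Real.exp (-(3 / 2 * y)) := fun u hu => by
      have : 0 < u := hu
      positivity
    refine (norm_integral_le_of_norm_le
      (IntegrableOn.mono_set (hi2.mul_const (Real.exp (-(3 / 2 * y)))) Set.sdiff_subset) ?_).trans
      (setIntegral_mono_set (hi2.mul_const _) ?_ (Eventually.of_forall Set.sdiff_subset))
    · refine (ae_restrict_iff' (measurableSet_Ioi.diff measurableSet_Ioo)).2
        (ae_of_all _ fun u hu => ?_)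
      obtain ⟨hu0, hu1⟩ := hu
      have hu0 : 0 < u := hu0
      have hu1 : 1 ≤ u := by
        by_contra h
        exact hu1 ⟨hu0, not_le.1 h⟩
      rw [norm_mul, Real.norm_of_nonneg (by positivity), Real.norm_of_nonneg (Real.exp_pos _).le,
        mul_assoc (u ^ n), ← Real.exp_add]
      refine mul_le_mul_of_nonneg_left (Real.exp_le_exp.2 ?_) (by positivity)
      have h1 : y * u ≤ y * A * u := by nlinarith [mul_nonneg (by linarith : 0 ≤ y) hu0.le]
      nlinarith
    · exact (ae_restrict_iff' measurableSet_Ioi).2 (ae_of_all _ hnn)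

theorem hasExpansion_segment (s t : Bool) (P : Polynomial ℚ) :
    HasExpansion s t fun y A _ =>
      ∫ u in Set.Ioo (0 : ℝ) 1, P.aeval u * Real.exp (-(2 * y * A * u)) := by
  have hi : ∀ (P : Polynomial ℚ) (c : ℝ),
      IntegrableOn (fun u : ℝ => P.aeval u * Real.exp (-(c * u))) (Set.Ioo 0 1) := fun P c => by
    have : Continuous fun u : ℝ => P.aeval u * Real.exp (-(c * u)) :=
      P.continuous_aeval.mul (by fun_prop)
    exact (this.integrableOn_Icc (a := 0) (b := 1)).mono_set Set.Ioo_subset_Icc_self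
  induction P using Polynomial.induction_on' with
  | add P Q hP hQ =>
    refine (hP.add hQ).congr fun y A B _ _ _ => ?_
    rw [← integral_add (hi P _) (hi Q _)]
    simp only [map_add, add_mul]
  | monomial n q =>
    refine ((hasExpansion_monomial_segment s t n).smul q).congr fun y A B _ _ _ => ?_
    rw [← integral_const_mul]
    simp [Polynomial.aeval_monomial, mul_assoc]

/-- The simplex `u, v > 0`, `u + v < 1`. -/
def cornerSimplex : Set (ℝ × ℝ) := {x | 0 < x.1 ∧ 0 < x.2 ∧ x.1 + x.2 < 1}

theorem measurableSet_cornerSimplex : MeasurableSet cornerSimplex :=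
  (measurableSet_lt measurable_const measurable_fst).inter
    ((measurableSet_lt measurable_const measurable_snd).inter
      (measurableSet_lt (measurable_fst.add measurable_snd) measurable_const))

theorem cornerSimplex_subset : cornerSimplex ⊆ Set.Icc (0 : ℝ × ℝ) 1 := by
  rintro ⟨u, v⟩ ⟨h1, h2, h3⟩
  simp only at h1 h2 h3
  exact ⟨⟨h1.le, h2.le⟩, ⟨by simp only [Prod.fst_one]; linarith,
    by simp only [Prod.snd_one]; linarith⟩⟩

/-- The Laplace integral of a polynomial over the simplex, with rates `2yA` and `2yB`. -/
noncomputable def simplexLaplace (P : MvPolynomial (Fin 2) ℚ) (y A B : ℝ) : ℝ :=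
  ∫ x in cornerSimplex, MvPolynomial.aeval ![x.1, x.2] P * Real.exp (-(2 * y * (A * x.1 + B * x.2)))

theorem integrableOn_cornerSimplex {f : ℝ × ℝ → ℝ} (hf : Continuous f) :
    IntegrableOn f cornerSimplex :=
  (hf.integrableOn_Icc (a := 0) (b := 1)).mono_set cornerSimplex_subset

theorem setIntegral_cornerSimplex {f : ℝ × ℝ → ℝ} (hf : Continuous f) :
    ∫ x in cornerSimplex, f x = ∫ u in Set.Ioo (0 : ℝ) 1, ∫ v in Set.Ioo 0 (1 - u), f (u, v) := by
  have hi := (integrable_indicator_iff measurableSet_cornerSimplex).2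
    (integrableOn_cornerSimplex hf)
  rw [← integral_indicator measurableSet_cornerSimplex, Measure.volume_eq_prod,
    integral_prod _ hi, ← integral_indicator measurableSet_Ioo]
  congr 1
  funext u
  by_cases hu : u ∈ Set.Ioo (0 : ℝ) 1
  · rw [Set.indicator_of_mem hu, ← integral_indicator measurableSet_Ioo]
    congr 1
    funext v
    have : (u, v) ∈ cornerSimplex ↔ v ∈ Set.Ioo 0 (1 - u) := by
      simp only [cornerSimplex, Set.mem_ofPred_eq, Set.mem_Ioo, lt_sub_iff_add_lt', hu.1, true_and]
    by_cases hv : v ∈ Set.Ioo 0 (1 - u)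
    · rw [Set.indicator_of_mem hv, Set.indicator_of_mem (this.2 hv)]
    · rw [Set.indicator_of_notMem hv, Set.indicator_of_notMem (fun h => hv (this.1 h))]
  · rw [Set.indicator_of_notMem hu]
    refine integral_eq_zero_of_ae (ae_of_all _ fun v => Set.indicator_of_notMem (fun h => hu ?_) _)
    obtain ⟨h1, h2, h3⟩ := h
    simp only at h1 h2 h3
    exact ⟨h1, by linarith⟩

theorem setIntegral_cornerSimplex_swap (f : ℝ × ℝ → ℝ) :
    ∫ x in cornerSimplex, f x.swap = ∫ x in cornerSimplex, f x := by
  have h := (Measure.measurePreserving_swap (μ := (volume : Measure ℝ))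
    (ν := (volume : Measure ℝ))).setIntegral_preimage_emb
    MeasurableEquiv.prodComm.measurableEmbedding f cornerSimplex
  rw [← Measure.volume_eq_prod] at h
  rw [← h]
  congr 2
  ext x
  simp only [cornerSimplex, Set.mem_ofPred_eq, Set.mem_preimage, Prod.fst_swap, Prod.snd_swap]
  rw [add_comm]
  tauto

/-- For positive rates the main term is the integral over the quadrant. The error is the integral
over the part `u + v ≥ 1` of the quadrant, where the integrand is at most `exp (-2y)` up to a
factor. -/
theorem hasExpansion_monomial_true_true (i j : ℕ) :
    HasExpansion true true fun y A B => ∫ x in cornerSimplex,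
      x.1 ^ i * x.2 ^ j * Real.exp (-(2 * y * (A * x.1 + B * x.2))) := by
  have hprod : ∀ a b : ℝ, 0 < a → 0 < b →
      IntegrableOn (fun x : ℝ × ℝ => (x.1 ^ i * Real.exp (-(a * x.1))) *
        (x.2 ^ j * Real.exp (-(b * x.2)))) (Set.Ioi 0 ×ˢ Set.Ioi 0) ∧
      ∫ x in Set.Ioi (0 : ℝ) ×ˢ Set.Ioi (0 : ℝ), (x.1 ^ i * Real.exp (-(a * x.1))) *
        (x.2 ^ j * Real.exp (-(b * x.2))) =
        i.factorial / a ^ (i + 1) * (j.factorial / b ^ (j + 1)) := by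
    intro a b ha hb
    constructor
    · rw [IntegrableOn, Measure.volume_eq_prod, ← Measure.prod_restrict]
      exact (integrableOn_pow_mul_exp_neg i ha).mul_prod (integrableOn_pow_mul_exp_neg j hb)
    · rw [Measure.volume_eq_prod, setIntegral_prod_mul (fun u : ℝ => u ^ i * Real.exp (-(a * u)))
        (fun v : ℝ => v ^ j * Real.exp (-(b * v))), integral_pow_mul_exp_neg i ha,
        integral_pow_mul_exp_neg j hb]
  refine ⟨[(i.factorial / 2 ^ (i + 1) * (j.factorial / 2 ^ (j + 1)), i + 1, j + 1)],
    ∫ x in Set.Ioi (0 : ℝ) ×ˢ Set.Ioi (0 : ℝ), (x.1 ^ i * Real.exp (-(1 / 2 * x.1))) *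
      (x.2 ^ j * Real.exp (-(1 / 2 * x.2))), fun y A B hy hA hB => ?_⟩
  have hA1 := hA.1 rfl
  have hB1 := hB.1 rfl
  have ha : 0 < 2 * y * A := by positivity
  have hb : 0 < 2 * y * B := by positivity
  have e : expansion
      [((i.factorial / 2 ^ (i + 1) * (j.factorial / 2 ^ (j + 1)) : ℚ), i + 1, j + 1)] y A B =
        i.factorial / (2 * y * A) ^ (i + 1) * (j.factorial / (2 * y * B) ^ (j + 1)) := by
    simp only [expansion, List.map_cons, List.map_nil, List.sum_cons, List.sum_nil]
    push_cast
    rw [add_zero, div_mul_div_comm, div_mul_div_comm, div_div]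
    congr 1
    ring
  have hf : ∀ x : ℝ × ℝ, x.1 ^ i * x.2 ^ j * Real.exp (-(2 * y * (A * x.1 + B * x.2))) =
      (x.1 ^ i * Real.exp (-(2 * y * A * x.1))) * (x.2 ^ j * Real.exp (-(2 * y * B * x.2))) := by
    intro x
    rw [show -(2 * y * (A * x.1 + B * x.2)) = -(2 * y * A * x.1) + -(2 * y * B * x.2) by ring,
      Real.exp_add]
    ring
  obtain ⟨hi, hval⟩ := hprod _ _ ha hb
  obtain ⟨hi2, -⟩ := hprod (1 / 2) (1 / 2) (by norm_num) (by norm_num)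
  have hsub : cornerSimplex ⊆ Set.Ioi (0 : ℝ) ×ˢ Set.Ioi (0 : ℝ) := fun x hx => ⟨hx.1, hx.2.1⟩
  simp_rw [hf]
  rw [e, ← hval, abs_sub_comm, ← setIntegral_sdiff measurableSet_cornerSimplex hi hsub,
    ← Real.norm_eq_abs, ← integral_mul_const]
  have hq : MeasurableSet (Set.Ioi (0 : ℝ) ×ˢ Set.Ioi (0 : ℝ)) :=
    measurableSet_Ioi.prod measurableSet_Ioi
  refine (norm_integral_le_of_norm_le
    (IntegrableOn.mono_set (hi2.mul_const (Real.exp (-(3 / 2 * y)))) Set.sdiff_subset) ?_).trans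
    (setIntegral_mono_set (hi2.mul_const _) ?_ (Eventually.of_forall Set.sdiff_subset))
  · refine (ae_restrict_iff' (hq.diff measurableSet_cornerSimplex)).2 (ae_of_all _ fun x hx => ?_)
    obtain ⟨⟨hu, hv⟩, hx1⟩ := hx
    have hu : 0 < x.1 := hu
    have hv : 0 < x.2 := hv
    have huv : 1 ≤ x.1 + x.2 := by
      by_contra h
      exact hx1 ⟨hu, hv, not_le.1 h⟩
    have key : Real.exp (-(2 * y * A * x.1)) * Real.exp (-(2 * y * B * x.2)) ≤
        Real.exp (-(1 / 2 * x.1)) * Real.exp (-(1 / 2 * x.2)) * Real.exp (-(3 / 2 * y)) := by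
      rw [← Real.exp_add, ← Real.exp_add, ← Real.exp_add, Real.exp_le_exp]
      have h1 : y * x.1 ≤ y * A * x.1 := by nlinarith [mul_nonneg (by linarith : 0 ≤ y) hu.le]
      have h2 : y * x.2 ≤ y * B * x.2 := by nlinarith [mul_nonneg (by linarith : 0 ≤ y) hv.le]
      nlinarith
    rw [Real.norm_of_nonneg (by positivity)]
    calc _ = x.1 ^ i * x.2 ^ j *
          (Real.exp (-(2 * y * A * x.1)) * Real.exp (-(2 * y * B * x.2))) := by ring
      _ ≤ x.1 ^ i * x.2 ^ j *
          (Real.exp (-(1 / 2 * x.1)) * Real.exp (-(1 / 2 * x.2)) * Real.exp (-(3 / 2 * y))) := by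
          gcongr
      _ = _ := by ring
  · refine (ae_restrict_iff' hq).2 (ae_of_all _ fun x hx => ?_)
    have hu : 0 < x.1 := hx.1
    have hv : 0 < x.2 := hx.2
    simp only [Pi.zero_apply]
    positivity

/-- For `B = 0` the inner integral is elementary, and a segment remains. -/
theorem hasExpansion_monomial_false (s : Bool) (i j : ℕ) :
    HasExpansion s false fun y A B => ∫ x in cornerSimplex,
      x.1 ^ i * x.2 ^ j * Real.exp (-(2 * y * (A * x.1 + B * x.2))) := by
  refine (hasExpansion_segment s false (Polynomial.C (1 / (j + 1) : ℚ) *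
    (Polynomial.X ^ i * (1 - Polynomial.X) ^ (j + 1)))).congr fun y A B _ _ hB => ?_
  rw [setIntegral_cornerSimplex (by fun_prop), hB.2 rfl]
  refine setIntegral_congr_fun measurableSet_Ioo fun u hu => ?_
  have h1 : ∫ v in Set.Ioo 0 (1 - u), v ^ j = (1 - u) ^ (j + 1) / (j + 1) := by
    rw [← integral_Ioc_eq_integral_Ioo, ← intervalIntegral.integral_of_le (by linarith [hu.2]),
      integral_pow]
    simp
  have h2 : ∀ v : ℝ, u ^ i * v ^ j * Real.exp (-(2 * y * (A * u + 0 * v))) =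
      (u ^ i * Real.exp (-(2 * y * A * u))) * v ^ j := by
    intro v
    rw [zero_mul, add_zero, ← mul_assoc (2 * y)]
    ring
  simp only [h2]
  rw [integral_const_mul, h1]
  simp
  ring

theorem hasExpansion_simplexLaplace (s t : Bool) (P : MvPolynomial (Fin 2) ℚ) :
    HasExpansion s t (simplexLaplace P) := by
  have hc : ∀ (P : MvPolynomial (Fin 2) ℚ) (y A B : ℝ), Continuous fun x : ℝ × ℝ =>
      MvPolynomial.aeval ![x.1, x.2] P * Real.exp (-(2 * y * (A * x.1 + B * x.2))) := by
    intro P y A B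
    refine Continuous.mul ?_ (by fun_prop)
    simp_rw [MvPolynomial.aeval_def, ← MvPolynomial.eval_map]
    exact (MvPolynomial.continuous_eval _).comp
      (continuous_pi fun i => by fin_cases i <;> simp <;> fun_prop)
  induction P using MvPolynomial.induction_on' with
  | add P Q hP hQ =>
    refine (hP.add hQ).congr fun y A B _ _ _ => ?_
    simp only [simplexLaplace]
    rw [← integral_add (integrableOn_cornerSimplex (hc P y A B))
      (integrableOn_cornerSimplex (hc Q y A B))]
    simp only [map_add, add_mul]
  | monomial k q =>
    have key : HasExpansion s t fun y A B => ∫ x in cornerSimplex,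
        x.1 ^ k 0 * x.2 ^ k 1 * Real.exp (-(2 * y * (A * x.1 + B * x.2))) := by
      cases t
      · exact hasExpansion_monomial_false s _ _
      cases s
      · refine (hasExpansion_monomial_false true (k 1) (k 0)).swap.congr fun y A B _ _ _ => ?_
        rw [← setIntegral_cornerSimplex_swap]
        congr 1
        funext x
        simp only [Prod.fst_swap, Prod.snd_swap]
        rw [add_comm (A * _), mul_comm (x.2 ^ _)]
      · exact hasExpansion_monomial_true_true _ _
    refine (key.smul q).congr fun y A B _ _ _ => ?_
    rw [simplexLaplace, ← integral_const_mul]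
    congr 1
    funext x
    rw [MvPolynomial.aeval_monomial, Finsupp.prod_fintype _ _ (by simp), Fin.prod_univ_two]
    simp [mul_assoc]

end Modes

section Asymptotics

open MeasureTheory Filter Topology Asymptotics
open scoped ENNReal

/-! ### Laurent polynomials in `π τ₂` up to exponentially small errors -/

/-- The value at `y` of the Laurent polynomial with the given list of coefficients and exponents. -/
noncomputable def monomialSum (L : List (ℝ × ℤ)) (y : ℝ) : ℝ := (L.map fun t => t.1 * y ^ t.2).sum

/-- Up to `O(exp(-κπτ₂))`, the function `f` is a Laurent polynomial in `πτ₂` with coefficients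
in `ℬ`. -/
def HasLaurentPart (κ : ℝ) (f : ℂ → ℝ) : Prop :=
  ∃ L : List (ℝ × ℤ), (∀ t ∈ L, t.1 ∈ conicalAlgebra01) ∧
    (fun τ : ℂ => f τ - monomialSum L (Real.pi * τ.im)) =O[comap Complex.im atTop]
      fun τ : ℂ => Real.exp (-(κ * (Real.pi * τ.im)))

theorem HasLaurentPart.zero (κ : ℝ) : HasLaurentPart κ fun _ => 0 :=
  ⟨[], by simp, by simpa [monomialSum] using isBigO_zero _ _⟩

theorem HasLaurentPart.add {κ : ℝ} {f g : ℂ → ℝ} (hf : HasLaurentPart κ f)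
    (hg : HasLaurentPart κ g) : HasLaurentPart κ fun τ => f τ + g τ := by
  obtain ⟨L, hL, h⟩ := hf
  obtain ⟨L', hL', h'⟩ := hg
  refine ⟨L ++ L', fun t ht => (List.mem_append.1 ht).elim (hL t) (hL' t), ?_⟩
  refine (h.add h').congr_left fun τ => ?_
  simp only [monomialSum, List.map_append, List.sum_append]
  ring

theorem HasLaurentPart.sum {κ : ℝ} {ι : Type*} {f : ι → ℂ → ℝ} (s : Finset ι)
    (h : ∀ i ∈ s, HasLaurentPart κ (f i)) : HasLaurentPart κ fun τ => ∑ i ∈ s, f i τ := by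
  classical
  induction s using Finset.induction_on with
  | empty => simpa using HasLaurentPart.zero κ
  | insert i s hi ih =>
    simp only [Finset.sum_insert hi]
    exact (h i (Finset.mem_insert_self i s)).add (ih fun j hj => h j (Finset.mem_insert_of_mem hj))

theorem HasLaurentPart.smul {κ : ℝ} {f : ℂ → ℝ} (hf : HasLaurentPart κ f) (q : ℚ) :
    HasLaurentPart κ fun τ => q * f τ := by
  obtain ⟨L, hL, h⟩ := hf
  refine ⟨L.map fun t => (q * t.1, t.2), fun t ht => ?_, ?_⟩
  · obtain ⟨t', ht', rfl⟩ := List.mem_map.1 ht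
    simp only
    rw [← Rat.smul_def]
    exact conicalAlgebra01.smul_mem (hL t' ht') q
  · refine (h.const_mul_left (q : ℝ)).congr_left fun τ => ?_
    simp only [monomialSum, List.map_map, mul_sub, ← List.sum_map_mul_left]
    congr 2
    refine List.map_congr_left fun t _ => ?_
    simp only [Function.comp_apply]
    ring

theorem HasLaurentPart.of_sub_isBigO {κ : ℝ} {f g : ℂ → ℝ} (hf : HasLaurentPart κ f)
    (h : (fun τ => g τ - f τ) =O[comap Complex.im atTop]
      fun τ : ℂ => Real.exp (-(κ * (Real.pi * τ.im)))) : HasLaurentPart κ g := by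
  obtain ⟨L, hL, h'⟩ := hf
  exact ⟨L, hL, (h.add h').congr_left fun τ => by ring⟩

theorem HasLaurentPart.congr {κ : ℝ} {f g : ℂ → ℝ} (hf : HasLaurentPart κ f)
    (h : ∀ᶠ τ in comap Complex.im atTop, g τ = f τ) : HasLaurentPart κ g := by
  refine hf.of_sub_isBigO ((isBigO_zero _ _).congr' ?_ EventuallyEq.rfl)
  filter_upwards [h] with τ hτ
  rw [hτ, sub_self]

theorem eventually_im_ge (c : ℝ) : ∀ᶠ τ : ℂ in comap Complex.im atTop, c ≤ τ.im :=
  tendsto_comap.eventually (eventually_ge_atTop c)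

theorem tendsto_pi_mul_im : Tendsto (fun τ : ℂ => Real.pi * τ.im) (comap Complex.im atTop) atTop :=
  tendsto_comap.const_mul_atTop Real.pi_pos

/-- A power of `τ₂` is absorbed by an arbitrarily small loss in the rate of the error. -/
theorem HasLaurentPart.pow_mul {κ κ' : ℝ} (hκ : κ' < κ) {f : ℂ → ℝ} (hf : HasLaurentPart κ f)
    (n : ℕ) : HasLaurentPart κ' fun τ => (Real.pi * τ.im) ^ n * f τ := by
  obtain ⟨L, hL, h⟩ := hf
  refine ⟨L.map fun t => (t.1, t.2 + n), fun t ht => ?_, ?_⟩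
  · obtain ⟨t', ht', rfl⟩ := List.mem_map.1 ht
    exact hL t' ht'
  · have h1 : (fun y : ℝ => y ^ n) =O[atTop] fun y => Real.exp ((κ - κ') * y) :=
      (isLittleO_pow_exp_pos_mul_atTop n (sub_pos.2 hκ)).isBigO
    have h2 := (h1.comp_tendsto tendsto_pi_mul_im).mul h
    refine h2.congr' ?_ ?_
    · filter_upwards [eventually_im_ge 1] with τ hτ
      have hy : Real.pi * τ.im ≠ 0 := (mul_pos Real.pi_pos (by linarith)).ne'
      simp only [Function.comp_apply, monomialSum, List.map_map, mul_sub, ← List.sum_map_mul_left]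
      congr 2
      refine List.map_congr_left fun t _ => ?_
      simp only [Function.comp_apply]
      rw [zpow_add₀ hy, zpow_natCast]
      ring
    · refine Eventually.of_forall fun τ => ?_
      simp only [Function.comp_apply]
      rw [← Real.exp_add]
      congr 1
      ring

/-! ### The contribution of one vertex of the simplex -/

/-- The second Bernoulli polynomial. -/
noncomputable def bern (r : ℝ) : ℝ := r ^ 2 - r + 1 / 6

theorem bern_one_sub (r : ℝ) : bern (1 - r) = bern r := by
  unfold bern
  ring

theorem abs_bern_le {r : ℝ} (h0 : 0 < r) (h1 : r < 1) : |bern r| ≤ 1 := by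
  rw [abs_le, bern]
  constructor <;> nlinarith

/-- The product of second Bernoulli polynomials of the three edges. -/
noncomputable def bernWeight (e₁ e₂ e₃ : ℕ) (p : ℝ × ℝ) : ℝ :=
  bern p.1 ^ e₁ * bern p.2 ^ e₂ * bern (p.1 - p.2) ^ e₃

theorem measurable_bernWeight (e₁ e₂ e₃ : ℕ) : Measurable (bernWeight e₁ e₂ e₃) := by
  have : Continuous (bernWeight e₁ e₂ e₃) := by
    unfold bernWeight bern
    fun_prop
  exact this.measurable

theorem abs_bernWeight_le (e₁ e₂ e₃ : ℕ) : ∀ p ∈ orderedPairs, |bernWeight e₁ e₂ e₃ p| ≤ 1 := by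
  intro p hp
  obtain ⟨⟨h1, h1'⟩, ⟨h2, h2'⟩, h3, h3'⟩ := orderedPairs_mem_Ioo hp
  rw [bernWeight, abs_mul, abs_mul, abs_pow, abs_pow, abs_pow]
  exact mul_le_one₀ (mul_le_one₀ (pow_le_one₀ (abs_nonneg _) (abs_bern_le h1 h1'))
    (by positivity) (pow_le_one₀ (abs_nonneg _) (abs_bern_le h2 h2'))) (by positivity)
    (pow_le_one₀ (abs_nonneg _) (abs_bern_le h3 h3'))

/-- The same product as a polynomial in coordinates `u, v` at a vertex of the simplex, where the
three edges have lengths `u + v`, `u`, `v`. -/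
noncomputable def cornerWeight (e₁ e₂ e₃ : ℕ) : MvPolynomial (Fin 2) ℚ :=
  ((MvPolynomial.X 0 + MvPolynomial.X 1) ^ 2 - (MvPolynomial.X 0 + MvPolynomial.X 1) +
      MvPolynomial.C (1 / 6)) ^ e₁ *
    (MvPolynomial.X 0 ^ 2 - MvPolynomial.X 0 + MvPolynomial.C (1 / 6)) ^ e₂ *
    (MvPolynomial.X 1 ^ 2 - MvPolynomial.X 1 + MvPolynomial.C (1 / 6)) ^ e₃

theorem aeval_cornerWeight (e₁ e₂ e₃ : ℕ) (u v : ℝ) :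
    MvPolynomial.aeval ![u, v] (cornerWeight e₁ e₂ e₃) =
      bern (u + v) ^ e₁ * bern u ^ e₂ * bern v ^ e₃ := by
  simp [cornerWeight, bern]

/-- The contribution of one vertex of the simplex, as a function of `y = πτ₂`. -/
noncomputable def cornerSum (a b c e₁ e₂ e₃ : ℕ) (y : ℝ) : ℝ :=
  ∑' m : Freq a b c, termR a b c 0 0 m * simplexLaplace (cornerWeight e₁ e₂ e₃) y
    (sumAbs m.1 + sumAbs m.2.1) (sumAbs m.1 + sumAbs m.2.2)

theorem termR_eq_div (a b c α β : ℕ) (m : Freq a b c) :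
    termR a b c α β m = termR a b c 0 0 m /
      ((sumAbs m.1 + sumAbs m.2.1) ^ α * (sumAbs m.1 + sumAbs m.2.2) ^ β) := by
  unfold termR
  split_ifs
  · rw [pow_zero, pow_zero, mul_one, mul_one, div_div, mul_assoc (_ * _ * _)]
  · simp

/-- The rate vanishes if there are no edges, and is at least `1` otherwise, as the frequencies are
non-zero integers. -/
theorem isRate_sumAbs {a b : ℕ} (k : Fin a → {z : ℤ // z ≠ 0}) (h : Fin b → {z : ℤ // z ≠ 0}) :
    IsRate (decide (0 < a + b)) (sumAbs k + sumAbs h) := by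
  have hle : ∀ {j : ℕ} (k : Fin j → {z : ℤ // z ≠ 0}), (j : ℝ) ≤ sumAbs k := by
    intro j k
    calc (j : ℝ) = ∑ _i : Fin j, (1 : ℝ) := by simp
      _ ≤ sumAbs k := Finset.sum_le_sum fun i _ => one_le_abs_intCast _
  refine ⟨fun hs => ?_, fun hs => ?_⟩
  · have h1 : (1 : ℝ) ≤ a + b := by exact_mod_cast (by simpa using hs : 0 < a + b)
    linarith [hle k, hle h]
  · have h1 : a = 0 ∧ b = 0 := by simpa using hs
    obtain ⟨rfl, rfl⟩ := h1
    simp [sumAbs]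

/-- The expansion of the Laplace integrals is uniform in the rates, so it can be summed over the
frequencies; the coefficients are rational combinations of values of the sums `R`. -/
theorem hasLaurentPart_cornerSum (a b c e₁ e₂ e₃ : ℕ) :
    HasLaurentPart (3 / 2) fun τ => cornerSum a b c e₁ e₂ e₃ (Real.pi * τ.im) := by
  obtain ⟨L, C, h⟩ := hasExpansion_simplexLaplace (decide (0 < a + b)) (decide (0 < a + c))
    (cornerWeight e₁ e₂ e₃)
  let M : List (ℝ × ℤ) := L.map fun t =>
    ((t.1 : ℝ) * ∑' m, termR a b c t.2.1 t.2.2 m, -((t.2.1 + t.2.2 : ℕ) : ℤ))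
  have hM : ∀ y : ℝ, HasSum (fun m : Freq a b c => termR a b c 0 0 m *
      expansion L y (sumAbs m.1 + sumAbs m.2.1) (sumAbs m.1 + sumAbs m.2.2)) (monomialSum M y) := by
    intro y
    simp only [M]
    clear h
    induction L with
    | nil => simp [expansion, monomialSum, hasSum_zero]
    | cons t L ih =>
      have h1 := ((summable_termR a b c t.2.1 t.2.2).hasSum.mul_left
        ((t.1 : ℝ) * y ^ (-((t.2.1 + t.2.2 : ℕ) : ℤ)))).add ih
      simp only [monomialSum, List.map_cons, List.sum_cons] at h1 ⊢
      rw [mul_right_comm] at h1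
      refine h1.congr_fun fun m => ?_
      rw [termR_eq_div a b c t.2.1 t.2.2, expansion, List.map_cons, List.sum_cons, mul_add,
        zpow_neg, zpow_natCast, ← expansion]
      congr 1
      ring
  refine ⟨M, fun t ht => ?_, ?_⟩
  · obtain ⟨t', -, rfl⟩ := List.mem_map.1 ht
    simp only
    rw [← Rat.smul_def]
    exact conicalAlgebra01.smul_mem (tsum_termR_mem _ _ _ _ _) _
  · refine IsBigO.of_bound (C * ∑' m, termR a b c 0 0 m) ?_
    filter_upwards [tendsto_pi_mul_im.eventually (eventually_ge_atTop 1)] with τ hy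
    set y := Real.pi * τ.im
    have hbound : ∀ m : Freq a b c, ‖termR a b c 0 0 m * simplexLaplace (cornerWeight e₁ e₂ e₃) y
        (sumAbs m.1 + sumAbs m.2.1) (sumAbs m.1 + sumAbs m.2.2) - termR a b c 0 0 m *
          expansion L y (sumAbs m.1 + sumAbs m.2.1) (sumAbs m.1 + sumAbs m.2.2)‖ ≤
        termR a b c 0 0 m * (C * Real.exp (-(3 / 2 * y))) := by
      intro m
      rw [← mul_sub, norm_mul, Real.norm_of_nonneg (termR_nonneg _ _ _ _ _ _)]
      exact mul_le_mul_of_nonneg_left (h y _ _ hy (isRate_sumAbs _ _) (isRate_sumAbs _ _))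
        (termR_nonneg _ _ _ _ _ _)
    have hs := (summable_termR a b c 0 0).mul_right (C * Real.exp (-(3 / 2 * y)))
    have hs1 := Summable.of_norm_bounded hs hbound
    have hs2 : Summable fun m : Freq a b c => termR a b c 0 0 m *
        simplexLaplace (cornerWeight e₁ e₂ e₃) y
          (sumAbs m.1 + sumAbs m.2.1) (sumAbs m.1 + sumAbs m.2.2) := by
      refine (hs1.add (hM y).summable).congr fun m => ?_
      ring
    rw [cornerSum, ← (hM y).tsum_eq, ← hs2.tsum_sub (hM y).summable,
      Real.norm_of_nonneg (Real.exp_pos _).le]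
    refine (tsum_of_norm_bounded hs.hasSum hbound).trans (le_of_eq ?_)
    rw [tsum_mul_right]
    ring

/-! ### The three vertices -/

theorem edgeEnergy_zero {j : ℕ} {r : ℝ} (h : 0 < r) (m : Fin j → {z : ℤ // z ≠ 0}) :
    edgeEnergy r (fun _ => 0) m = sumAbs m * r := by
  simp [edgeEnergy, sumAbs, Finset.sum_mul, abs_of_pos h]

theorem edgeEnergy_neg_one {j : ℕ} {r : ℝ} (h : r < 1) (m : Fin j → {z : ℤ // z ≠ 0}) :
    edgeEnergy r (fun _ => -1) m = sumAbs m * (1 - r) := by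
  have : |((-1 : ℤ) : ℝ) + r| = 1 - r := by
    push_cast
    rw [abs_of_neg (by linarith)]
    ring
  simp only [edgeEnergy, sumAbs, Finset.sum_mul, this]

theorem setIntegral_orderedPairs_eq {φ : ℝ × ℝ → ℝ × ℝ} (hφ : MeasurePreserving φ volume volume)
    (hc : Continuous φ) (hi : Function.Injective φ) (hpre : φ ⁻¹' orderedPairs = cornerSimplex)
    (f : ℝ × ℝ → ℝ) : ∫ p in orderedPairs, f p = ∫ x in cornerSimplex, f (φ x) := by
  rw [← hpre, hφ.setIntegral_preimage_emb (hc.measurableEmbedding hi)]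

theorem measurePreserving_one_sub : MeasurePreserving (fun x : ℝ => 1 - x) volume volume :=
  Measure.measurePreserving_sub_left volume 1

theorem setIntegral_orderedPairs_corner_zero (f : ℝ × ℝ → ℝ) :
    ∫ p in orderedPairs, f p = ∫ x in cornerSimplex, f (x.1 + x.2, x.1) := by
  refine setIntegral_orderedPairs_eq (φ := fun x => (x.1 + x.2, x.1)) ?_ (by fun_prop) ?_ ?_ f
  · exact (Measure.measurePreserving_swap (μ := (volume : Measure ℝ))
      (ν := (volume : Measure ℝ))).comp (measurePreserving_prod_add volume volume)
  · rintro ⟨a, b⟩ ⟨c, d⟩ h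
    simp only [Prod.mk.injEq] at h ⊢
    exact ⟨h.2, by linarith⟩
  · ext x
    simp only [orderedPairs, cornerSimplex, Set.mem_preimage, Set.mem_ofPred_eq]
    constructor
    · rintro ⟨h1, h2, h3⟩
      exact ⟨h1, by linarith, h3⟩
    · rintro ⟨h1, h2, h3⟩
      exact ⟨h1, by linarith, h3⟩

theorem setIntegral_orderedPairs_corner_one (f : ℝ × ℝ → ℝ) :
    ∫ p in orderedPairs, f p = ∫ x in cornerSimplex, f (1 - x.1, 1 - (x.1 + x.2)) := by
  refine setIntegral_orderedPairs_eq (φ := fun x => (1 - x.1, 1 - (x.1 + x.2))) ?_ (by fun_prop)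
    ?_ ?_ f
  · exact (measurePreserving_one_sub.prod measurePreserving_one_sub).comp
      (measurePreserving_prod_add volume volume)
  · rintro ⟨a, b⟩ ⟨c, d⟩ h
    simp only [Prod.mk.injEq] at h ⊢
    exact ⟨by linarith, by linarith⟩
  · ext x
    simp only [orderedPairs, cornerSimplex, Set.mem_preimage, Set.mem_ofPred_eq]
    constructor
    · rintro ⟨h1, h2, h3⟩
      exact ⟨by linarith, by linarith, by linarith⟩
    · rintro ⟨h1, h2, h3⟩
      exact ⟨by linarith, by linarith, by linarith⟩

theorem setIntegral_orderedPairs_corner_mixed (f : ℝ × ℝ → ℝ) :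
    ∫ p in orderedPairs, f p = ∫ x in cornerSimplex, f (1 - x.1, x.2) := by
  refine setIntegral_orderedPairs_eq (φ := fun x => (1 - x.1, x.2)) ?_ (by fun_prop) ?_ ?_ f
  · exact measurePreserving_one_sub.prod (MeasurePreserving.id volume)
  · rintro ⟨a, b⟩ ⟨c, d⟩ h
    simp only [Prod.mk.injEq] at h ⊢
    exact ⟨by linarith, h.2⟩
  · ext x
    simp only [orderedPairs, cornerSimplex, Set.mem_preimage, Set.mem_ofPred_eq]
    constructor
    · rintro ⟨h1, h2, h3⟩
      exact ⟨by linarith, by linarith, by linarith⟩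
    · rintro ⟨h1, h2, h3⟩
      exact ⟨by linarith, by linarith, by linarith⟩

variable {a b c : ℕ}

theorem modeIntegral_corner_zero (e₁ e₂ e₃ : ℕ) (y : ℝ) (m : Freq a b c) :
    modeIntegral (bernWeight e₁ e₂ e₃) y (fun _ => 0, fun _ => 0, fun _ => 0) m =
      simplexLaplace (cornerWeight e₁ e₂ e₃) y (sumAbs m.1 + sumAbs m.2.1)
        (sumAbs m.1 + sumAbs m.2.2) := by
  rw [modeIntegral, orderedMeas, setIntegral_orderedPairs_corner_zero, simplexLaplace]
  refine setIntegral_congr_fun measurableSet_cornerSimplex fun x hx => ?_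
  obtain ⟨h1, h2, h3⟩ := hx
  simp only [bernWeight, aeval_cornerWeight, energy, add_sub_cancel_left]
  rw [edgeEnergy_zero (add_pos h1 h2), edgeEnergy_zero h1, edgeEnergy_zero h2]
  ring_nf

theorem modeIntegral_corner_one (e₁ e₂ e₃ : ℕ) (y : ℝ) (m : Freq a b c) :
    modeIntegral (bernWeight e₁ e₂ e₃) y (fun _ => -1, fun _ => -1, fun _ => 0) m =
      simplexLaplace (cornerWeight e₂ e₁ e₃) y (sumAbs m.2.1 + sumAbs m.1)
        (sumAbs m.2.1 + sumAbs m.2.2) := by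
  rw [modeIntegral, orderedMeas, setIntegral_orderedPairs_corner_one, simplexLaplace]
  refine setIntegral_congr_fun measurableSet_cornerSimplex fun x hx => ?_
  obtain ⟨h1, h2, h3⟩ := hx
  have e : 1 - x.1 - (1 - (x.1 + x.2)) = x.2 := by ring
  simp only [bernWeight, aeval_cornerWeight, energy, e, bern_one_sub]
  rw [edgeEnergy_neg_one (by linarith), edgeEnergy_neg_one (by linarith), edgeEnergy_zero h2]
  ring_nf

theorem modeIntegral_corner_mixed (e₁ e₂ e₃ : ℕ) (y : ℝ) (m : Freq a b c) :
    modeIntegral (bernWeight e₁ e₂ e₃) y (fun _ => -1, fun _ => 0, fun _ => -1) m =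
      simplexLaplace (cornerWeight e₃ e₁ e₂) y (sumAbs m.2.2 + sumAbs m.1)
        (sumAbs m.2.2 + sumAbs m.2.1) := by
  rw [modeIntegral, orderedMeas, setIntegral_orderedPairs_corner_mixed, simplexLaplace]
  refine setIntegral_congr_fun measurableSet_cornerSimplex fun x hx => ?_
  obtain ⟨h1, h2, h3⟩ := hx
  have e : 1 - x.1 - x.2 = 1 - (x.1 + x.2) := by ring
  simp only [bernWeight, aeval_cornerWeight, energy, e, bern_one_sub]
  rw [edgeEnergy_neg_one (by linarith), edgeEnergy_zero h2, edgeEnergy_neg_one (by linarith)]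
  ring_nf

/-- Sign change of a vector of non-zero integers. -/
def negVec {j : ℕ} : (Fin j → {z : ℤ // z ≠ 0}) ≃ (Fin j → {z : ℤ // z ≠ 0}) where
  toFun k i := ⟨-(k i : ℤ), neg_ne_zero.2 (k i).2⟩
  invFun k i := ⟨-(k i : ℤ), neg_ne_zero.2 (k i).2⟩
  left_inv k := by funext i; simp
  right_inv k := by funext i; simp

theorem total_negVec {j : ℕ} (k : Fin j → {z : ℤ // z ≠ 0}) : total (negVec k) = -total k := by
  simp [total, negVec]

theorem sumAbs_negVec {j : ℕ} (k : Fin j → {z : ℤ // z ≠ 0}) : sumAbs (negVec k) = sumAbs k := by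
  simp [sumAbs, negVec]

theorem prodAbs_negVec {j : ℕ} (k : Fin j → {z : ℤ // z ≠ 0}) :
    prodAbs (negVec k) = prodAbs k := by
  simp [prodAbs, negVec]

theorem tsum_corner_zero (e₁ e₂ e₃ : ℕ) (y : ℝ) :
    ∑' m : Freq a b c, balancedWeight m *
        modeIntegral (bernWeight e₁ e₂ e₃) y (fun _ => 0, fun _ => 0, fun _ => 0) m =
      cornerSum a b c e₁ e₂ e₃ y := by
  refine tsum_congr fun m => ?_
  rw [modeIntegral_corner_zero]
  congr 1
  simp only [balancedWeight, termR, pow_zero, mul_one, one_div]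
  refine if_congr ?_ rfl rfl
  constructor <;> rintro ⟨h1, h2⟩ <;> constructor <;> omega

/-- At the vertex `(1,1)` the edges `1` and `2` exchange their roles; the conditions on the totals
are those of `R` after a change of sign on the third edge. -/
theorem tsum_corner_one (e₁ e₂ e₃ : ℕ) (y : ℝ) :
    ∑' m : Freq a b c, balancedWeight m *
        modeIntegral (bernWeight e₁ e₂ e₃) y (fun _ => -1, fun _ => -1, fun _ => 0) m =
      cornerSum b a c e₂ e₁ e₃ y := by
  let σ : Freq a b c ≃ Freq b a c :=
    { toFun := fun m => (m.2.1, m.1, negVec m.2.2)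
      invFun := fun m => (m.2.1, m.1, negVec.symm m.2.2)
      left_inv := fun m => by simp
      right_inv := fun m => by simp }
  rw [cornerSum, ← σ.tsum_eq]
  refine tsum_congr fun m => ?_
  rw [modeIntegral_corner_one]
  simp only [σ, Equiv.coe_fn_mk, sumAbs_negVec]
  congr 1
  simp only [balancedWeight, termR, pow_zero, mul_one, one_div, total_negVec, prodAbs_negVec]
  rw [mul_comm (prodAbs m.1)]
  refine if_congr ?_ rfl rfl
  constructor <;> rintro ⟨h1, h2⟩ <;> constructor <;> omega

/-- At the vertex `(1,0)` the third edge is the long one; the conditions on the totals are those of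
`R` after a change of sign on the second edge. -/
theorem tsum_corner_mixed (e₁ e₂ e₃ : ℕ) (y : ℝ) :
    ∑' m : Freq a b c, balancedWeight m *
        modeIntegral (bernWeight e₁ e₂ e₃) y (fun _ => -1, fun _ => 0, fun _ => -1) m =
      cornerSum c a b e₃ e₁ e₂ y := by
  let σ : Freq a b c ≃ Freq c a b :=
    { toFun := fun m => (m.2.2, m.1, negVec m.2.1)
      invFun := fun m => (m.2.1, negVec.symm m.2.2, m.1)
      left_inv := fun m => by simp
      right_inv := fun m => by simp }
  rw [cornerSum, ← σ.tsum_eq]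
  refine tsum_congr fun m => ?_
  rw [modeIntegral_corner_mixed]
  simp only [σ, Equiv.coe_fn_mk, sumAbs_negVec]
  congr 1
  simp only [balancedWeight, termR, pow_zero, mul_one, one_div, total_negVec, prodAbs_negVec]
  rw [mul_comm (_ * _) (prodAbs m.2.2), ← mul_assoc]
  refine if_congr ?_ rfl rfl
  constructor <;> rintro ⟨h1, h2⟩ <;> constructor <;> omega

theorem hasLaurentPart_sectorIntegral (e₁ e₂ e₃ a b c : ℕ) :
    HasLaurentPart (3 / 2) (sectorIntegral (bernWeight e₁ e₂ e₃) a b c) := by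
  have h : HasLaurentPart (3 / 2) fun τ => ∑ n ∈ slowModes a b c, ∑' m : Freq a b c,
      balancedWeight m * modeIntegral (bernWeight e₁ e₂ e₃) (Real.pi * τ.im) n m := by
    refine HasLaurentPart.sum _ fun n hn => ?_
    simp only [slowModes, Finset.mem_insert, Finset.mem_singleton] at hn
    rcases hn with rfl | rfl | rfl
    · simp_rw [tsum_corner_zero]
      exact hasLaurentPart_cornerSum _ _ _ _ _ _
    · simp_rw [tsum_corner_one]
      exact hasLaurentPart_cornerSum _ _ _ _ _ _
    · simp_rw [tsum_corner_mixed]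
      exact hasLaurentPart_cornerSum _ _ _ _ _ _
  obtain ⟨C, hC⟩ := exists_abs_sectorIntegral_sub_le (measurable_bernWeight e₁ e₂ e₃)
    (abs_bernWeight_le e₁ e₂ e₃) a b c
  refine h.of_sub_isBigO (IsBigO.of_bound C ?_)
  filter_upwards [eventually_im_ge 4] with τ hτ
  rw [Real.norm_eq_abs, Real.norm_of_nonneg (Real.exp_pos _).le]
  exact hC τ hτ

/-! ### The modular graph function as a sum of integrals over the simplex -/

/-- The passage from the coordinates `((r₁,r₂),(s₁,s₂))` of a pair of points of the torus to
`((r₁,s₁),(r₂,s₂))`. -/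
theorem measurePreserving_transpose : MeasurePreserving
    (fun x : (ℝ × ℝ) × (ℝ × ℝ) => ((x.1.1, x.2.1), (x.1.2, x.2.2)))
    (squareMeas.prod squareMeas) (squareMeas.prod squareMeas) := by
  have a1 := measurePreserving_prodAssoc unitMeas unitMeas (unitMeas.prod unitMeas)
  have a2 := measurePreserving_prodAssoc unitMeas unitMeas unitMeas
  have s := Measure.measurePreserving_swap (μ := unitMeas) (ν := unitMeas)
  have i := MeasurePreserving.id unitMeas
  exact a1.symm.comp ((i.prod a2).comp ((i.prod (s.prod i)).comp ((i.prod a2.symm).comp a1)))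

theorem injective_transpose : Function.Injective
    (fun x : (ℝ × ℝ) × (ℝ × ℝ) => ((x.1.1, x.2.1), (x.1.2, x.2.2))) := by
  rintro ⟨⟨a, b⟩, c, d⟩ ⟨⟨a', b'⟩, c', d'⟩ h
  simp only [Prod.mk.injEq] at h ⊢
  tauto

theorem restrict_Icc_cube : (volume : Measure ((ℝ × ℝ) × (ℝ × ℝ))).restrict (Set.Icc 0 1) =
    squareMeas.prod squareMeas := by
  have e : (Set.Icc 0 1 : Set ((ℝ × ℝ) × (ℝ × ℝ))) =
      (Set.Icc (0 : ℝ) 1 ×ˢ Set.Icc (0 : ℝ) 1) ×ˢ (Set.Icc (0 : ℝ) 1 ×ˢ Set.Icc (0 : ℝ) 1) := by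
    rw [Set.Icc_prod_Icc, Set.Icc_prod_Icc]
    rfl
  have e' : unitMeas = volume.restrict (Set.Icc 0 1) := Measure.restrict_congr_set Ioo_ae_eq_Icc
  rw [e, squareMeas, e', Measure.prod_restrict, Measure.prod_restrict, ← Measure.volume_eq_prod,
    ← Measure.volume_eq_prod]

theorem squareMeas_eq_add : squareMeas = orderedMeas + orderedMeas.map Prod.swap := by
  have hm : MeasurableSet {p : ℝ × ℝ | p.2 < p.1} := measurableSet_lt measurable_snd measurable_fst
  have hswap : squareMeas.map Prod.swap = squareMeas :=
    (Measure.measurePreserving_swap (μ := unitMeas) (ν := unitMeas)).map_eq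
  -- the diagonal is a null set
  have hdiag : squareMeas {p : ℝ × ℝ | p.1 = p.2} = 0 := by
    have hd : MeasurableSet {p : ℝ × ℝ | p.1 = p.2} :=
      measurableSet_eq_fun measurable_fst measurable_snd
    rw [squareMeas, Measure.measure_prod_null hd]
    refine ae_of_all _ fun x => ?_
    have : Prod.mk x ⁻¹' {p : ℝ × ℝ | p.1 = p.2} = {x} := by
      ext y
      simp [eq_comm]
    simp only [this, Pi.zero_apply]
    have : unitMeas ≪ volume := Measure.absolutelyContinuous_of_le Measure.restrict_le_self
    exact this (by simp)
  conv_lhs => rw [← Measure.restrict_add_restrict_compl hm (μ := squareMeas)]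
  rw [← orderedMeas_eq]
  congr 1
  rw [orderedMeas_eq]
  conv_rhs =>
    rw [show {p : ℝ × ℝ | p.2 < p.1} = Prod.swap ⁻¹' {p : ℝ × ℝ | p.1 < p.2} from rfl,
      ← Measure.restrict_map measurable_swap
        (measurableSet_lt measurable_fst measurable_snd), hswap]
  refine Measure.restrict_congr_set ?_
  have : ∀ᵐ p ∂squareMeas, p.1 ≠ p.2 := by
    rw [ae_iff]
    simpa using hdiag
  filter_upwards [this] with p hp
  refine propext ⟨fun h => lt_of_le_of_ne (not_lt.1 h) hp, fun h => not_lt.2 (le_of_lt h)⟩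

/-- The integrand of `4^{l₁+l₂+l₃} D_{l₁,l₂,l₃}` at `((r₁,r₂),(s₁,s₂))`. -/
noncomputable def graphIntegrand (τ : ℂ) (l₁ l₂ l₃ : ℕ) (x : (ℝ × ℝ) × (ℝ × ℝ)) : ℝ :=
  (4 * propagator (torusPoint τ (x.1.1, x.2.1)) τ) ^ l₁ *
    (4 * propagator (torusPoint τ (x.1.2, x.2.2)) τ) ^ l₂ *
    (4 * propagator (torusPoint τ (x.1.1 - x.1.2, x.2.1 - x.2.2)) τ) ^ l₃

theorem four_mul_propagator (τ : ℂ) (r s : ℝ) : 4 * propagator (torusPoint τ (r, s)) τ =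
    2 * (Real.pi * τ.im) * bern r + fluct τ r s := by
  rw [fluct, bern]
  ring

theorem torusPoint_sub (τ : ℂ) (p q : ℝ × ℝ) :
    torusPoint τ p - torusPoint τ q = torusPoint τ (p.1 - q.1, p.2 - q.2) := by
  simp only [torusPoint]
  push_cast
  ring

theorem graphIntegrand_swap (τ : ℂ) (l₁ l₂ l₃ : ℕ) (x : (ℝ × ℝ) × (ℝ × ℝ)) :
    graphIntegrand τ l₁ l₂ l₃ (x.1.swap, x.2.swap) = graphIntegrand τ l₂ l₁ l₃ x := by
  have e : torusPoint τ (x.1.2 - x.1.1, x.2.2 - x.2.1) =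
      -torusPoint τ (x.1.1 - x.1.2, x.2.1 - x.2.2) := by
    simp only [torusPoint]
    push_cast
    ring
  simp only [graphIntegrand, Prod.fst_swap, Prod.snd_swap, e, propagator_neg]
  rw [mul_comm (_ ^ l₁)]

/-- The binomial expansion of the powers of `4G = 2πτ₂ B₂(r) + fluct`. -/
theorem graphIntegrand_eq_sum (τ : ℂ) (l₁ l₂ l₃ : ℕ) (x : (ℝ × ℝ) × (ℝ × ℝ)) :
    graphIntegrand τ l₁ l₂ l₃ x = ∑ i ∈ Finset.range (l₁ + 1), ∑ j ∈ Finset.range (l₂ + 1),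
      ∑ k ∈ Finset.range (l₃ + 1),
        ((l₁.choose i * l₂.choose j * l₃.choose k * 2 ^ (i + j + k) : ℕ) : ℝ) *
          ((Real.pi * τ.im) ^ (i + j + k) *
          (bernWeight i j k x.1 * fluctProd τ (l₁ - i) (l₂ - j) (l₃ - k) x.1 x.2)) := by
  simp only [graphIntegrand, four_mul_propagator, add_pow, Finset.sum_mul]
  refine Finset.sum_congr rfl fun i _ => ?_
  simp only [Finset.mul_sum, Finset.sum_mul]
  rw [Finset.sum_comm]
  refine Finset.sum_congr rfl fun j _ => ?_
  refine Finset.sum_congr rfl fun k _ => ?_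
  simp only [bernWeight, fluctProd]
  push_cast
  ring

theorem integrable_bernWeight_mul_fluctProd {τ : ℂ} (hτ : 0 < τ.im) (i j k a b c : ℕ) :
    Integrable (fun x : (ℝ × ℝ) × (ℝ × ℝ) => bernWeight i j k x.1 * fluctProd τ a b c x.1 x.2)
      (orderedMeas.prod squareMeas) := by
  refine (allLp_fluctProd hτ a b c).integrable.bdd_mul (c := 1)
    ((measurable_bernWeight i j k).comp measurable_fst).aestronglyMeasurable ?_
  have : ∀ᵐ x ∂orderedMeas.prod squareMeas, x.1 ∈ orderedPairs :=
    Measure.quasiMeasurePreserving_fst.ae ae_mem_orderedPairs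
  filter_upwards [this] with x hx
  exact abs_bernWeight_le i j k _ hx

theorem integrable_graphIntegrand {τ : ℂ} (hτ : 0 < τ.im) (l₁ l₂ l₃ : ℕ) :
    Integrable (graphIntegrand τ l₁ l₂ l₃) (orderedMeas.prod squareMeas) := by
  have : graphIntegrand τ l₁ l₂ l₃ = _ := funext (graphIntegrand_eq_sum τ l₁ l₂ l₃)
  rw [this]
  exact integrable_finsetSum _ fun i _ => integrable_finsetSum _ fun j _ =>
    integrable_finsetSum _ fun k _ =>
      ((integrable_bernWeight_mul_fluctProd hτ i j k _ _ _).const_mul _).const_mul _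

theorem integral_graphIntegrand {τ : ℂ} (hτ : 0 < τ.im) (l₁ l₂ l₃ : ℕ) :
    ∫ x, graphIntegrand τ l₁ l₂ l₃ x ∂orderedMeas.prod squareMeas =
      ∑ i ∈ Finset.range (l₁ + 1), ∑ j ∈ Finset.range (l₂ + 1), ∑ k ∈ Finset.range (l₃ + 1),
        ((l₁.choose i * l₂.choose j * l₃.choose k * 2 ^ (i + j + k) : ℕ) : ℚ) *
          ((Real.pi * τ.im) ^ (i + j + k) *
            sectorIntegral (bernWeight i j k) (l₁ - i) (l₂ - j) (l₃ - k) τ) := by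
  have hi : ∀ i j k, Integrable (fun x : (ℝ × ℝ) × (ℝ × ℝ) =>
      ((l₁.choose i * l₂.choose j * l₃.choose k * 2 ^ (i + j + k) : ℕ) : ℝ) *
          ((Real.pi * τ.im) ^ (i + j + k) *
          (bernWeight i j k x.1 * fluctProd τ (l₁ - i) (l₂ - j) (l₃ - k) x.1 x.2)))
      (orderedMeas.prod squareMeas) := fun i j k =>
    ((integrable_bernWeight_mul_fluctProd hτ i j k _ _ _).const_mul _).const_mul _
  simp_rw [graphIntegrand_eq_sum]
  rw [integral_finsetSum _ fun i _ => integrable_finsetSum _ fun j _ =>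
    integrable_finsetSum _ fun k _ => hi i j k]
  refine Finset.sum_congr rfl fun i _ => ?_
  rw [integral_finsetSum _ fun j _ => integrable_finsetSum _ fun k _ => hi i j k]
  refine Finset.sum_congr rfl fun j _ => ?_
  rw [integral_finsetSum _ fun k _ => hi i j k]
  refine Finset.sum_congr rfl fun k _ => ?_
  rw [integral_const_mul, integral_const_mul, sectorIntegral]
  push_cast
  rfl

/-- The errors `exp (-3πτ₂/2)` of the sector integrals absorb the powers of `τ₂` that come from the
polynomial part of the propagator. -/
theorem hasLaurentPart_integral_graphIntegrand (l₁ l₂ l₃ : ℕ) :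
    HasLaurentPart 1 fun τ => ∫ x, graphIntegrand τ l₁ l₂ l₃ x ∂orderedMeas.prod squareMeas := by
  have h : HasLaurentPart 1 fun τ : ℂ => ∑ i ∈ Finset.range (l₁ + 1),
      ∑ j ∈ Finset.range (l₂ + 1), ∑ k ∈ Finset.range (l₃ + 1),
        ((l₁.choose i * l₂.choose j * l₃.choose k * 2 ^ (i + j + k) : ℕ) : ℚ) *
          ((Real.pi * τ.im) ^ (i + j + k) *
            sectorIntegral (bernWeight i j k) (l₁ - i) (l₂ - j) (l₃ - k) τ) :=
    HasLaurentPart.sum _ fun i _ => HasLaurentPart.sum _ fun j _ => HasLaurentPart.sum _ fun k _ =>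
      ((hasLaurentPart_sectorIntegral i j k _ _ _).pow_mul (by norm_num) _).smul _
  refine h.congr ?_
  filter_upwards [eventually_im_ge 1] with τ hτ
  exact integral_graphIntegrand (by linarith) l₁ l₂ l₃

/-- The contributions of `r₂ < r₁` and `r₁ < r₂`; the second is brought to the first by exchanging
the two points, as the propagator is even. -/
theorem modularGraphFunction_eq {τ : ℂ} (hτ : 0 < τ.im) (l₁ l₂ l₃ : ℕ) :
    4 ^ (l₁ + l₂ + l₃) * modularGraphFunction l₁ l₂ l₃ τ =
      ∫ x, graphIntegrand τ l₁ l₂ l₃ x ∂orderedMeas.prod squareMeas +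
        ∫ x, graphIntegrand τ l₂ l₁ l₃ x ∂orderedMeas.prod squareMeas := by
  have hT : MeasurableEmbedding
      (fun x : (ℝ × ℝ) × (ℝ × ℝ) => ((x.1.1, x.2.1), (x.1.2, x.2.2))) :=
    Continuous.measurableEmbedding (by fun_prop) injective_transpose
  have hS : MeasurableEmbedding (fun x : (ℝ × ℝ) × (ℝ × ℝ) => (x.1.swap, x.2.swap)) := by
    refine Continuous.measurableEmbedding (by fun_prop) ?_
    rintro ⟨⟨a, b⟩, c, d⟩ ⟨⟨a', b'⟩, c', d'⟩ h
    simp only [Prod.swap_prod_mk, Prod.mk.injEq] at h ⊢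
    tauto
  have hSm : MeasurePreserving (fun x : (ℝ × ℝ) × (ℝ × ℝ) => (x.1.swap, x.2.swap))
      (orderedMeas.prod squareMeas) ((orderedMeas.map Prod.swap).prod squareMeas) :=
    MeasurePreserving.prod ⟨measurable_swap, rfl⟩
      (Measure.measurePreserving_swap (μ := unitMeas) (ν := unitMeas))
  have h1 : 4 ^ (l₁ + l₂ + l₃) * modularGraphFunction l₁ l₂ l₃ τ =
      ∫ x, graphIntegrand τ l₁ l₂ l₃ x ∂squareMeas.prod squareMeas := by
    rw [modularGraphFunction, restrict_Icc_cube, ← measurePreserving_transpose.integral_comp hT,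
      ← integral_const_mul]
    congr 1
    funext x
    rw [torusPoint_sub, graphIntegrand, mul_pow, mul_pow, mul_pow, pow_add, pow_add]
    ring
  have hI := integrable_graphIntegrand hτ l₁ l₂ l₃
  have hI' : Integrable (graphIntegrand τ l₁ l₂ l₃)
      ((orderedMeas.map Prod.swap).prod squareMeas) := by
    rw [← hSm.integrable_comp_emb hS]
    exact (integrable_graphIntegrand hτ l₂ l₁ l₃).congr
      (ae_of_all _ fun x => (graphIntegrand_swap τ l₁ l₂ l₃ x).symm)
  have hsq : squareMeas.prod squareMeas = orderedMeas.prod squareMeas +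
      (orderedMeas.map Prod.swap).prod squareMeas := by
    conv_lhs => rw [squareMeas_eq_add]
    rw [Measure.add_prod, ← squareMeas_eq_add]
  rw [h1, hsq, integral_add_measure hI hI', ← hSm.integral_comp hS]
  simp_rw [graphIntegrand_swap]

theorem hasLaurentPart_modularGraphFunction (l₁ l₂ l₃ : ℕ) :
    HasLaurentPart 1 fun τ => 4 ^ (l₁ + l₂ + l₃) * modularGraphFunction l₁ l₂ l₃ τ := by
  refine ((hasLaurentPart_integral_graphIntegrand l₁ l₂ l₃).add
    (hasLaurentPart_integral_graphIntegrand l₂ l₁ l₃)).congr ?_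
  filter_upwards [eventually_im_ge 1] with τ hτ
  exact modularGraphFunction_eq (by linarith) l₁ l₂ l₃

/-! ### The zero mode and uniqueness -/

theorem measurable_modularGraphFunction (l₁ l₂ l₃ : ℕ) {T : ℝ} (hT : 0 < T) :
    Measurable fun t : ℝ => modularGraphFunction l₁ l₂ l₃ (t + T * Complex.I) := by
  have him : ∀ t : ℝ, 0 < ((t : ℂ) + T * Complex.I).im := fun t => by simpa using hT
  have hp : ∀ f : ℝ × ((ℝ × ℝ) × (ℝ × ℝ)) → ℂ, Continuous f →
      Measurable fun x => propagator (f x) (x.1 + T * Complex.I) := fun f hf =>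
    measurable_propagator hf (by fun_prop) fun x => him x.1
  have hm : Measurable fun x : ℝ × ((ℝ × ℝ) × (ℝ × ℝ)) =>
      propagator (torusPoint (x.1 + T * Complex.I) x.2.1) (x.1 + T * Complex.I) ^ l₁ *
        propagator (torusPoint (x.1 + T * Complex.I) x.2.2) (x.1 + T * Complex.I) ^ l₂ *
        propagator (torusPoint (x.1 + T * Complex.I) x.2.1 -
          torusPoint (x.1 + T * Complex.I) x.2.2) (x.1 + T * Complex.I) ^ l₃ := by
    unfold torusPoint
    exact (((hp _ (by fun_prop)).pow_const _).mul ((hp _ (by fun_prop)).pow_const _)).mul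
      ((hp _ (by fun_prop)).pow_const _)
  exact (hm.stronglyMeasurable.integral_prod_right'
    (ν := (volume : Measure ((ℝ × ℝ) × (ℝ × ℝ))).restrict (Set.Icc 0 1))).measurable

/-- The uniform asymptotics imply those of the zero mode. -/
theorem isLaurentPart_of_asymptotics {l₁ l₂ l₃ : ℕ} {d : LaurentPolynomial ℝ}
    (h : (fun τ : ℂ => modularGraphFunction l₁ l₂ l₃ τ -
        laurentEval d (Real.pi * τ.im) / 4 ^ (l₁ + l₂ + l₃))
      =O[comap Complex.im atTop] fun τ : ℂ => Real.exp (-(Real.pi * τ.im))) :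
    IsLaurentPart l₁ l₂ l₃ d := by
  obtain ⟨C, hC⟩ := h.bound
  rw [eventually_comap, eventually_atTop] at hC
  obtain ⟨T₀, hT₀⟩ := hC
  have hb : ∀ T t : ℝ, T₀ ≤ T → ‖modularGraphFunction l₁ l₂ l₃ (t + T * Complex.I) -
      laurentEval d (Real.pi * T) / 4 ^ (l₁ + l₂ + l₃)‖ ≤ C * ‖Real.exp (-(Real.pi * T))‖ := by
    intro T t hT
    have := hT₀ T hT (t + T * Complex.I) (by simp)
    simpa using this
  have hint : ∀ T : ℝ, max T₀ 1 ≤ T → IntervalIntegrable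
      (fun t : ℝ => modularGraphFunction l₁ l₂ l₃ (t + T * Complex.I)) volume 0 1 := by
    intro T hT
    have hm := measurable_modularGraphFunction l₁ l₂ l₃ (T := T)
      (by linarith [(le_max_right T₀ 1).trans hT])
    refine (intervalIntegrable_const (c := C * ‖Real.exp (-(Real.pi * T))‖ +
      ‖laurentEval d (Real.pi * T) / 4 ^ (l₁ + l₂ + l₃)‖)).mono_fun hm.aestronglyMeasurable
      (ae_of_all _ fun t => ?_)
    have h1 := hb T t ((le_max_left _ _).trans hT)
    rw [Real.norm_of_nonneg (add_nonneg ((norm_nonneg _).trans h1) (norm_nonneg _))]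
    have h2 := norm_sub_norm_le (modularGraphFunction l₁ l₂ l₃ (t + T * Complex.I))
      (laurentEval d (Real.pi * T) / 4 ^ (l₁ + l₂ + l₃))
    linarith
  refine ⟨h, ?_, ?_⟩
  · filter_upwards [eventually_ge_atTop (max T₀ 1)] with T hT
    exact hint T hT
  · refine IsBigO.of_bound C ?_
    filter_upwards [eventually_ge_atTop (max T₀ 1)] with T hT
    have e : (∫ t in (0 : ℝ)..1, modularGraphFunction l₁ l₂ l₃ (t + T * Complex.I)) -
        laurentEval d (Real.pi * T) / 4 ^ (l₁ + l₂ + l₃) =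
        ∫ t in (0 : ℝ)..1, (modularGraphFunction l₁ l₂ l₃ (t + T * Complex.I) -
          laurentEval d (Real.pi * T) / 4 ^ (l₁ + l₂ + l₃)) := by
      rw [intervalIntegral.integral_sub (hint T hT) intervalIntegrable_const]
      simp
    rw [e]
    refine (intervalIntegral.norm_integral_le_of_norm_le_const fun t _ =>
      hb T t ((le_max_left _ _).trans hT)).trans ?_
    simp

theorem laurentEval_add (d d' : LaurentPolynomial ℝ) (y : ℝ) :
    laurentEval (d + d') y = laurentEval d y + laurentEval d' y := by
  unfold laurentEval
  rw [AddMonoidAlgebra.coeff_add]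
  exact Finsupp.sum_add_index' (by simp) (by intros; ring)

theorem laurentEval_neg (d : LaurentPolynomial ℝ) (y : ℝ) :
    laurentEval (-d) y = -laurentEval d y := by
  have h := laurentEval_add d (-d) y
  rw [add_neg_cancel] at h
  have h0 : laurentEval 0 y = 0 := by simp [laurentEval]
  linarith

/-- A list of coefficients and exponents as a Laurent polynomial. -/
theorem exists_laurentEval_eq (L : List (ℝ × ℤ)) (hL : ∀ t ∈ L, t.1 ∈ conicalAlgebra01) :
    ∃ d : LaurentPolynomial ℝ, (∀ n, d.coeff n ∈ conicalAlgebra01) ∧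
      ∀ y, laurentEval d y = monomialSum L y := by
  induction L with
  | nil => exact ⟨0, fun n => by simp, fun y => by simp [laurentEval, monomialSum]⟩
  | cons t L ih =>
    obtain ⟨d, hd, hy⟩ := ih fun t' ht' => hL t' (List.mem_cons_of_mem _ ht')
    refine ⟨AddMonoidAlgebra.single t.2 t.1 + d, fun n => ?_, fun y => ?_⟩
    · rw [AddMonoidAlgebra.coeff_add, Finsupp.add_apply, AddMonoidAlgebra.coeff_single,
        Finsupp.single_apply]
      refine add_mem ?_ (hd n)
      split_ifs
      · exact hL t List.mem_cons_self
      · exact zero_mem _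
    · rw [laurentEval_add, hy, laurentEval, AddMonoidAlgebra.coeff_single,
        Finsupp.sum_single_index (by simp)]
      simp [monomialSum]

/-- A Laurent polynomial that decays exponentially vanishes. -/
theorem eq_zero_of_isBigO_exp {d : LaurentPolynomial ℝ}
    (h : laurentEval d =O[atTop] fun y => Real.exp (-y)) : d = 0 := by
  by_contra hd
  have hne : d.coeff.support.Nonempty := by
    rw [Finsupp.support_nonempty_iff]
    exact fun h0 => hd (AddMonoidAlgebra.coeff_eq_zero.1 h0)
  set N := d.coeff.support.max' hne with hN
  -- after division by the leading monomial the limit at infinity is the leading coefficient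
  have hlim : Tendsto (fun y => laurentEval d y * y ^ (-N)) atTop (𝓝 (d.coeff N)) := by
    have e : d.coeff N = ∑ n ∈ d.coeff.support, if n = N then d.coeff n else 0 := by
      rw [Finset.sum_ite_eq' d.coeff.support N, if_pos (Finset.max'_mem _ hne)]
    rw [e]
    have e2 : (fun y => laurentEval d y * y ^ (-N)) =ᶠ[atTop] fun y =>
        ∑ n ∈ d.coeff.support, d.coeff n * y ^ (n - N) := by
      filter_upwards [eventually_gt_atTop 0] with y hy
      rw [laurentEval, Finsupp.sum, Finset.sum_mul]
      refine Finset.sum_congr rfl fun n _ => ?_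
      rw [mul_assoc, ← zpow_add₀ hy.ne', sub_eq_add_neg]
    refine Tendsto.congr' e2.symm (tendsto_finsetSum _ fun n hn => ?_)
    split_ifs with hnN
    · simp [hnN]
    · have hlt : n < N := lt_of_le_of_ne (Finset.le_max' _ _ hn) hnN
      have : Tendsto (fun y : ℝ => y ^ (n - N)) atTop (𝓝 0) :=
        tendsto_zpow_atTop_zero (by omega)
      simpa using this.const_mul (d.coeff n)
  -- by the exponential decay, the same limit is zero
  have hzero : Tendsto (fun y => laurentEval d y * y ^ (-N)) atTop (𝓝 0) := by
    refine (h.mul (isBigO_refl (fun y : ℝ => y ^ (-N)) atTop)).trans_tendsto ?_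
    have h1 := tendsto_rpow_mul_exp_neg_mul_atTop_nhds_zero (-N : ℝ) 1 one_pos
    refine h1.congr fun y => ?_
    rw [neg_one_mul, mul_comm, ← Real.rpow_intCast]
    push_cast
    rfl
  exact (Finsupp.mem_support_iff.1 (Finset.max'_mem _ hne)) (tendsto_nhds_unique hlim hzero)

theorem IsLaurentPart.unique {l₁ l₂ l₃ : ℕ} {d d' : LaurentPolynomial ℝ}
    (h : IsLaurentPart l₁ l₂ l₃ d) (h' : IsLaurentPart l₁ l₂ l₃ d') : d' = d := by
  have hsub := h.asymptotics.sub h'.asymptotics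
  have ht : Tendsto (fun y : ℝ => ((y / Real.pi : ℝ) : ℂ) * Complex.I) atTop
      (comap Complex.im atTop) := by
    rw [tendsto_comap_iff]
    refine (tendsto_id.atTop_div_const Real.pi_pos).congr fun y => ?_
    simp
  have h2 := (hsub.comp_tendsto ht).const_mul_left ((4 : ℝ) ^ (l₁ + l₂ + l₃))
  refine sub_eq_zero.1 (eq_zero_of_isBigO_exp ?_)
  refine h2.congr (fun y => ?_) (fun y => ?_)
  · simp only [Function.comp_apply]
    rw [sub_eq_add_neg d' d, laurentEval_add, laurentEval_neg]
    have : Real.pi * (((y / Real.pi : ℝ) : ℂ) * Complex.I).im = y := by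
      rw [Complex.im_ofReal_mul, Complex.I_im]
      field_simp
    rw [this]
    field_simp
    ring
  · simp only [Function.comp_apply]
    have : Real.pi * (((y / Real.pi : ℝ) : ℂ) * Complex.I).im = y := by
      rw [Complex.im_ofReal_mul, Complex.I_im]
      field_simp
    rw [this]

theorem exists_isLaurentPart (l₁ l₂ l₃ : ℕ) : ∃ d : LaurentPolynomial ℝ,
    IsLaurentPart l₁ l₂ l₃ d ∧ ∀ n, d.coeff n ∈ conicalAlgebra01 := by
  obtain ⟨L, hL, h⟩ := hasLaurentPart_modularGraphFunction l₁ l₂ l₃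
  obtain ⟨d, hd, hy⟩ := exists_laurentEval_eq L hL
  refine ⟨d, isLaurentPart_of_asymptotics ?_, hd⟩
  refine (h.const_mul_left ((4 : ℝ) ^ (l₁ + l₂ + l₃))⁻¹).congr (fun τ => ?_) fun τ => ?_
  · rw [hy]
    field_simp
  · rw [one_mul]

end Asymptotics

end ThreePoint

theorem mainTheorem2 :
    (∀ l₁ l₂ l₃ : ℕ, ∃ d : LaurentPolynomial ℝ,
      ThreePoint.IsLaurentPart l₁ l₂ l₃ d ∧
      (∀ d' : LaurentPolynomial ℝ, ThreePoint.IsLaurentPart l₁ l₂ l₃ d' → d' = d) ∧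
      ∀ n : ℤ, d.coeff n ∈ ThreePoint.conicalAlgebra01) ∧
    (∀ m₁ m₂ m₃ α β : ℕ, 1 ≤ m₁ → 1 ≤ m₂ → 1 ≤ m₃ →
      Summable (ThreePoint.termR m₁ m₂ m₃ α β) ∧
      Summable (ThreePoint.termZero m₁ m₂ m₃ α β) ∧
      Summable (ThreePoint.termPos m₁ m₂ m₃ α β) ∧
      ∑' p, ThreePoint.termR m₁ m₂ m₃ α β p =
        ((m₁.factorial * m₂.factorial * m₃.factorial : ℕ) : ℝ) /
            (2 : ℝ) ^ (((α + β + m₁ + m₂ + m₃ : ℕ) : ℤ) - 6) *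
          ∑' l, ThreePoint.termZero m₁ m₂ m₃ α β l +
        2 * (((m₁.factorial * m₂.factorial * m₃.factorial : ℕ) : ℝ) / 2 ^ (α + β) *
          ∑' x, ThreePoint.termPos m₁ m₂ m₃ α β x) ∧
      ∑' p, ThreePoint.termR m₁ m₂ m₃ α β p ∈ ThreePoint.conicalAlgebra01) := by
  refine ⟨fun l₁ l₂ l₃ => ?_, fun m₁ m₂ m₃ α β h₁ h₂ h₃ => ?_⟩
  · obtain ⟨d, hd, hB⟩ := ThreePoint.exists_isLaurentPart l₁ l₂ l₃
    exact ⟨d, hd, fun d' hd' => hd.unique hd', hB⟩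
  · obtain ⟨h0, hpos, heq⟩ := ThreePoint.explicit_formula m₁ m₂ m₃ α β h₁ h₂ h₃
    exact ⟨ThreePoint.summable_termR m₁ m₂ m₃ α β, h0, hpos, heq,
      ThreePoint.tsum_termR_mem m₁ m₂ m₃ α β⟩
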